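/- For $m,l\in\mathbb R$ let $M^3_{m,l}$ be the BCV space, i.e. the set $\{(x,y,z)\in\mathbb R^3 : F>0\}$, $F=1+m(x^2+y^2)$, with the Riemannian metric $$g=\frac{dx^2+dy^2}{F^2}+\Big(dz+\frac l2\,\frac{y\,dx-x\,dy}{F}\Big)^2 .$$ For $m<0$, $l=0$ this is $H^2(4m)\times\mathbb R$ (the disc model of the hyperbolic plane of curvature $4m$, times a line); for $m<0$, $l\neq0$ it is the model denoted $\widetilde{SL}(2,\mathbb R)$. A smooth map $\pi:(M,g)\to(N,h)$ is harmonic if its tension field $\tau(\pi)=\mathrm{Trace}_g\nabla d\pi$ vanishes, biharmonic if its bitension field $$\tau^2(\pi)=\mathrm{Trace}_g\big(\nabla^\pi\nabla^\pi-\nabla^\pi_{\nabla^M}\big)\tau(\pi)-\mathrm{Trace}_g R^N(d\pi,\tau(\pi))d\pi$$ vanishes, where $R^N(X,Y)=[\nabla^N_X,\nabla^N_Y]-\nabla^N_{[X,Y]}$, and proper biharmonic if it is biharmonic but not harmonic. A Riemannian submersion is a smooth surjective submersion whose differential preserves the inner products of horizontal vectors. **Theorem.** Proper biharmonic Riemannian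 submersions from a BCV 3-space onto a surface exist exactly in the two cases $H^2(4m)\times\mathbb R\to\mathbb R^2$ and $\widetilde{SL}(2,\mathbb R)\to\mathbb R^2$. Precisely: 1. If $\pi:M^3_{m,l}\to(N^2,h)$ is a proper biharmonic Riemannian submersion onto a smooth Riemannian surface, then either $m<0$ and $l=0$, or $m<0$ and $l\neq0$; and in both cases $(N^2,h)$ is locally isometric to the Euclidean plane $\mathbb R^2$. 2. Conversely, for all $m,l$ with $m<0$ and $l=0$, and for all $m,l$ with $m<0$ and $l\neq0$, there is a proper biharmonic Riemannian submersion from $M^3_{m,l}$ onto the Euclidean plane $\mathbb R^2$. -/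

import Mathlib

open scoped Manifold ContDiff

noncomputable section

namespace BCV

/-! ### Riemannian geometry in coordinates

A Riemannian metric on an open subset of `ℝⁿ` is given by its matrix of components
`g x i j = g(∂ᵢ, ∂ⱼ)` at the point `x`. -/

/-- The `i`-th partial derivative of a real function on `ℝⁿ`. -/
def pd {n : ℕ} (i : Fin n) (f : EuclideanSpace ℝ (Fin n) → ℝ) (x : EuclideanSpace ℝ (Fin n)) : ℝ :=
  fderiv ℝ f x (EuclideanSpace.single i 1)

/-- The Christoffel symbol `Γᵏᵢⱼ` of the Levi-Civita connection: `∇_{∂ᵢ} ∂ⱼ = ∑ₖ Γᵏᵢⱼ ∂ₖ`. -/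
def christoffel {n : ℕ} (g : EuclideanSpace ℝ (Fin n) → Matrix (Fin n) (Fin n) ℝ)
    (k i j : Fin n) (x : EuclideanSpace ℝ (Fin n)) : ℝ :=
  (1 / 2) * ∑ l, (g x)⁻¹ k l *
    (pd i (fun y => g y j l) x + pd j (fun y => g y i l) x - pd l (fun y => g y i j) x)

/-- The components of the curvature operator `R(X, Y) = [∇_X, ∇_Y] - ∇_{[X, Y]}`:
`R(∂ₐ, ∂_b) ∂_c = ∑_d (curvature h d a b c) ∂_d`. -/
def curvature {k : ℕ} (h : EuclideanSpace ℝ (Fin k) → Matrix (Fin k) (Fin k) ℝ)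
    (d a b c : Fin k) (y : EuclideanSpace ℝ (Fin k)) : ℝ :=
  pd a (christoffel h d b c) y - pd b (christoffel h d a c) y +
    ∑ e, (christoffel h d a e y * christoffel h e b c y -
      christoffel h d b e y * christoffel h e a c y)

/-- The covariant derivative `∇^f_{∂ᵢ} V` of a vector field `V` along the map `f`, for the pull-back
of the Levi-Civita connection of `h`. -/
def pullbackDeriv {n k : ℕ} (h : EuclideanSpace ℝ (Fin k) → Matrix (Fin k) (Fin k) ℝ)
    (f : EuclideanSpace ℝ (Fin n) → EuclideanSpace ℝ (Fin k)) (i : Fin n)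
    (V : EuclideanSpace ℝ (Fin n) → Fin k → ℝ) (x : EuclideanSpace ℝ (Fin n)) (α : Fin k) : ℝ :=
  pd i (fun y => V y α) x +
    ∑ β, ∑ γ, christoffel h α β γ (f x) * pd i (fun y => f y β) x * V x γ

/-- The tension field `τ(f) = Trace_g ∇ df`
`= ∑ᵢⱼ gⁱʲ (∇^f_{∂ᵢ} (df ∂ⱼ) - df (∇_{∂ᵢ} ∂ⱼ))`. -/
def tension {n k : ℕ} (g : EuclideanSpace ℝ (Fin n) → Matrix (Fin n) (Fin n) ℝ)
    (h : EuclideanSpace ℝ (Fin k) → Matrix (Fin k) (Fin k) ℝ)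
    (f : EuclideanSpace ℝ (Fin n) → EuclideanSpace ℝ (Fin k))
    (x : EuclideanSpace ℝ (Fin n)) (α : Fin k) : ℝ :=
  ∑ i, ∑ j, (g x)⁻¹ i j *
    (pullbackDeriv h f i (fun z β => pd j (fun y => f y β) z) x α -
      ∑ l, christoffel g l i j x * pd l (fun y => f y α) x)

/-- `Trace_g (∇^f ∇^f - ∇^f_{∇}) V` for a vector field `V` along `f`. -/
def roughLaplacian {n k : ℕ} (g : EuclideanSpace ℝ (Fin n) → Matrix (Fin n) (Fin n) ℝ)
    (h : EuclideanSpace ℝ (Fin k) → Matrix (Fin k) (Fin k) ℝ)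
    (f : EuclideanSpace ℝ (Fin n) → EuclideanSpace ℝ (Fin k))
    (V : EuclideanSpace ℝ (Fin n) → Fin k → ℝ)
    (x : EuclideanSpace ℝ (Fin n)) (α : Fin k) : ℝ :=
  ∑ i, ∑ j, (g x)⁻¹ i j *
    (pullbackDeriv h f i (pullbackDeriv h f j V) x α -
      ∑ l, christoffel g l i j x * pullbackDeriv h f l V x α)

/-- The bitension field
`τ²(f) = Trace_g (∇^f ∇^f - ∇^f_{∇}) τ(f) - Trace_g R^h(df, τ(f)) df`. -/
def bitension {n k : ℕ} (g : EuclideanSpace ℝ (Fin n) → Matrix (Fin n) (Fin n) ℝ)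
    (h : EuclideanSpace ℝ (Fin k) → Matrix (Fin k) (Fin k) ℝ)
    (f : EuclideanSpace ℝ (Fin n) → EuclideanSpace ℝ (Fin k))
    (x : EuclideanSpace ℝ (Fin n)) (α : Fin k) : ℝ :=
  roughLaplacian g h f (tension g h f) x α -
    ∑ i, ∑ j, (g x)⁻¹ i j * ∑ β, ∑ γ, ∑ δ, curvature h α β γ δ (f x) *
      pd i (fun y => f y β) x * tension g h f x γ * pd j (fun y => f y δ) x

/-! ### The Bianchi-Cartan-Vranceanu spaces -/

/-- The function `F = 1 + m (x² + y²)`. -/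
def bcvF (m : ℝ) (p : EuclideanSpace ℝ (Fin 3)) : ℝ :=
  1 + m * (p 0 ^ 2 + p 1 ^ 2)

/-- The underlying space of `M³_{m,l}`: the set of points `(x, y, z)` with `1 + m (x² + y²) > 0`. It
is all of `ℝ³` if `m ≥ 0`, and a solid cylinder (disc times line) if `m < 0`. -/
def bcvDomain (m : ℝ) : Set (EuclideanSpace ℝ (Fin 3)) :=
  {p | 0 < bcvF m p}

/-- The components of the one-form `dz + (l / 2) (y dx - x dy) / F`. -/
def bcvForm (m l : ℝ) (p : EuclideanSpace ℝ (Fin 3)) : Fin 3 → ℝ :=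
  ![l / 2 * p 1 / bcvF m p, -(l / 2 * p 0 / bcvF m p), 1]

/-- The metric `(dx² + dy²) / F² + (dz + (l / 2) (y dx - x dy) / F)²` of `M³_{m,l}`. -/
def bcvMetric (m l : ℝ) (p : EuclideanSpace ℝ (Fin 3)) : Matrix (Fin 3) (Fin 3) ℝ :=
  Matrix.diagonal ![1 / bcvF m p ^ 2, 1 / bcvF m p ^ 2, 0] +
    Matrix.vecMulVec (bcvForm m l p) (bcvForm m l p)

/-! ### Riemannian surfaces and maps into them -/

section Surface

variable {N : Type*} [TopologicalSpace N] [ChartedSpace (EuclideanSpace ℝ (Fin 2)) N]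
  [IsManifold 𝓘(ℝ, EuclideanSpace ℝ (Fin 2)) ∞ N]

/-- The components `h(∂ᵢ, ∂ⱼ)` of a Riemannian metric `h` on a surface in the local coordinates `φ`,
as functions on the target of `φ`. -/
def chartMetric
    (h : Bundle.ContMDiffRiemannianMetric 𝓘(ℝ, EuclideanSpace ℝ (Fin 2)) ∞
      (EuclideanSpace ℝ (Fin 2))
      (fun x : N => TangentSpace 𝓘(ℝ, EuclideanSpace ℝ (Fin 2)) x))
    (φ : OpenPartialHomeomorph N (EuclideanSpace ℝ (Fin 2)))
    (y : EuclideanSpace ℝ (Fin 2)) : Matrix (Fin 2) (Fin 2) ℝ :=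
  fun i j => h.inner (φ.symm y)
    (mfderiv 𝓘(ℝ, EuclideanSpace ℝ (Fin 2)) 𝓘(ℝ, EuclideanSpace ℝ (Fin 2)) φ.symm y
      (EuclideanSpace.single i (1 : ℝ) : EuclideanSpace ℝ (Fin 2)))
    (mfderiv 𝓘(ℝ, EuclideanSpace ℝ (Fin 2)) 𝓘(ℝ, EuclideanSpace ℝ (Fin 2)) φ.symm y
      (EuclideanSpace.single j (1 : ℝ) : EuclideanSpace ℝ (Fin 2)))

/-- The surface is locally isometric to the Euclidean plane: around every point there are local
coordinates `(u, v)` in which the metric is `du² + dv²`. -/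
def IsLocallyFlat
    (h : Bundle.ContMDiffRiemannianMetric 𝓘(ℝ, EuclideanSpace ℝ (Fin 2)) ∞
      (EuclideanSpace ℝ (Fin 2))
      (fun x : N => TangentSpace 𝓘(ℝ, EuclideanSpace ℝ (Fin 2)) x)) : Prop :=
  ∀ q : N, ∃ φ ∈ IsManifold.maximalAtlas 𝓘(ℝ, EuclideanSpace ℝ (Fin 2)) ∞ N,
    q ∈ φ.source ∧ ∀ y ∈ φ.target, chartMetric h φ y = 1

/-- `v` is horizontal at `p`: orthogonal, for the inner product `g p`, to the kernel of the
differential of `π` at `p`. -/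
def IsHorizontal (g : EuclideanSpace ℝ (Fin 3) → Matrix (Fin 3) (Fin 3) ℝ)
    (π : EuclideanSpace ℝ (Fin 3) → N) (p v : EuclideanSpace ℝ (Fin 3)) : Prop :=
  ∀ u : EuclideanSpace ℝ (Fin 3),
    mfderiv 𝓘(ℝ, EuclideanSpace ℝ (Fin 3)) 𝓘(ℝ, EuclideanSpace ℝ (Fin 2)) π p u = 0 →
      ∑ i, ∑ j, g p i j * v i * u j = 0

/-- `π : (U, g) → (N, h)` is a Riemannian submersion of the open set `U ⊆ ℝ³` onto the surface `N`: a
smooth surjective submersion whose differential preserves inner products of horizontal vectors.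
(Values of `π` outside `U` play no role.) -/
structure IsRiemannianSubmersion (U : Set (EuclideanSpace ℝ (Fin 3)))
    (g : EuclideanSpace ℝ (Fin 3) → Matrix (Fin 3) (Fin 3) ℝ)
    (h : Bundle.ContMDiffRiemannianMetric 𝓘(ℝ, EuclideanSpace ℝ (Fin 2)) ∞
      (EuclideanSpace ℝ (Fin 2))
      (fun x : N => TangentSpace 𝓘(ℝ, EuclideanSpace ℝ (Fin 2)) x))
    (π : EuclideanSpace ℝ (Fin 3) → N) : Prop where
  smooth : ContMDiffOn 𝓘(ℝ, EuclideanSpace ℝ (Fin 3)) 𝓘(ℝ, EuclideanSpace ℝ (Fin 2)) ∞ π U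
  surjOn : Set.SurjOn π U Set.univ
  submersion : ∀ p ∈ U, Function.Surjective
    (mfderiv 𝓘(ℝ, EuclideanSpace ℝ (Fin 3)) 𝓘(ℝ, EuclideanSpace ℝ (Fin 2)) π p)
  isometry : ∀ p ∈ U, ∀ v w : EuclideanSpace ℝ (Fin 3),
    IsHorizontal g π p v → IsHorizontal g π p w →
      h.inner (π p)
        (mfderiv 𝓘(ℝ, EuclideanSpace ℝ (Fin 3)) 𝓘(ℝ, EuclideanSpace ℝ (Fin 2)) π p v)
        (mfderiv 𝓘(ℝ, EuclideanSpace ℝ (Fin 3)) 𝓘(ℝ, EuclideanSpace ℝ (Fin 2)) π p w) =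
      ∑ i, ∑ j, g p i j * v i * w j

/-- `π : (U, g) → (N, h)` is harmonic: its tension field, computed in the charts of `N`, vanishes. -/
def IsHarmonic (U : Set (EuclideanSpace ℝ (Fin 3)))
    (g : EuclideanSpace ℝ (Fin 3) → Matrix (Fin 3) (Fin 3) ℝ)
    (h : Bundle.ContMDiffRiemannianMetric 𝓘(ℝ, EuclideanSpace ℝ (Fin 2)) ∞
      (EuclideanSpace ℝ (Fin 2))
      (fun x : N => TangentSpace 𝓘(ℝ, EuclideanSpace ℝ (Fin 2)) x))
    (π : EuclideanSpace ℝ (Fin 3) → N) : Prop :=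
  ∀ φ ∈ atlas (EuclideanSpace ℝ (Fin 2)) N, ∀ p ∈ U, π p ∈ φ.source →
    tension g (chartMetric h φ) (fun x => φ (π x)) p = 0

/-- `π : (U, g) → (N, h)` is biharmonic: its bitension field, computed in the charts of `N`,
vanishes. -/
def IsBiharmonic (U : Set (EuclideanSpace ℝ (Fin 3)))
    (g : EuclideanSpace ℝ (Fin 3) → Matrix (Fin 3) (Fin 3) ℝ)
    (h : Bundle.ContMDiffRiemannianMetric 𝓘(ℝ, EuclideanSpace ℝ (Fin 2)) ∞
      (EuclideanSpace ℝ (Fin 2))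
      (fun x : N => TangentSpace 𝓘(ℝ, EuclideanSpace ℝ (Fin 2)) x))
    (π : EuclideanSpace ℝ (Fin 3) → N) : Prop :=
  ∀ φ ∈ atlas (EuclideanSpace ℝ (Fin 2)) N, ∀ p ∈ U, π p ∈ φ.source →
    bitension g (chartMetric h φ) (fun x => φ (π x)) p = 0

/-- Proper biharmonic: biharmonic but not harmonic. -/
def IsProperBiharmonic (U : Set (EuclideanSpace ℝ (Fin 3)))
    (g : EuclideanSpace ℝ (Fin 3) → Matrix (Fin 3) (Fin 3) ℝ)
    (h : Bundle.ContMDiffRiemannianMetric 𝓘(ℝ, EuclideanSpace ℝ (Fin 2)) ∞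
      (EuclideanSpace ℝ (Fin 2))
      (fun x : N => TangentSpace 𝓘(ℝ, EuclideanSpace ℝ (Fin 2)) x))
    (π : EuclideanSpace ℝ (Fin 3) → N) : Prop :=
  IsBiharmonic U g h π ∧ ¬ IsHarmonic U g h π

end Surface

/-- The standard Riemannian metric of the Euclidean plane. -/
def euclideanPlane : Bundle.ContMDiffRiemannianMetric 𝓘(ℝ, EuclideanSpace ℝ (Fin 2)) ∞
    (EuclideanSpace ℝ (Fin 2))
    (fun x : EuclideanSpace ℝ (Fin 2) =>
      TangentSpace 𝓘(ℝ, EuclideanSpace ℝ (Fin 2)) x) where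
  inner := (riemannianMetricVectorSpace (EuclideanSpace ℝ (Fin 2))).inner
  symm := (riemannianMetricVectorSpace (EuclideanSpace ℝ (Fin 2))).symm
  pos := (riemannianMetricVectorSpace (EuclideanSpace ℝ (Fin 2))).pos
  isVonNBounded := (riemannianMetricVectorSpace (EuclideanSpace ℝ (Fin 2))).isVonNBounded
  contMDiff := (riemannianMetricVectorSpace (EuclideanSpace ℝ (Fin 2))).contMDiff.of_le le_top

end BCV

end

/-!
# Proper biharmonic Riemannian submersions from BCV spaces

Let `π : M³_{m,l} → N²` be a Riemannian submersion and write `τ = l / 2`. Where the Killing field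
`∂_z` is not vertical there is an orthonormal frame `e₁, e₂, e₃` with `e₃` vertical and `e₂`
orthogonal to `∂_z`, so that `∂_z = t e₁ + a e₃` with `a² + t² = 1`. The structure equations of the
BCV space and the fact that `π` is a Riemannian submersion express all connection coefficients by
functions `σ, ρ, G, x, y` (`SubmersionFrame`): `σ` is the O'Neill tensor (the horizontal
distribution is integrable if it vanishes), and the tension field of `π` is
`-(x dπ(e₁) + y dπ(e₂))`. The equations determine all first derivatives of `a`, `t`, `σ`, `x`, `y`
except those of `σ`, `x`, `y` along `e₃`.

*The twist `σ` is constant along the fibres*, even without biharmonicity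
(`SubmersionFrame.e₃_σ_pow`). The curvature `K = τ² + (4 m - l²) a² + 3 σ²` of `N` is constant
along the fibres, hence so are `|∇K|²`, `ΔK` and `Hess K (J ∇K, J ∇K)`, where `J` is the rotation
by a right angle. Eliminating `x`, `y`, `a`, `t` from these quantities leaves a polynomial equation
of degree 16 for `σ` whose coefficients are constant along the fibres and whose leading coefficient
is a non-zero number (`twistPolynomial`); therefore `e₃ σ = 0`.

*The tension field of a biharmonic `π` has constant length.* As `e₃ σ = 0`, the integrability
condition `SubmersionFrame.deriv_twist` becomes `(4 m - l²) a t x = 0`. If `l² ≠ 4 m` it follows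
that `x = 0`, and the two components of the bitension field and their derivatives give, wherever
the tension field does not vanish, `|τ(π)|² = -4 m`, `(4 m - l²) a² = -l²` and `ρ = G = 0`
(`BiharmonicFrame.isFlatFrame_of_ne`). If `l² = 4 m` they determine the products of the components
of the derivative of `τ(π)` along the fibres; that these form a matrix of rank one forces
`τ(π) = 0` (`BiharmonicFrame.norm_sq_eq_zero`). So `m < 0` if `π` is not harmonic, and on the set
considered `dπ(e₁)`, `dπ(e₂)` are parallel along `π`: the target is flat, and integrating the
closed dual forms produces Euclidean coordinates (`LocalSubmersion.exists_flat_chart`).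

*These properties hold on the whole space.* The set where neither the tension field nor the
horizontal part of `∂_z` vanishes is open; by the equations `|τ(π)|² = -4 m` and
`(4 m - (4 m - l²) t²) |τ(π)|² = 0` it is also closed. It is not empty if `π` is not harmonic,
because `π` is harmonic where `∂_z` is vertical. As the BCV space is connected, the set is
everything, and `π` is surjective (`neg_of_isProperBiharmonic`,
`isLocallyFlat_of_isProperBiharmonic`).

All equations are identities between elements of a commutative `ℝ`-algebra with derivations, namely
the algebra of smooth functions on an open set (`smoothAlgebra`). It is reduced, so the annihilator
of an element is stable under derivations (`mul_deriv_eq_zero`); multiplying an equation by a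
function `g` thus replaces the restriction to the open set `g ≠ 0`.

*Example.* Let `m < 0`, `μ = √(-m)`, let `b` be a Busemann function of the hyperbolic plane of
curvature `4 m`, and `φ` the angle at the corresponding point at infinity. The gradient of `b` is a
horizontal unit field with constant divergence `-2 μ`, and with a suitable constant `ν` the
function `ν (z - (l / (2 μ²)) φ)` is harmonic, and its gradient is a unit field orthogonal to that
of `b`. Hence the two functions form a Riemannian submersion to the Euclidean plane whose tension
field is constant and non-zero, so that it is proper biharmonic (`exists_isProperBiharmonic`).
-/

open scoped Manifold ContDiff

noncomputable section

namespace BCV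

/-! ### The pulled-back Levi-Civita connection -/

/-- The pull-back of a surface with a Riemannian metric, in local coordinates, by a map `f`, read in
an algebra `A` of functions on the source: the coordinates `f α` of the map, and the metric
coefficients, the Christoffel symbols and the derivatives `dΓ δ = ∂_δ Γ` of the latter, composed
with the map. The chain rule is required for the derivations (vector fields) in `𝒱`, and the
metric is required to be parallel. -/
structure PullbackGeometry (A : Type*) [CommRing A] [Algebra ℝ A]
    (𝒱 : Submodule A (Derivation ℝ A A)) where
  f : Fin 2 → A
  metric : Fin 2 → Fin 2 → A
  Γ : Fin 2 → Fin 2 → Fin 2 → A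
  dΓ : Fin 2 → Fin 2 → Fin 2 → Fin 2 → A
  metric_symm : ∀ α β, metric α β = metric β α
  Γ_symm : ∀ α β γ, Γ α β γ = Γ α γ β
  deriv_metric : ∀ X ∈ 𝒱, ∀ α β, X (metric α β) =
    ∑ γ, (∑ δ, (metric δ β * Γ δ γ α + metric α δ * Γ δ γ β)) * X (f γ)
  deriv_Γ : ∀ X ∈ 𝒱, ∀ α β γ, X (Γ α β γ) = ∑ δ, dΓ δ α β γ * X (f δ)

namespace PullbackGeometry

variable {A : Type*} [CommRing A] [Algebra ℝ A] {𝒱 : Submodule A (Derivation ℝ A A)}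
  (P : PullbackGeometry A 𝒱)

/-- The covariant derivative `∇^f_X W` of a field `W` along the map. -/
def cov (X : Derivation ℝ A A) (W : Fin 2 → A) (α : Fin 2) : A :=
  X (W α) + ∑ β, ∑ γ, P.Γ α β γ * X (P.f β) * W γ

/-- The pulled-back metric on fields along the map. -/
def inner (W W' : Fin 2 → A) : A := ∑ α, ∑ β, P.metric α β * W α * W' β

/-- The image `df(X)` of a vector field. -/
def push (X : Derivation ℝ A A) (α : Fin 2) : A := X (P.f α)

/-- The components of the curvature operator of the target, as in `BCV.curvature`. -/
def curv (d a b c : Fin 2) : A :=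
  P.dΓ a d b c - P.dΓ b d a c + ∑ e, (P.Γ d a e * P.Γ e b c - P.Γ d b e * P.Γ e a c)

lemma cov_add (X : Derivation ℝ A A) (W W' : Fin 2 → A) :
    P.cov X (W + W') = P.cov X W + P.cov X W' := by
  ext α
  simp only [cov, Pi.add_apply, map_add, Fin.sum_univ_two]
  ring

lemma cov_smul (X : Derivation ℝ A A) (r : A) (W : Fin 2 → A) :
    P.cov X (r • W) = X r • W + r • P.cov X W := by
  ext α
  simp only [cov, Pi.smul_apply, Pi.add_apply, smul_eq_mul, Derivation.leibniz, Fin.sum_univ_two]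
  ring

lemma cov_neg (X : Derivation ℝ A A) (W : Fin 2 → A) : P.cov X (-W) = -P.cov X W := by
  ext α
  simp only [cov, Pi.neg_apply, map_neg, Fin.sum_univ_two]
  ring

lemma cov_add_left (X Y : Derivation ℝ A A) (W : Fin 2 → A) :
    P.cov (X + Y) W = P.cov X W + P.cov Y W := by
  ext α
  simp only [cov, Pi.add_apply, Derivation.add_apply, Fin.sum_univ_two]
  ring

lemma cov_smul_left (r : A) (X : Derivation ℝ A A) (W : Fin 2 → A) :
    P.cov (r • X) W = r • P.cov X W := by
  ext α
  simp only [cov, Pi.smul_apply, smul_eq_mul, Derivation.smul_apply, Fin.sum_univ_two]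
  ring

lemma cov_zero (X : Derivation ℝ A A) : P.cov X 0 = 0 := by
  ext α
  simp [cov]

lemma push_add (X Y : Derivation ℝ A A) : P.push (X + Y) = P.push X + P.push Y := by
  ext α; simp [push]

lemma push_smul (r : A) (X : Derivation ℝ A A) : P.push (r • X) = r • P.push X := by
  ext α; simp [push]

lemma inner_comm (W W' : Fin 2 → A) : P.inner W W' = P.inner W' W := by
  simp only [inner, Fin.sum_univ_two, P.metric_symm 1 0]
  ring

lemma inner_add_left (W₁ W₂ W' : Fin 2 → A) :
    P.inner (W₁ + W₂) W' = P.inner W₁ W' + P.inner W₂ W' := by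
  simp only [inner, Fin.sum_univ_two, Pi.add_apply]
  ring

lemma inner_smul_left (r : A) (W W' : Fin 2 → A) : P.inner (r • W) W' = r * P.inner W W' := by
  simp only [inner, Fin.sum_univ_two, Pi.smul_apply, smul_eq_mul]
  ring

lemma inner_neg_left (W W' : Fin 2 → A) : P.inner (-W) W' = -P.inner W W' := by
  simp only [inner, Fin.sum_univ_two, Pi.neg_apply]
  ring

/-- The pulled-back connection is metric. -/
lemma deriv_inner {X : Derivation ℝ A A} (hX : X ∈ 𝒱) (W W' : Fin 2 → A) :
    X (P.inner W W') = P.inner (P.cov X W) W' + P.inner W (P.cov X W') := by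
  simp only [inner, cov, Fin.sum_univ_two, map_add, Derivation.leibniz, smul_eq_mul,
    P.deriv_metric X hX]
  ring

/-- The pulled-back connection is torsion free. -/
lemma cov_push_sub (X Y : Derivation ℝ A A) :
    P.cov X (P.push Y) - P.cov Y (P.push X) = P.push ⁅X, Y⁆ := by
  ext α
  simp only [cov, push, Pi.sub_apply, Derivation.commutator_apply, Fin.sum_univ_two, P.Γ_symm α 1 0]
  ring

/-- The curvature of the pulled-back connection is the pull-back of the curvature. -/
lemma cov_commutator {X Y : Derivation ℝ A A} (hX : X ∈ 𝒱) (hY : Y ∈ 𝒱) (W : Fin 2 → A)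
    (α : Fin 2) :
    P.cov X (P.cov Y W) α - P.cov Y (P.cov X W) α - P.cov ⁅X, Y⁆ W α =
      ∑ β, ∑ γ, ∑ δ, P.curv α β γ δ * P.push X β * P.push Y γ * W δ := by
  simp only [cov, push, curv, Derivation.commutator_apply, Fin.sum_univ_two, map_add,
    Derivation.leibniz, smul_eq_mul, P.deriv_Γ X hX, P.deriv_Γ Y hY]
  ring

end PullbackGeometry

/-- An adapted frame of a Riemannian submersion: `e₃` is vertical, and `e₁`, `e₂` are mapped to an
orthonormal frame of the target. -/
structure AdaptedFrame {A : Type*} [CommRing A] [Algebra ℝ A]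
    {𝒱 : Submodule A (Derivation ℝ A A)} (P : PullbackGeometry A 𝒱)
    (e₁ e₂ e₃ : Derivation ℝ A A) : Prop where
  mem₁ : e₁ ∈ 𝒱
  mem₂ : e₂ ∈ 𝒱
  mem₃ : e₃ ∈ 𝒱
  vertical : P.push e₃ = 0
  inner₁₁ : P.inner (P.push e₁) (P.push e₁) = 1
  inner₁₂ : P.inner (P.push e₁) (P.push e₂) = 0
  inner₂₂ : P.inner (P.push e₂) (P.push e₂) = 1

namespace AdaptedFrame

variable {A : Type*} [CommRing A] [Algebra ℝ A] {𝒱 : Submodule A (Derivation ℝ A A)}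
  {P : PullbackGeometry A 𝒱} {e₁ e₂ e₃ : Derivation ℝ A A}

lemma eq_zero_of_add_self {A : Type*} [CommRing A] [Algebra ℝ A] {r : A} (hr : r + r = 0) :
    r = 0 := by
  have h2 : ((2 : ℝ)⁻¹ * 2) • r = 0 := by rw [mul_smul, two_smul, hr, smul_zero]
  simpa using h2

/-- The images of `e₁` and `e₂` are a basis of the fields along the map. -/
lemma expand (h : AdaptedFrame P e₁ e₂ e₃) (W : Fin 2 → A) :
    W = P.inner W (P.push e₁) • P.push e₁ + P.inner W (P.push e₂) • P.push e₂ := by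
  set M : Matrix (Fin 2) (Fin 2) A := Matrix.of ![P.push e₁, P.push e₂] with hM
  set H : Matrix (Fin 2) (Fin 2) A := Matrix.of P.metric with hH
  have h1 : M * (H * M.transpose) = 1 := by
    have a := h.inner₁₁
    have b := h.inner₁₂
    have c := h.inner₂₂
    have b' := b
    rw [P.inner_comm] at b'
    simp only [PullbackGeometry.inner, Fin.sum_univ_two] at a b c b'
    ext i j
    fin_cases i <;> fin_cases j <;>
      simp [Matrix.mul_apply, Fin.sum_univ_two, hM, hH] <;>
      first
        | linear_combination a
        | linear_combination b
        | linear_combination b'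
        | linear_combination c
  have h2 := mul_eq_one_comm.1 h1
  have h3 : (H * M.transpose * M).transpose.mulVec W = W := by rw [h2]; simp
  nth_rewrite 1 [← h3]
  ext α
  fin_cases α <;>
    simp [Matrix.mul_apply, Matrix.mulVec, dotProduct, Fin.sum_univ_two, hM, hH,
      PullbackGeometry.inner, P.metric_symm 1 0] <;> ring

lemma ext_inner (h : AdaptedFrame P e₁ e₂ e₃) {W W' : Fin 2 → A}
    (h1 : P.inner W (P.push e₁) = P.inner W' (P.push e₁))
    (h2 : P.inner W (P.push e₂) = P.inner W' (P.push e₂)) : W = W' := by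
  rw [h.expand W, h.expand W', h1, h2]

/-- In an orthonormal frame the connection is a rotation. -/
lemma cov_push (h : AdaptedFrame P e₁ e₂ e₃) {X : Derivation ℝ A A} (hX : X ∈ 𝒱) :
    P.cov X (P.push e₁) = P.inner (P.cov X (P.push e₁)) (P.push e₂) • P.push e₂ ∧
    P.cov X (P.push e₂) = -(P.inner (P.cov X (P.push e₁)) (P.push e₂) • P.push e₁) := by
  have a := P.deriv_inner hX (P.push e₁) (P.push e₁)
  have b := P.deriv_inner hX (P.push e₁) (P.push e₂)
  have c := P.deriv_inner hX (P.push e₂) (P.push e₂)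
  rw [h.inner₁₁, Derivation.map_one_eq_zero, P.inner_comm (P.push e₁)] at a
  rw [h.inner₁₂, map_zero, P.inner_comm (P.push e₁)] at b
  rw [h.inner₂₂, Derivation.map_one_eq_zero, P.inner_comm (P.push e₂)] at c
  have a' := eq_zero_of_add_self a.symm
  have c' := eq_zero_of_add_self c.symm
  constructor
  · apply h.ext_inner
    · rw [a', P.inner_smul_left, P.inner_comm (P.push e₂), h.inner₁₂, mul_zero]
    · rw [P.inner_smul_left, h.inner₂₂, mul_one]
  · apply h.ext_inner
    · rw [P.inner_neg_left, P.inner_smul_left, h.inner₁₁, mul_one]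
      linear_combination -b
    · rw [c', P.inner_neg_left, P.inner_smul_left, h.inner₁₂, mul_zero, neg_zero]

/-- Coefficients with respect to `df(e₁)`, `df(e₂)` are unique. -/
lemma coeff_eq (h : AdaptedFrame P e₁ e₂ e₃) {r s r' s' : A}
    (hrs : r • P.push e₁ + s • P.push e₂ = r' • P.push e₁ + s' • P.push e₂) : r = r' ∧ s = s' := by
  have a := congrArg (fun W => P.inner W (P.push e₁)) hrs
  have b := congrArg (fun W => P.inner W (P.push e₂)) hrs
  simp only [P.inner_add_left, P.inner_smul_left, h.inner₁₁, h.inner₂₂, h.inner₁₂,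
    P.inner_comm (P.push e₂) (P.push e₁), mul_one, mul_zero, add_zero, zero_add] at a b
  exact ⟨a, b⟩

/-- The vertical direction of an adapted frame: the flow of `e₃` preserves the metric of the
horizontal planes, and it rotates the frame by the rate `-r₁₂`. -/
lemma vertical_bracket (h : AdaptedFrame P e₁ e₂ e₃) {r₁₁ r₁₂ r₁₃ r₂₁ r₂₂ r₂₃ : A}
    (h13 : ⁅e₁, e₃⁆ = r₁₁ • e₁ + r₁₂ • e₂ + r₁₃ • e₃)
    (h23 : ⁅e₂, e₃⁆ = r₂₁ • e₁ + r₂₂ • e₂ + r₂₃ • e₃) :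
    r₁₁ = 0 ∧ r₂₂ = 0 ∧ r₂₁ = -r₁₂ ∧ P.cov e₃ (P.push e₁) = -r₁₂ • P.push e₂ ∧
      P.cov e₃ (P.push e₂) = r₁₂ • P.push e₁ := by
  have t1 := P.cov_push_sub e₁ e₃
  have t2 := P.cov_push_sub e₂ e₃
  rw [h13, h.vertical, P.cov_zero] at t1
  rw [h23, h.vertical, P.cov_zero] at t2
  simp only [P.push_add, P.push_smul, h.vertical, smul_zero, add_zero, zero_sub] at t1 t2
  obtain ⟨k1, k2⟩ := h.cov_push h.mem₃
  rw [k1] at t1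
  rw [k2] at t2
  obtain ⟨a1, a2⟩ := h.coeff_eq (r := 0) (s := -P.inner (P.cov e₃ (P.push e₁)) (P.push e₂))
    (r' := r₁₁) (s' := r₁₂) (by rw [zero_smul, zero_add, neg_smul]; exact t1)
  obtain ⟨b1, b2⟩ := h.coeff_eq (r := P.inner (P.cov e₃ (P.push e₁)) (P.push e₂)) (s := 0)
    (r' := r₂₁) (s' := r₂₂) (by rw [zero_smul, add_zero]; simpa using t2)
  refine ⟨a1.symm, b2.symm, by rw [← a2, ← b1, neg_neg], ?_, ?_⟩
  · rw [k1, ← a2, neg_neg]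
  · rw [k2, ← a2, neg_smul]

/-- The connection form of an adapted frame in the horizontal directions. -/
lemma horizontal_bracket (h : AdaptedFrame P e₁ e₂ e₃) {p₁ p₂ p₃ : A}
    (h12 : ⁅e₁, e₂⁆ = p₁ • e₁ + p₂ • e₂ + p₃ • e₃) :
    P.cov e₁ (P.push e₁) = -p₁ • P.push e₂ ∧ P.cov e₁ (P.push e₂) = p₁ • P.push e₁ ∧
    P.cov e₂ (P.push e₁) = -p₂ • P.push e₂ ∧ P.cov e₂ (P.push e₂) = p₂ • P.push e₁ := by
  have t := P.cov_push_sub e₁ e₂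
  obtain ⟨k1, k2⟩ := h.cov_push h.mem₁
  obtain ⟨k3, k4⟩ := h.cov_push h.mem₂
  rw [h12, k2, k3] at t
  simp only [P.push_add, P.push_smul, h.vertical, smul_zero, add_zero] at t
  obtain ⟨a1, a2⟩ := h.coeff_eq (r := -P.inner (P.cov e₁ (P.push e₁)) (P.push e₂))
    (s := -P.inner (P.cov e₂ (P.push e₁)) (P.push e₂)) (r' := p₁) (s' := p₂)
    (by rw [neg_smul, neg_smul, ← sub_eq_add_neg]; exact t)
  refine ⟨?_, ?_, ?_, ?_⟩
  · rw [k1, ← a1, neg_neg]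
  · rw [k2, ← a1, neg_smul]
  · rw [k3, ← a2, neg_neg]
  · rw [k4, ← a2, neg_smul]

end AdaptedFrame

/-! ### The frame adapted to a submersion from a BCV space -/

/-- The structure equations of the standard orthonormal frame `E₁ = F ∂ₓ - (l y / 2) ∂_z`,
`E₂ = F ∂_y + (l x / 2) ∂_z`, `E₃ = ∂_z` of a BCV space. Here `X`, `Y` are the coordinates `x`, `y`,
and `M`, `L` are the constants `m`, `l`. -/
structure BCVFrame {A : Type*} [CommRing A] [Algebra ℝ A] (M L X Y : A)
    (E₁ E₂ E₃ : Derivation ℝ A A) : Prop where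
  M_const : ∀ D : Derivation ℝ A A, D M = 0
  L_const : ∀ D : Derivation ℝ A A, D L = 0
  E₁_X : E₁ X = 1 + M * (X ^ 2 + Y ^ 2)
  E₁_Y : E₁ Y = 0
  E₂_X : E₂ X = 0
  E₂_Y : E₂ Y = 1 + M * (X ^ 2 + Y ^ 2)
  E₃_X : E₃ X = 0
  E₃_Y : E₃ Y = 0
  bracket₁₂ : ⁅E₁, E₂⁆ = -(2 * M * Y) • E₁ + (2 * M * X) • E₂ + L • E₃
  bracket₁₃ : ⁅E₁, E₃⁆ = 0
  bracket₂₃ : ⁅E₂, E₃⁆ = 0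

/-- The structure equations of an orthonormal frame `n`, `e`, `ξ` of a BCV space that contains the
Killing field `ξ`, with connection coefficients `p`, `C`, `G`: this is the standard frame after a
rotation about `ξ`. The last three equations express the curvature. -/
structure RotatedFrame {A : Type*} [CommRing A] [Algebra ℝ A] (M L p C G : A)
    (n e ξ : Derivation ℝ A A) : Prop where
  M_const : ∀ D : Derivation ℝ A A, D M = 0
  L_const : ∀ D : Derivation ℝ A A, D L = 0
  bracket_ne : ⁅n, e⁆ = p • n + C • e - L • ξ
  bracket_nξ : ⁅n, ξ⁆ = G • e
  bracket_eξ : ⁅e, ξ⁆ = -G • n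
  curv_ne : n C - e p = p ^ 2 + C ^ 2 - L * G + 4 * M
  curv_nξ : n G - ξ p = G * C
  curv_eξ : e G - ξ C = -(G * p)

section Rotation

variable {A : Type*} [CommRing A] [Algebra ℝ A]

lemma deriv_of_sq_add_sq {c d : A} (h : c ^ 2 + d ^ 2 = 1) (D : Derivation ℝ A A) :
    D c = -d * (c * D d - d * D c) ∧ D d = c * (c * D d - d * D c) := by
  have h1 : c * D c + d * D d = 0 := by
    apply AdaptedFrame.eq_zero_of_add_self
    have := congrArg D h
    simp only [map_add, Derivation.leibniz_pow, Derivation.map_one_eq_zero, smul_eq_mul,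
      nsmul_eq_mul] at this
    push_cast at this
    linear_combination this
  constructor
  · linear_combination (-D c) * h + c * h1
  · linear_combination (-D d) * h + d * h1

lemma BCVFrame.rotate {M L X Y c d : A} {E₁ E₂ E₃ : Derivation ℝ A A}
    (h : BCVFrame M L X Y E₁ E₂ E₃) (hcd : c ^ 2 + d ^ 2 = 1) :
    ∃ p C G : A, RotatedFrame M L p C G (c • E₁ + d • E₂) (d • E₁ - c • E₂) E₃ ∧
      (2 * M * X) • E₁ + (2 * M * Y) • E₂ +
          ((c • E₁ + d • E₂) c + (d • E₁ - c • E₂) d) • E₁ +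
          ((c • E₁ + d • E₂) d - (d • E₁ - c • E₂) c) • E₂ =
        C • (c • E₁ + d • E₂) - p • (d • E₁ - c • E₂) := by
  obtain ⟨c1, d1⟩ := deriv_of_sq_add_sq hcd E₁
  obtain ⟨c2, d2⟩ := deriv_of_sq_add_sq hcd E₂
  obtain ⟨c3, d3⟩ := deriv_of_sq_add_sq hcd E₃
  set θ₁ := c * E₁ d - d * E₁ c
  set θ₂ := c * E₂ d - d * E₂ c
  set θ₃ := c * E₃ d - d * E₃ c
  have b12 : ∀ r, E₁ (E₂ r) - E₂ (E₁ r) = -(2 * M * Y) * E₁ r + (2 * M * X) * E₂ r + L * E₃ r := by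
    intro r
    have := congrArg (fun D : Derivation ℝ A A => D r) h.bracket₁₂
    simpa [Derivation.commutator_apply] using this
  have b13 : ∀ r, E₁ (E₃ r) - E₃ (E₁ r) = 0 := by
    intro r
    have := congrArg (fun D : Derivation ℝ A A => D r) h.bracket₁₃
    simpa [Derivation.commutator_apply] using this
  have b23 : ∀ r, E₂ (E₃ r) - E₃ (E₂ r) = 0 := by
    intro r
    have := congrArg (fun D : Derivation ℝ A A => D r) h.bracket₂₃
    simpa [Derivation.commutator_apply] using this
  have t12 : E₁ θ₂ - E₂ θ₁ = -(2 * M * Y) * θ₁ + 2 * M * X * θ₂ + L * θ₃ := by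
    have kc := b12 c
    have kd := b12 d
    rw [c1, c2, c3] at kc
    rw [d1, d2, d3] at kd
    simp only [Derivation.leibniz, map_neg, smul_eq_mul, neg_mul] at kc kd
    rw [d1, d2] at kc
    rw [c1, c2] at kd
    linear_combination c * kd - d * kc +
      (-(E₁ θ₂ - E₂ θ₁) + (-(2 * M * Y) * θ₁ + 2 * M * X * θ₂ + L * θ₃)) * hcd
  have t13 : E₁ θ₃ - E₃ θ₁ = 0 := by
    have kc := b13 c
    have kd := b13 d
    rw [c1, c3] at kc
    rw [d1, d3] at kd
    simp only [Derivation.leibniz, map_neg, smul_eq_mul, neg_mul] at kc kd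
    rw [d1, d3] at kc
    rw [c1, c3] at kd
    linear_combination c * kd - d * kc - (E₁ θ₃ - E₃ θ₁) * hcd
  have t23 : E₂ θ₃ - E₃ θ₂ = 0 := by
    have kc := b23 c
    have kd := b23 d
    rw [c2, c3] at kc
    rw [d2, d3] at kd
    simp only [Derivation.leibniz, map_neg, smul_eq_mul, neg_mul] at kc kd
    rw [d2, d3] at kc
    rw [c2, c3] at kd
    linear_combination c * kd - d * kc - (E₂ θ₃ - E₃ θ₂) * hcd
  clear_value θ₁ θ₂ θ₃
  have h2 : ∀ D : Derivation ℝ A A, D (2 : A) = 0 := fun D => by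
    simpa using D.map_natCast 2
  refine ⟨c * θ₁ + d * θ₂ + 2 * M * Y * c - 2 * M * X * d,
    d * θ₁ - c * θ₂ + 2 * M * Y * d + 2 * M * X * c, θ₃, ⟨h.M_const, h.L_const, ?_, ?_, ?_,
    ?_, ?_, ?_⟩, ?_⟩
  · ext r
    simp only [Derivation.commutator_apply, Derivation.add_apply, Derivation.sub_apply,
      Derivation.smul_apply, map_add, map_sub, Derivation.leibniz, smul_eq_mul,
      c1, c2, d1, d2]
    linear_combination -(c ^ 2 + d ^ 2) * b12 r - L * E₃ r * hcd
  · ext r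
    simp only [Derivation.commutator_apply, Derivation.add_apply, Derivation.sub_apply,
      Derivation.smul_apply, map_add, Derivation.leibniz, smul_eq_mul, c3, d3]
    linear_combination c * b13 r + d * b23 r
  · ext r
    simp only [Derivation.commutator_apply, Derivation.add_apply, Derivation.sub_apply,
      Derivation.smul_apply, map_sub, Derivation.leibniz, smul_eq_mul, c3, d3]
    linear_combination d * b13 r - c * b23 r
  · simp only [Derivation.add_apply, Derivation.sub_apply,
      Derivation.smul_apply, map_add, map_sub, Derivation.leibniz, smul_eq_mul, c1, c2, d1, d2,
      h.M_const, h.E₁_X, h.E₁_Y, h.E₂_X, h.E₂_Y, h2]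
    linear_combination -(c ^ 2 + d ^ 2) * t12 + (4 * M - L * θ₃) * hcd
  · simp only [Derivation.add_apply,
      Derivation.smul_apply, map_add, map_sub, Derivation.leibniz, smul_eq_mul, c3, d3,
      h.M_const, h.E₃_X, h.E₃_Y, h2]
    linear_combination c * t13 + d * t23
  · simp only [Derivation.sub_apply,
      Derivation.smul_apply, map_add, map_sub, Derivation.leibniz, smul_eq_mul, c3, d3,
      h.M_const, h.E₃_X, h.E₃_Y, h2]
    linear_combination d * t13 - c * t23
  · ext r
    simp only [Derivation.add_apply, Derivation.sub_apply, Derivation.smul_apply, smul_eq_mul,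
      c1, c2, d1, d2]
    linear_combination -(2 * M * X * E₁ r + 2 * M * Y * E₂ r) * hcd

/-- The structure equations of a Riemannian submersion from a BCV space of constants `m` and
`l = 2 τ`, in the adapted frame `e₁`, `e₂`, `e₃`, where `e₃` is vertical and `e₁` is the direction
of the horizontal part of the Killing field `ξ = a e₃ + t e₁`, assumed to be nonzero, with
`u = 1 / t`. The mean curvature vector of the fibres is `x e₁ + y e₂`, the horizontal
distribution has twist `σ`, and the connection form of the frame `df(e₁)`, `df(e₂)` is `(ρ, 0, G)`. -/
structure SubmersionFrame {A : Type*} [CommRing A] [Algebra ℝ A] (M τ a t u σ ρ G x y : A)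
    (e₁ e₂ e₃ : Derivation ℝ A A) : Prop where
  M_const : ∀ D : Derivation ℝ A A, D M = 0
  τ_const : ∀ D : Derivation ℝ A A, D τ = 0
  sq_add_sq : a ^ 2 + t ^ 2 = 1
  t_mul_u : t * u = 1
  t_mul_ρ : t * ρ = -a * (τ + σ)
  t_mul_G : t * G = (τ - σ) * t - a * y
  bracket₁₂ : ⁅e₁, e₂⁆ = -ρ • e₁ - (2 * σ) • e₃
  bracket₁₃ : ⁅e₁, e₃⁆ = -G • e₂ + x • e₃
  bracket₂₃ : ⁅e₂, e₃⁆ = G • e₁ + y • e₃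
  e₁_a : e₁ a = 0
  e₁_t : e₁ t = 0
  e₂_a : e₂ a = -(τ + σ) * t
  e₂_t : e₂ t = a * (τ + σ)
  e₃_a : e₃ a = t * x
  e₃_t : e₃ t = -(a * x)
  e₁_σ : e₁ σ = 2 * σ * x
  e₂_σ : e₂ σ = 2 * σ * y - (4 * M - 4 * τ ^ 2) * a * t
  e₁_x : e₁ x = τ ^ 2 - σ ^ 2 + x ^ 2 + ρ * y
  e₂_x : e₂ x = x * y - e₃ σ
  e₁_y : e₁ y = e₃ σ + x * y - ρ * x
  e₂_y : e₂ y = τ ^ 2 - σ ^ 2 + (4 * M - 4 * τ ^ 2) * t ^ 2 + y ^ 2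

lemma RotatedFrame.tilt {M τ p C G a t u : A} {n e ξ : Derivation ℝ A A}
    (h : RotatedFrame M (2 * τ) p C G n e ξ) (hat : a ^ 2 + t ^ 2 = 1) (htu : t * u = 1)
    {𝒱 : Submodule A (Derivation ℝ A A)} {P : PullbackGeometry A 𝒱}
    (hP : AdaptedFrame P (-a • n + t • ξ) e (t • n + a • ξ)) :
    ∃ σ ρ x y : A, SubmersionFrame M τ a t u σ ρ G x y (-a • n + t • ξ) e (t • n + a • ξ) ∧
      C = 0 ∧ ρ + y = -p := by
  have b1 : ∀ r, n (e r) - e (n r) = p * n r + C * e r - 2 * τ * ξ r := by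
    intro r
    have := congrArg (fun D : Derivation ℝ A A => D r) h.bracket_ne
    simpa [Derivation.commutator_apply] using this
  have b2 : ∀ r, n (ξ r) - ξ (n r) = G * e r := by
    intro r
    have := congrArg (fun D : Derivation ℝ A A => D r) h.bracket_nξ
    simpa [Derivation.commutator_apply] using this
  have b3 : ∀ r, e (ξ r) - ξ (e r) = -G * n r := by
    intro r
    have := congrArg (fun D : Derivation ℝ A A => D r) h.bracket_eξ
    simpa [Derivation.commutator_apply] using this
  obtain ⟨an, tn⟩ := deriv_of_sq_add_sq hat n
  obtain ⟨ae, te⟩ := deriv_of_sq_add_sq hat e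
  obtain ⟨aξ, tξ⟩ := deriv_of_sq_add_sq hat ξ
  set ψn := a * n t - t * n a
  set ψe := a * e t - t * e a
  set ψξ := a * ξ t - t * ξ a
  clear_value ψn ψe ψξ
  have hb12 : ⁅-a • n + t • ξ, e⁆ = (a ^ 2 * p - a * t * G + a * t * (2 * τ)) •
      (-a • n + t • ξ) + (-(a * C)) • e +
      (-ψe - a * t * p + t ^ 2 * G + a ^ 2 * (2 * τ)) • (t • n + a • ξ) := by
    ext r
    simp only [Derivation.commutator_apply, Derivation.add_apply,
      Derivation.smul_apply, map_add, map_neg, Derivation.leibniz, smul_eq_mul, ae, te]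
    linear_combination -a * b1 r - t * b3 r + (a * p * n r - t * G * n r - a * (2 * τ) * ξ r) * hat
  have hb13 : ⁅-a • n + t • ξ, t • n + a • ξ⁆ = (a * ψn - t * ψξ) •
      (-a • n + t • ξ) + (-G) • e + (-(t * ψn + a * ψξ)) • (t • n + a • ξ) := by
    ext r
    simp only [Derivation.commutator_apply, Derivation.add_apply,
      Derivation.smul_apply, map_add, map_neg, Derivation.leibniz, smul_eq_mul, an, tn, aξ, tξ]
    linear_combination (-a ^ 2 - t ^ 2) * b2 r - G * e r * hat
  have hb23 : ⁅e, t • n + a • ξ⁆ = (-ψe + a * t * p + a ^ 2 * G + t ^ 2 * (2 * τ)) •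
      (-a • n + t • ξ) + (-(t * C)) • e +
      (-(t ^ 2 * p) - a * t * G + a * t * (2 * τ)) • (t • n + a • ξ) := by
    ext r
    simp only [Derivation.commutator_apply, Derivation.add_apply,
      Derivation.smul_apply, map_add, Derivation.leibniz, smul_eq_mul, ae, te]
    linear_combination -t * b1 r + a * b3 r +
      (t * p * n r + a * G * n r - t * (2 * τ) * ξ r) * hat
  obtain ⟨h11, h22, h21, -, -⟩ := hP.vertical_bracket hb13 hb23
  have hC : C = 0 := by linear_combination -C * htu - u * h22
  have hψe : ψe = t * (a * p - t * G + t * (2 * τ)) := by linear_combination -h21 + G * hat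
  set B := a * p - t * G + t * (2 * τ) with hB
  set x := -(t * ψn + a * ψξ) with hx
  have e1a : (-a • n + t • ξ) a = 0 := by
    simp only [Derivation.add_apply, Derivation.smul_apply, smul_eq_mul, an, aξ]
    linear_combination t * h11
  have e1t : (-a • n + t • ξ) t = 0 := by
    simp only [Derivation.add_apply, Derivation.smul_apply, smul_eq_mul, tn, tξ]
    linear_combination -a * h11
  have e3a : (t • n + a • ξ) a = t * x := by
    simp only [Derivation.add_apply, Derivation.smul_apply, smul_eq_mul, an, aξ, hx]
    ring
  have e3t : (t • n + a • ξ) t = -(a * x) := by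
    simp only [Derivation.add_apply, Derivation.smul_apply, smul_eq_mul, tn, tξ, hx]
    ring
  have e2a : e a = -(t * B) * t := by rw [ae, hψe]; ring
  have e2t : e t = a * (t * B) := by rw [te, hψe]
  have ep : e p = -p ^ 2 + 2 * τ * G - 4 * M := by
    have := h.curv_ne
    rw [hC, map_zero] at this
    linear_combination -this
  have eG : e G = -(G * p) := by
    have := h.curv_eξ
    rw [hC, map_zero] at this
    linear_combination this
  have nG : n G = ξ p := by
    have := h.curv_nξ
    rw [hC] at this
    linear_combination this
  have h2 : ∀ D : Derivation ℝ A A, D (2 : A) = 0 := fun D => by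
    simpa using D.map_natCast 2
  have hτ : ∀ D : Derivation ℝ A A, D τ = 0 := fun D => by
    have := h.L_const D
    rw [Derivation.leibniz, h2, smul_zero, add_zero, smul_eq_mul] at this
    exact AdaptedFrame.eq_zero_of_add_self (by linear_combination this)
  set e₁ := -a • n + t • ξ with he₁
  set e₃ := t • n + a • ξ with he₃
  have c12 : ⁅e₁, e⁆ = (a * B) • e₁ - (2 * (t * B - τ)) • e₃ := by
    have k1 : a ^ 2 * p - a * t * G + a * t * (2 * τ) = a * B := by rw [hB]; ring
    have k2 : -ψe - a * t * p + t ^ 2 * G + a ^ 2 * (2 * τ) = -(2 * (t * B - τ)) := by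
      rw [hψe, hB]
      linear_combination (2 * τ) * hat
    rw [hb12, hC, k1, k2, mul_zero, neg_zero, zero_smul, add_zero, neg_smul, ← sub_eq_add_neg]
  have c13 : ⁅e₁, e₃⁆ = -G • e + x • e₃ := by rw [hb13, h11, zero_smul, zero_add]
  have c23 : ⁅e, e₃⁆ = G • e₁ + (-p + a * B) • e₃ := by
    rw [hb23, hC, mul_zero, neg_zero, zero_smul, add_zero, h21, neg_neg]
    congr 2
    rw [hB]
    linear_combination -p * hat
  have d12 : ∀ r, e₁ (e r) - e (e₁ r) = a * B * e₁ r - 2 * (t * B - τ) * e₃ r := by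
    intro r
    have := congrArg (fun D : Derivation ℝ A A => D r) c12
    simpa only [Derivation.commutator_apply, Derivation.sub_apply, Derivation.smul_apply,
      smul_eq_mul] using this
  have d13 : ∀ r, e₁ (e₃ r) - e₃ (e₁ r) = -G * e r + x * e₃ r := by
    intro r
    have := congrArg (fun D : Derivation ℝ A A => D r) c13
    simpa only [Derivation.commutator_apply, Derivation.add_apply, Derivation.smul_apply,
      smul_eq_mul] using this
  have d23 : ∀ r, e (e₃ r) - e₃ (e r) = G * e₁ r + (-p + a * B) * e₃ r := by
    intro r
    have := congrArg (fun D : Derivation ℝ A A => D r) c23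
    simpa only [Derivation.commutator_apply, Derivation.add_apply, Derivation.smul_apply,
      smul_eq_mul] using this
  have e1tB : e₁ (t * B) = 2 * (t * B - τ) * x := by
    have k := d12 a
    rw [e1a, map_zero, e2a, e3a, Derivation.leibniz, map_neg, e1t] at k
    simp only [smul_eq_mul] at k
    linear_combination -u * k + (2 * (t * B - τ) * x - e₁ (t * B)) * htu
  have hG : t * G = a * p + 2 * τ * t - B := by rw [hB]; ring
  have eB : ∀ D : Derivation ℝ A A, D B =
      D a * p + a * D p - D t * G - t * D G + 2 * τ * D t := by
    intro D
    rw [hB]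
    simp only [map_add, map_sub, Derivation.leibniz, smul_eq_mul, h2, hτ]
    ring
  clear_value B x
  have e2B : e B = -(t ^ 2 * B * p) + a * (-p ^ 2 + 2 * τ * G - 4 * M) - a * t * B * G +
      t * G * p + 2 * τ * a * t * B := by
    rw [eB, e2a, e2t, ep, eG]
    ring
  have e2tB : e (t * B) = 2 * (t * B - τ) * (-p + a * B) - (4 * M - 4 * τ ^ 2) * a * t := by
    rw [Derivation.leibniz, e2t, e2B, smul_eq_mul, smul_eq_mul]
    linear_combination (2 * τ * a - a * t * B + t * p) * hG + (2 * τ * p - t * B * p) * hat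
  have e1x : e₁ x = t * B * G + x ^ 2 := by
    have k := d13 a
    rw [e1a, map_zero, e2a, e3a, Derivation.leibniz, e1t] at k
    simp only [smul_eq_mul] at k
    linear_combination u * k + (t * B * G + x ^ 2 - e₁ x) * htu
  have e2x : e x = x * (-p + a * B) - e₃ (t * B) := by
    have k := d23 a
    rw [e1a, e2a, e3a, Derivation.leibniz, Derivation.leibniz, e2t, e3t] at k
    simp only [smul_eq_mul, map_neg] at k
    linear_combination u * k + (x * (-p + a * B) - e₃ (t * B) - e x) * htu
  refine ⟨t * B - τ, -(a * B), x, -p + a * B, ⟨h.M_const, hτ, hat, htu, by ring, ?_, ?_, c13, c23,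
    e1a, e1t, ?_, ?_, e3a, e3t, ?_, ?_, ?_, ?_, ?_, ?_⟩, hC, by ring⟩
  · linear_combination B * hat + hG
  · rw [c12, neg_neg]
  · rw [e2a]; ring
  · rw [e2t]; ring
  · rw [map_sub, e1tB, hτ]; ring
  · rw [map_sub, e2tB, hτ]; ring
  · rw [e1x]
    linear_combination B * hG + B ^ 2 * hat
  · rw [e2x, map_sub, hτ]; ring
  · -- the equation `n G = ξ p` in terms of `e₁` and `e₃`
    have k : t * e₁ p + a * e₁ G = t * e₃ G - a * e₃ p := by
      have hn : ∀ r, n r = -a * e₁ r + t * e₃ r := by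
        intro r
        simp only [he₁, he₃, Derivation.add_apply, Derivation.smul_apply, smul_eq_mul]
        linear_combination -n r * hat
      have hξ : ∀ r, ξ r = t * e₁ r + a * e₃ r := by
        intro r
        simp only [he₁, he₃, Derivation.add_apply, Derivation.smul_apply, smul_eq_mul]
        linear_combination -ξ r * hat
      rw [hn, hξ] at nG
      linear_combination -nG
    rw [map_add, map_neg, map_sub, hτ, Derivation.leibniz, Derivation.leibniz, eB, eB, e1a, e1t,
      e3a, e3t]
    simp only [smul_eq_mul]
    linear_combination -t * k + (e₁ p - x * p) * hat - a * x * hG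
  · rw [map_add, map_neg, ep, Derivation.leibniz, e2B, e2a, smul_eq_mul, smul_eq_mul]
    linear_combination (2 * τ * G - 4 * M - a * B * p) * hat + (a * p - 2 * τ * t - a ^ 2 * B) * hG

end Rotation

/-! ### Tension and bitension in an adapted frame -/

namespace PullbackGeometry

variable {A : Type*} [CommRing A] [Algebra ℝ A] {𝒱 : Submodule A (Derivation ℝ A A)}
  (P : PullbackGeometry A 𝒱)

/-- The tension field `∑ ∇^f_{Eᵢ} df(Eᵢ) - df(Z)`, where `E₁`, `E₂`, `E₃` is an orthonormal frame of
the source and `Z = ∑ ∇_{Eᵢ} Eᵢ`. -/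
def frameTension (E₁ E₂ E₃ Z : Derivation ℝ A A) : Fin 2 → A :=
  P.cov E₁ (P.push E₁) + P.cov E₂ (P.push E₂) + P.cov E₃ (P.push E₃) - P.push Z

/-- The rough Laplacian `∑ ∇^f_{Eᵢ} ∇^f_{Eᵢ} W - ∇^f_Z W`, with the notation of `frameTension`. -/
def frameLaplacian (E₁ E₂ E₃ Z : Derivation ℝ A A) (W : Fin 2 → A) : Fin 2 → A :=
  P.cov E₁ (P.cov E₁ W) + P.cov E₂ (P.cov E₂ W) + P.cov E₃ (P.cov E₃ W) - P.cov Z W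

/-- The curvature operator `R(U, V) W` of the target, for fields along the map. -/
def curvOp (U V W : Fin 2 → A) (α : Fin 2) : A :=
  ∑ β, ∑ γ, ∑ δ, P.curv α β γ δ * U β * V γ * W δ

/-- The bitension field, with the notation of `frameTension`. -/
def frameBitension (E₁ E₂ E₃ Z : Derivation ℝ A A) : Fin 2 → A :=
  P.frameLaplacian E₁ E₂ E₃ Z (P.frameTension E₁ E₂ E₃ Z) -
    (P.curvOp (P.push E₁) (P.frameTension E₁ E₂ E₃ Z) (P.push E₁) +
      P.curvOp (P.push E₂) (P.frameTension E₁ E₂ E₃ Z) (P.push E₂) +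
      P.curvOp (P.push E₃) (P.frameTension E₁ E₂ E₃ Z) (P.push E₃))

lemma cov_sub_left (X Y : Derivation ℝ A A) (W : Fin 2 → A) :
    P.cov (X - Y) W = P.cov X W - P.cov Y W := by
  ext α
  simp only [cov, Pi.sub_apply, Derivation.sub_apply, Fin.sum_univ_two]
  ring

lemma cov_sub (X : Derivation ℝ A A) (W W' : Fin 2 → A) :
    P.cov X (W - W') = P.cov X W - P.cov X W' := by
  ext α
  simp only [cov, Pi.sub_apply, map_sub, Fin.sum_univ_two]
  ring

lemma push_sub (X Y : Derivation ℝ A A) : P.push (X - Y) = P.push X - P.push Y := by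
  ext α; simp [push]

lemma curvOp_add_left (U U' V W : Fin 2 → A) :
    P.curvOp (U + U') V W = P.curvOp U V W + P.curvOp U' V W := by
  ext α; simp only [curvOp, Fin.sum_univ_two, Pi.add_apply]; ring

lemma curvOp_smul_left (r : A) (U V W : Fin 2 → A) :
    P.curvOp (r • U) V W = r • P.curvOp U V W := by
  ext α; simp only [curvOp, Fin.sum_univ_two, Pi.smul_apply, smul_eq_mul]; ring

lemma curvOp_add_right (U V W W' : Fin 2 → A) :
    P.curvOp U V (W + W') = P.curvOp U V W + P.curvOp U V W' := by
  ext α; simp only [curvOp, Fin.sum_univ_two, Pi.add_apply]; ring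

lemma curvOp_smul_right (r : A) (U V W : Fin 2 → A) :
    P.curvOp U V (r • W) = r • P.curvOp U V W := by
  ext α; simp only [curvOp, Fin.sum_univ_two, Pi.smul_apply, smul_eq_mul]; ring

lemma curvOp_swap (U V W : Fin 2 → A) : P.curvOp U V W = -P.curvOp V U W := by
  ext α; simp only [curvOp, curv, Fin.sum_univ_two, Pi.neg_apply]; ring

lemma curvOp_self (U W : Fin 2 → A) : P.curvOp U U W = 0 := by
  ext α; simp only [curvOp, curv, Fin.sum_univ_two, Pi.zero_apply]; ring

lemma curvOp_zero (U V : Fin 2 → A) : P.curvOp U V 0 = 0 := by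
  ext α; simp [curvOp]

lemma curvOp_add_middle (U V V' W : Fin 2 → A) :
    P.curvOp U (V + V') W = P.curvOp U V W + P.curvOp U V' W := by
  ext α; simp only [curvOp, Fin.sum_univ_two, Pi.add_apply]; ring

lemma curvOp_smul_middle (r : A) (U V W : Fin 2 → A) :
    P.curvOp U (r • V) W = r • P.curvOp U V W := by
  ext α; simp only [curvOp, Fin.sum_univ_two, Pi.smul_apply, smul_eq_mul]; ring

lemma curvOp_push {X Y : Derivation ℝ A A} (hX : X ∈ 𝒱) (hY : Y ∈ 𝒱) (W : Fin 2 → A) :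
    P.curvOp (P.push X) (P.push Y) W =
      P.cov X (P.cov Y W) - P.cov Y (P.cov X W) - P.cov ⁅X, Y⁆ W := by
  ext α
  exact (P.cov_commutator hX hY W α).symm

lemma frameTension_rotate
    {c d : A} (hcd : c ^ 2 + d ^ 2 = 1) {E₁ E₂ E₃ Z Z' : Derivation ℝ A A}
    (hZ : Z + ((c • E₁ + d • E₂) c + (d • E₁ - c • E₂) d) • E₁ +
      ((c • E₁ + d • E₂) d - (d • E₁ - c • E₂) c) • E₂ = Z') :
    P.frameTension (c • E₁ + d • E₂) (d • E₁ - c • E₂) E₃ Z' = P.frameTension E₁ E₂ E₃ Z := by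
  rw [← hZ]
  ext α
  simp only [frameTension, P.cov_add_left, P.cov_smul_left, P.cov_sub_left, P.push_add, P.push_sub,
    P.push_smul, P.cov_add, P.cov_sub, P.cov_smul, Pi.add_apply, Pi.sub_apply, Pi.smul_apply,
    smul_eq_mul, Derivation.add_apply, Derivation.sub_apply, Derivation.smul_apply]
  linear_combination (P.cov E₁ (P.push E₁) α + P.cov E₂ (P.push E₂) α) * hcd

lemma frameLaplacian_rotate
    {c d : A} (hcd : c ^ 2 + d ^ 2 = 1) {E₁ E₂ E₃ Z Z' : Derivation ℝ A A}
    (hZ : Z + ((c • E₁ + d • E₂) c + (d • E₁ - c • E₂) d) • E₁ +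
      ((c • E₁ + d • E₂) d - (d • E₁ - c • E₂) c) • E₂ = Z') (W : Fin 2 → A) :
    P.frameLaplacian (c • E₁ + d • E₂) (d • E₁ - c • E₂) E₃ Z' W =
      P.frameLaplacian E₁ E₂ E₃ Z W := by
  rw [← hZ]
  ext α
  simp only [frameLaplacian, P.cov_add_left, P.cov_smul_left, P.cov_sub_left,
    P.cov_add, P.cov_sub, P.cov_smul, Pi.add_apply, Pi.sub_apply, Pi.smul_apply,
    smul_eq_mul, Derivation.add_apply, Derivation.sub_apply, Derivation.smul_apply]
  linear_combination (P.cov E₁ (P.cov E₁ W) α + P.cov E₂ (P.cov E₂ W) α) * hcd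

lemma frameBitension_rotate
    {c d : A} (hcd : c ^ 2 + d ^ 2 = 1) {E₁ E₂ E₃ Z Z' : Derivation ℝ A A}
    (hZ : Z + ((c • E₁ + d • E₂) c + (d • E₁ - c • E₂) d) • E₁ +
      ((c • E₁ + d • E₂) d - (d • E₁ - c • E₂) c) • E₂ = Z') :
    P.frameBitension (c • E₁ + d • E₂) (d • E₁ - c • E₂) E₃ Z' =
      P.frameBitension E₁ E₂ E₃ Z := by
  unfold frameBitension
  rw [P.frameTension_rotate hcd hZ, P.frameLaplacian_rotate hcd hZ]
  congr 1
  set T := P.frameTension E₁ E₂ E₃ Z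
  have hsub : d • E₁ - c • E₂ = d • E₁ + (-c) • E₂ := by rw [neg_smul, sub_eq_add_neg]
  ext α
  simp only [hsub, P.push_add, P.push_smul, P.curvOp_add_left, P.curvOp_smul_left,
    P.curvOp_add_right, P.curvOp_smul_right, Pi.add_apply, Pi.smul_apply, smul_eq_mul]
  linear_combination (P.curvOp (P.push E₁) T (P.push E₁) α +
      P.curvOp (P.push E₂) T (P.push E₂) α) * hcd

end PullbackGeometry

namespace AdaptedFrame

variable {A : Type*} [CommRing A] [Algebra ℝ A] {𝒱 : Submodule A (Derivation ℝ A A)}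
  {P : PullbackGeometry A 𝒱} {e₁ e₂ e₃ : Derivation ℝ A A}

/-- The tension field of a Riemannian submersion is minus the image of the mean curvature vector
`x e₁ + y e₂` of the fibres. -/
lemma frameTension_eq (h : AdaptedFrame P e₁ e₂ e₃) {p₁ p₂ p₃ x y : A}
    (h12 : ⁅e₁, e₂⁆ = p₁ • e₁ + p₂ • e₂ + p₃ • e₃) :
    P.frameTension e₁ e₂ e₃ ((x + p₂) • e₁ + (y - p₁) • e₂) =
      -(x • P.push e₁ + y • P.push e₂) := by
  obtain ⟨a1, -, -, a4⟩ := h.horizontal_bracket h12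
  ext α
  simp only [PullbackGeometry.frameTension, a1, a4, h.vertical, P.cov_zero, P.push_add, P.push_smul,
    Pi.add_apply, Pi.sub_apply, Pi.neg_apply, Pi.smul_apply, Pi.zero_apply, smul_eq_mul]
  ring

lemma cov_combination (X : Derivation ℝ A A) {ρ : A}
    (h1 : P.cov X (P.push e₁) = ρ • P.push e₂) (h2 : P.cov X (P.push e₂) = -ρ • P.push e₁)
    (x y : A) :
    P.cov X (x • P.push e₁ + y • P.push e₂) =
      (X x - ρ * y) • P.push e₁ + (X y + ρ * x) • P.push e₂ := by
  ext α
  simp only [P.cov_add, P.cov_smul, h1, h2, Pi.add_apply, Pi.smul_apply, smul_eq_mul]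
  ring

/-- The bitension field of a Riemannian submersion in an adapted frame whose connection form is
`(ρ, 0, G)`. -/
lemma frameBitension_eq (h : AdaptedFrame P e₁ e₂ e₃) {ρ G σ x y K x₁ y₁ x₂ y₂ x₃ y₃ : A}
    (h12 : ⁅e₁, e₂⁆ = -ρ • e₁ - (2 * σ) • e₃)
    (h13 : ⁅e₁, e₃⁆ = -G • e₂ + x • e₃) (h23 : ⁅e₂, e₃⁆ = G • e₁ + y • e₃)
    (hK : K = e₂ ρ - ρ ^ 2 - 2 * σ * G)
    (hx₁ : x₁ = e₁ x - ρ * y) (hy₁ : y₁ = e₁ y + ρ * x) (hx₂ : x₂ = e₂ x) (hy₂ : y₂ = e₂ y)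
    (hx₃ : x₃ = e₃ x - G * y) (hy₃ : y₃ = e₃ y + G * x)
    (hbi : P.frameBitension e₁ e₂ e₃ (x • e₁ + (ρ + y) • e₂) = 0) :
    e₁ x₁ - ρ * y₁ + e₂ x₂ + e₃ x₃ - G * y₃ - x * x₁ - (ρ + y) * x₂ + K * x = 0 ∧
    e₁ y₁ + ρ * x₁ + e₂ y₂ + e₃ y₃ + G * x₃ - x * y₁ - (ρ + y) * y₂ + K * y = 0 := by
  have k12 : ⁅e₁, e₂⁆ = -ρ • e₁ + (0 : A) • e₂ + (-(2 * σ)) • e₃ := by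
    rw [h12, zero_smul, add_zero, neg_smul (2 * σ), sub_eq_add_neg]
  obtain ⟨a1, a2, a3, a4⟩ := h.horizontal_bracket k12
  obtain ⟨-, -, -, a5, a6⟩ := h.vertical_bracket (r₁₁ := 0) (r₂₂ := 0)
    (r₂₁ := G) (by rw [h13, zero_smul, zero_add]) (by rw [h23, zero_smul, add_zero])
  rw [neg_neg] at a1 a5
  rw [neg_zero, zero_smul] at a3
  rw [zero_smul] at a4
  have hT : P.frameTension e₁ e₂ e₃ (x • e₁ + (ρ + y) • e₂) =
      -(x • P.push e₁ + y • P.push e₂) := by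
    rw [← h.frameTension_eq k12]
    congr 3
    · ring
    · ring
  have c1 := cov_combination e₁ a1 a2
  have c2 := cov_combination e₂ (ρ := 0) (by rw [a3, zero_smul]) (by rw [a4, neg_zero, zero_smul])
  have c3 := cov_combination e₃ a5 a6
  have r1 : P.curvOp (P.push e₁) (P.push e₂) (P.push e₁) = -K • P.push e₂ := by
    rw [P.curvOp_push h.mem₁ h.mem₂, h12, a1, a3, P.cov_sub_left, P.cov_smul_left, P.cov_smul_left,
      a1, a5, P.cov_smul, a4, smul_zero, P.cov_zero, hK]
    ext α
    simp only [Pi.add_apply, Pi.sub_apply, Pi.smul_apply, Pi.zero_apply, smul_eq_mul]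
    ring
  have r2 : P.curvOp (P.push e₁) (P.push e₂) (P.push e₂) = K • P.push e₁ := by
    rw [P.curvOp_push h.mem₁ h.mem₂, h12, a2, a4, P.cov_sub_left, P.cov_smul_left, P.cov_smul_left,
      a2, a6, P.cov_smul, a3, smul_zero, P.cov_zero, hK]
    ext α
    simp only [Pi.add_apply, Pi.sub_apply, Pi.smul_apply, Pi.zero_apply, smul_eq_mul, map_neg]
    ring
  have r3 : P.curvOp (P.push e₂) (P.push e₁) (P.push e₂) = -K • P.push e₁ := by
    rw [P.curvOp_swap, r2, neg_smul]
  have hlap : P.frameLaplacian e₁ e₂ e₃ (x • e₁ + (ρ + y) • e₂) (x • P.push e₁ + y • P.push e₂) +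
      K • (x • P.push e₁ + y • P.push e₂) = 0 := by
    have hneg : ∀ W, P.frameLaplacian e₁ e₂ e₃ (x • e₁ + (ρ + y) • e₂) (-W) =
        -P.frameLaplacian e₁ e₂ e₃ (x • e₁ + (ρ + y) • e₂) W := by
      intro W
      simp only [PullbackGeometry.frameLaplacian, P.cov_neg]
      abel
    have hm : -(x • P.push e₁ + y • P.push e₂) = (-x) • P.push e₁ + (-y) • P.push e₂ := by
      rw [neg_smul, neg_smul, neg_add]
    unfold PullbackGeometry.frameBitension at hbi
    rw [hT, h.vertical, P.curvOp_zero, hneg, hm, P.curvOp_add_middle, P.curvOp_add_middle,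
      P.curvOp_smul_middle, P.curvOp_smul_middle, P.curvOp_smul_middle, P.curvOp_smul_middle,
      P.curvOp_self, P.curvOp_self, r1, r3] at hbi
    rw [← neg_eq_zero, ← hbi]
    ext α
    simp only [Pi.add_apply, Pi.sub_apply, Pi.smul_apply, Pi.zero_apply, Pi.neg_apply, smul_eq_mul]
    ring
  have hsplit : P.frameLaplacian e₁ e₂ e₃ (x • e₁ + (ρ + y) • e₂)
      (x • P.push e₁ + y • P.push e₂) + K • (x • P.push e₁ + y • P.push e₂) =
      (e₁ x₁ - ρ * y₁ + e₂ x₂ + e₃ x₃ - G * y₃ - x * x₁ - (ρ + y) * x₂ + K * x) • P.push e₁ +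
      (e₁ y₁ + ρ * x₁ + e₂ y₂ + e₃ y₃ + G * x₃ - x * y₁ - (ρ + y) * y₂ + K * y) • P.push e₂ := by
    unfold PullbackGeometry.frameLaplacian
    rw [P.cov_add_left, P.cov_smul_left, P.cov_smul_left, c1, c2, c3, ← hx₁, ← hy₁, ← hx₃, ← hy₃,
      c1, c2, c3]
    simp only [zero_mul, sub_zero, add_zero, ← hx₂, ← hy₂]
    ext α
    simp only [Pi.add_apply, Pi.sub_apply, Pi.smul_apply, smul_eq_mul]
    ring
  rw [hlap] at hsplit
  have := h.coeff_eq ((by rw [zero_smul, zero_smul, add_zero] :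
    (0 : A) • P.push e₁ + (0 : A) • P.push e₂ = 0).trans hsplit)
  exact ⟨this.1.symm, this.2.symm⟩

end AdaptedFrame

/-- The structure equations of a Riemannian submersion from a BCV space, together with the equation
for its tension field and the consequence of biharmonicity, in the frame adapted to the Killing
field. Here `V = t c E₁ + t d E₂ + a E₃` is the unit vertical field. -/
theorem BCVFrame.exists_submersionFrame {A : Type*} [CommRing A] [Algebra ℝ A]
    {𝒱 : Submodule A (Derivation ℝ A A)} {P : PullbackGeometry A 𝒱} {M τ X Y a t u c d : A}
    {E₁ E₂ E₃ : Derivation ℝ A A} (h : BCVFrame M (2 * τ) X Y E₁ E₂ E₃)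
    (hcd : c ^ 2 + d ^ 2 = 1) (hat : a ^ 2 + t ^ 2 = 1) (htu : t * u = 1)
    {e₁ e₂ e₃ : Derivation ℝ A A} (he₁ : e₁ = -a • (c • E₁ + d • E₂) + t • E₃)
    (he₂ : e₂ = d • E₁ - c • E₂) (he₃ : e₃ = t • (c • E₁ + d • E₂) + a • E₃)
    (hP : AdaptedFrame P e₁ e₂ e₃) :
    ∃ σ ρ G x y : A, SubmersionFrame M τ a t u σ ρ G x y e₁ e₂ e₃ ∧
      P.frameTension E₁ E₂ E₃ ((2 * M * X) • E₁ + (2 * M * Y) • E₂) =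
        -(x • P.push e₁ + y • P.push e₂) ∧
      P.frameBitension E₁ E₂ E₃ ((2 * M * X) • E₁ + (2 * M * Y) • E₂) =
        P.frameBitension e₁ e₂ e₃ (x • e₁ + (ρ + y) • e₂) := by
  obtain ⟨p, C, G, hrot, hZ⟩ := h.rotate hcd
  subst he₁ he₂ he₃
  obtain ⟨σ, ρ, x, y, hS, hC, hρ⟩ := hrot.tilt hat htu hP
  refine ⟨σ, ρ, G, x, y, hS, ?_⟩
  have hperm : ∀ E₁ E₂ E₃ Z : Derivation ℝ A A,
      P.frameTension E₁ E₂ E₃ Z = P.frameTension E₁ E₃ E₂ Z ∧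
      P.frameBitension E₁ E₂ E₃ Z = P.frameBitension E₁ E₃ E₂ Z := by
    intro E₁ E₂ E₃ Z
    have k1 : P.frameTension E₁ E₂ E₃ Z = P.frameTension E₁ E₃ E₂ Z := by
      simp only [PullbackGeometry.frameTension]; abel
    refine ⟨k1, ?_⟩
    simp only [PullbackGeometry.frameBitension, ← k1, PullbackGeometry.frameLaplacian]
    abel
  set n := c • E₁ + d • E₂ with hn
  set e := d • E₁ - c • E₂ with he
  have htilt : (C • n - p • e) + ((-a • n + t • E₃) (-a) + (t • n - (-a) • E₃) t) • n +
      ((-a • n + t • E₃) t - (t • n - (-a) • E₃) (-a)) • E₃ =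
      x • (-a • n + t • E₃) + (ρ + y) • e := by
    have k : t • n - (-a) • E₃ = t • n + a • E₃ := by rw [neg_smul, sub_neg_eq_add]
    rw [k, map_neg, map_neg, hS.e₁_a, hS.e₁_t, hS.e₃_a, hS.e₃_t, hC, hρ]
    ext r
    simp only [Derivation.add_apply, Derivation.sub_apply, Derivation.smul_apply, smul_eq_mul]
    ring
  have hat' : (-a) ^ 2 + t ^ 2 = 1 := by rw [neg_sq, hat]
  have k : t • n - (-a) • E₃ = t • n + a • E₃ := by rw [neg_smul, sub_neg_eq_add]
  have kT := P.frameTension_rotate (E₃ := e) hat' htilt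
  have kB := P.frameBitension_rotate (E₃ := e) hat' htilt
  rw [k] at kT kB
  rw [← P.frameTension_rotate hcd hZ, ← P.frameBitension_rotate hcd hZ, ← hn, ← he,
    (hperm n e E₃ _).1, (hperm n e E₃ _).2, ← kT, ← kB, (hperm _ _ e _).1, (hperm _ _ e _).2]
  refine ⟨?_, rfl⟩
  have k12 : ⁅-a • n + t • E₃, e⁆ = -ρ • (-a • n + t • E₃) + (0 : A) • e +
      (-(2 * σ)) • (t • n + a • E₃) := by
    rw [hS.bracket₁₂, zero_smul, add_zero, neg_smul (2 * σ), sub_eq_add_neg]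
  rw [← hP.frameTension_eq k12]
  congr 3
  · ring
  · ring

/-! ### The twist is constant along the fibres -/

lemma deriv_ofNat {A : Type*} [CommRing A] [Algebra ℝ A] (D : Derivation ℝ A A) (n : ℕ)
    [n.AtLeastTwo] : D (ofNat(n) : A) = 0 :=
  D.map_natCast n

/-- A root of a polynomial whose coefficients are constant along `D` is itself constant along `D`,
up to nilpotents and to the leading coefficient. -/
lemma exists_coeff_mul_pow_eq_zero {A : Type*} [CommRing A] [Algebra ℝ A] (D : Derivation ℝ A A)
    (σ : A) (n N : ℕ) (P : Polynomial A) (hP : ∀ i, D (P.coeff i) = 0) (hn : P.natDegree ≤ n)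
    (h0 : P.eval σ * D σ ^ (N + 1) = 0) :
    ∃ k, (n.factorial : A) * P.coeff n * D σ ^ k = 0 := by
  induction n generalizing N P with
  | zero =>
    refine ⟨N + 1, ?_⟩
    rw [Polynomial.eq_C_of_natDegree_le_zero hn, Polynomial.eval_C] at h0
    simpa using h0
  | succ n ih =>
    have hev : D (P.eval σ) = P.derivative.eval σ * D σ := by
      rw [Derivation.apply_eval_eq]
      have : D.mapCoeffs P = 0 := by
        ext i
        rw [Derivation.mapCoeffs_apply, hP]
        rfl
      rw [this, map_zero, zero_add, smul_eq_mul]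
    have h1 : P.derivative.eval σ * D σ ^ (N + 2 + 1) = 0 := by
      have := congrArg D h0
      rw [map_zero, Derivation.leibniz, Derivation.leibniz_pow, hev] at this
      simp only [smul_eq_mul, nsmul_eq_mul, Nat.add_sub_cancel] at this
      linear_combination D σ * this - ((N + 1 : ℕ) : A) * D (D σ) * h0
    obtain ⟨k, hk⟩ := ih (N + 2) P.derivative
      (fun i => by
        rw [Polynomial.coeff_derivative, Derivation.leibniz, hP, smul_zero, add_zero, map_add,
          Derivation.map_natCast, Derivation.map_one_eq_zero, add_zero, smul_zero])
      ((Polynomial.natDegree_derivative_le P).trans (by omega)) h1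
    refine ⟨k, ?_⟩
    rw [Polynomial.coeff_derivative] at hk
    rw [Nat.factorial_succ]
    push_cast
    linear_combination hk

section TwistPolynomial

open Polynomial

variable {A : Type*} [CommRing A] (τ lam K z Δ Ξ : A)

/-- The quantity `lam a²`, in terms of `σ` and of the curvature `K` of the target. -/
def twistL : A[X] := C K - C τ ^ 2 - 3 * X ^ 2

/-- The part of `Hess K (e₁, e₁)` that does not involve `x`, in terms of `σ` and `K`. -/
def twistC : A[X] := 12 * X ^ 2 * (C τ ^ 2 - X ^ 2) - 2 * twistL τ K * (C τ + 4 * X) * (C τ + X)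

/-- The factor `g` in `3 σ² (Ξ - c₀ z) = g (lam - lam a²) (e₁ K)²`, where `c₀` is `twistC`, and
`z`, `Ξ` are as in `twistPolynomial`. -/
def twistG : A[X] := 5 * C τ * twistL τ K * (C τ + 4 * X) + 36 * X ^ 4 +
  6 * X ^ 2 * (C τ + X) * (C τ + 4 * X) + 24 * twistL τ K * X ^ 2

/-- The quantity `20 lam (τ + 2 σ) a t (e₂ K)`, in terms of `σ` and functions of the target. -/
def twistS : A[X] := 12 * X ^ 2 * C Δ - 5 * C z - 4 * twistG τ K * (C lam - twistL τ K) -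
  24 * X ^ 2 * twistC τ K

/-- The polynomial equation of the twist `σ` of a Riemannian submersion from a BCV space. Its
coefficients are functions of the target: the curvature `K`, the squared norm `z` of its gradient,
its Laplacian `Δ`, and the value `Ξ` of its Hessian at the gradient rotated by a right angle. -/
def twistPolynomial : A[X] := twistG τ K * twistS τ lam K z Δ ^ 2 +
  1200 * X ^ 2 * (C τ + 2 * X) ^ 2 * twistL τ K * (C Ξ - twistC τ K * C z) -
  400 * (C τ + 2 * X) ^ 2 * twistG τ K * twistL τ K * (C lam - twistL τ K) * C z

lemma natDegree_twistG : (twistG τ K).natDegree ≤ 4 := by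
  unfold twistG twistL; compute_degree
lemma coeff_twistG : (twistG τ K).coeff 4 = -12 := by
  unfold twistG twistL; compute_degree; all_goals norm_num
lemma natDegree_twistS : (twistS τ lam K z Δ).natDegree ≤ 6 := by
  unfold twistS twistG twistC twistL; compute_degree
lemma coeff_twistS : (twistS τ lam K z Δ).coeff 6 = -144 := by
  unfold twistS twistG twistC twistL; compute_degree; all_goals norm_num
lemma natDegree_twistPolynomial : (twistPolynomial τ lam K z Δ Ξ).natDegree ≤ 16 := by
  unfold twistPolynomial twistS twistG twistC twistL; compute_degree
lemma coeff_twistPolynomial : (twistPolynomial τ lam K z Δ Ξ).coeff 16 = -248832 := by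
  unfold twistPolynomial
  have e1 : (twistG τ K * twistS τ lam K z Δ ^ 2).coeff 16 = -248832 := by
    have h1 := coeff_mul_add_eq_of_natDegree_le (natDegree_twistG τ K)
      (natDegree_pow_le_of_le 2 (natDegree_twistS τ lam K z Δ))
    rw [coeff_pow_of_natDegree_le (natDegree_twistS τ lam K z Δ), coeff_twistG, coeff_twistS] at h1
    norm_num at h1 ⊢
    exact h1
  rw [coeff_sub, coeff_add, e1, coeff_eq_zero_of_natDegree_lt, coeff_eq_zero_of_natDegree_lt]
  · ring
  · refine Nat.lt_of_le_of_lt (m := 10) ?_ (by norm_num)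
    unfold twistG twistL; compute_degree
  · refine Nat.lt_of_le_of_lt (m := 10) ?_ (by norm_num)
    unfold twistC twistL; compute_degree

variable [Algebra ℝ A]
lemma coeff_twistPolynomial_const (D : Derivation ℝ A A)
    (hτ : D τ = 0) (hlam : D lam = 0) (hK : D K = 0) (hz : D z = 0) (hΔ : D Δ = 0) (hΞ : D Ξ = 0)
    (i : ℕ) : D ((twistPolynomial τ lam K z Δ Ξ).coeff i) = 0 := by
  have hn : ∀ (n : ℕ) [n.AtLeastTwo], D.mapCoeffs (ofNat(n) : A[X]) = 0 := fun n _ =>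
    D.mapCoeffs.map_natCast n
  have hC : ∀ c : A, D c = 0 → D.mapCoeffs (C c) = 0 := fun c hc => by
    rw [Derivation.mapCoeffs_C, hc]
    exact map_zero (PolynomialModule.lsingle A 0)
  have : D.mapCoeffs (twistPolynomial τ lam K z Δ Ξ) = 0 := by
    simp only [twistPolynomial, twistS, twistG, twistC, twistL, map_add, map_sub,
      Derivation.leibniz, Derivation.leibniz_pow, hC _ hτ, hC _ hlam, hC _ hK, hC _ hz,
      hC _ hΔ, hC _ hΞ, Derivation.mapCoeffs_X, hn,
      smul_zero, add_zero, sub_zero]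
  rw [← Derivation.mapCoeffs_apply, this]; rfl
end TwistPolynomial

namespace SubmersionFrame

variable {A : Type*} [CommRing A] [Algebra ℝ A] {M τ a t u σ ρ G x y : A}
  {e₁ e₂ e₃ : Derivation ℝ A A}

lemma comm₁₂ (h : SubmersionFrame M τ a t u σ ρ G x y e₁ e₂ e₃) (r : A) :
    e₁ (e₂ r) - e₂ (e₁ r) = -ρ * e₁ r - 2 * σ * e₃ r := by
  have := congrArg (fun D : Derivation ℝ A A => D r) h.bracket₁₂
  simpa only [Derivation.commutator_apply, Derivation.sub_apply, Derivation.smul_apply,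
    smul_eq_mul] using this

lemma comm₁₃ (h : SubmersionFrame M τ a t u σ ρ G x y e₁ e₂ e₃) (r : A) :
    e₁ (e₃ r) - e₃ (e₁ r) = -G * e₂ r + x * e₃ r := by
  have := congrArg (fun D : Derivation ℝ A A => D r) h.bracket₁₃
  simpa only [Derivation.commutator_apply, Derivation.add_apply, Derivation.smul_apply,
    smul_eq_mul] using this

lemma comm₂₃ (h : SubmersionFrame M τ a t u σ ρ G x y e₁ e₂ e₃) (r : A) :
    e₂ (e₃ r) - e₃ (e₂ r) = G * e₁ r + y * e₃ r := by
  have := congrArg (fun D : Derivation ℝ A A => D r) h.bracket₂₃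
  simpa only [Derivation.commutator_apply, Derivation.add_apply, Derivation.smul_apply,
    smul_eq_mul] using this

/-- The integrability condition of the equations for `σ`. It also says that the curvature
`τ² + (4 m - l²) a² + 3 σ²` of the target is constant along the fibres. -/
lemma deriv_twist (h : SubmersionFrame M τ a t u σ ρ G x y e₁ e₂ e₃) :
    (4 * M - 4 * τ ^ 2) * a * t * x + 3 * σ * e₃ σ = 0 := by
  have k := h.comm₁₂ σ
  simp only [h.e₂_σ, h.e₁_σ, map_sub, Derivation.leibniz, Derivation.leibniz_pow,
    smul_eq_mul, nsmul_eq_mul, deriv_ofNat, h.M_const, h.τ_const, h.e₁_a, h.e₁_t, h.e₁_y, h.e₂_x,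
    mul_zero, add_zero, sub_zero] at k
  apply AdaptedFrame.eq_zero_of_add_self
  linear_combination k

lemma e₂_G (h : SubmersionFrame M τ a t u σ ρ G x y e₁ e₂ e₃) : e₂ G = G * (ρ + y) := by
  have k := congrArg e₂ h.t_mul_G
  simp only [map_sub, Derivation.leibniz, smul_eq_mul, h.τ_const, h.e₂_t, h.e₂_a, h.e₂_σ,
    h.e₂_y] at k
  linear_combination u * k + (G * (ρ + y) - e₂ G) * h.t_mul_u - u * G * h.t_mul_ρ -
    u * y * h.t_mul_G

lemma e₁_G (h : SubmersionFrame M τ a t u σ ρ G x y e₁ e₂ e₃) : e₁ G = e₃ ρ + x * G := by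
  have k := congrArg e₁ h.t_mul_G
  have k' := congrArg e₃ h.t_mul_ρ
  simp only [map_sub, map_neg, map_add, Derivation.leibniz, smul_eq_mul, h.τ_const, h.e₁_t, h.e₁_a,
    h.e₁_σ, h.e₁_y, h.e₃_t, h.e₃_a] at k k'
  linear_combination u * k - u * k' + (e₃ ρ + x * G - e₁ G) * h.t_mul_u - u * x * h.t_mul_G

lemma e₃_σ_pow (h : SubmersionFrame M τ a t u σ ρ G x y e₁ e₂ e₃) : ∃ N, e₃ σ ^ N = 0 := by
  set lam := 4 * M - 4 * τ ^ 2 with hlam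
  have hl : ∀ D : Derivation ℝ A A, D lam = 0 := fun D => by
    simp only [hlam, map_sub, Derivation.leibniz, Derivation.leibniz_pow, h.M_const, h.τ_const,
      deriv_ofNat, smul_zero, add_zero, sub_zero]
  have h4 := h.deriv_twist
  have e2σ := h.e₂_σ
  have e2y := h.e₂_y
  rw [← hlam] at h4 e2σ e2y
  clear_value lam
  have hat := h.sq_add_sq
  have hρ := h.t_mul_ρ
  -- the curvature of the target, its gradient and its Hessian
  set K := τ ^ 2 + lam * a ^ 2 + 3 * σ ^ 2 with hK
  have K3 : e₃ K = 0 := by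
    simp only [hK, map_add, Derivation.leibniz, Derivation.leibniz_pow, hl, h.τ_const,
      deriv_ofNat, smul_eq_mul, nsmul_eq_mul, h.e₃_a]
    push_cast
    linear_combination 2 * h4
  set k₁ := e₁ K with hk₁
  set k₂ := e₂ K with hk₂
  have k₁_eq : k₁ = 12 * σ ^ 2 * x := by
    simp only [hk₁, hK, map_add, Derivation.leibniz, Derivation.leibniz_pow, hl, h.τ_const,
      deriv_ofNat, smul_eq_mul, nsmul_eq_mul, h.e₁_a, h.e₁_σ]
    push_cast
    ring
  have k₂_eq : k₂ = 12 * σ ^ 2 * y - 2 * lam * a * t * (τ + 4 * σ) := by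
    simp only [hk₂, hK, map_add, Derivation.leibniz, Derivation.leibniz_pow, hl, h.τ_const,
      deriv_ofNat, smul_eq_mul, nsmul_eq_mul, h.e₂_a, e2σ]
    push_cast
    ring
  have k₁3 : e₃ k₁ = G * k₂ := by
    have := h.comm₁₃ K
    rw [K3, map_zero] at this
    linear_combination -this
  have k₂3 : e₃ k₂ = -G * k₁ := by
    have := h.comm₂₃ K
    rw [K3, map_zero] at this
    linear_combination -this
  have k12 : e₁ k₂ - e₂ k₁ = -ρ * k₁ := by
    have := h.comm₁₂ K
    rw [K3] at this
    linear_combination this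
  have q11 : e₁ k₁ = 60 * σ ^ 2 * x ^ 2 + ρ * k₂ + (12 * σ ^ 2 * (τ ^ 2 - σ ^ 2) -
      2 * lam * a ^ 2 * (τ + 4 * σ) * (τ + σ)) := by
    rw [k₂_eq]
    have := congrArg e₁ k₁_eq
    simp only [Derivation.leibniz, Derivation.leibniz_pow, deriv_ofNat, smul_eq_mul,
      nsmul_eq_mul, h.e₁_σ, h.e₁_x] at this
    push_cast at this
    rw [this]
    linear_combination (2 * lam * a * (τ + 4 * σ)) * hρ
  have q12 : e₁ k₂ = -ρ * k₁ + 60 * σ ^ 2 * x * y - 20 * lam * σ * a * t * x := by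
    have h2 := congrArg e₂ k₁_eq
    simp only [Derivation.leibniz, Derivation.leibniz_pow, deriv_ofNat, smul_eq_mul,
      nsmul_eq_mul, e2σ, h.e₂_x] at h2
    push_cast at h2
    linear_combination k12 + h2 - 4 * σ * h4
  have q21 : e₂ k₁ = 60 * σ ^ 2 * x * y - 20 * lam * σ * a * t * x := by
    linear_combination q12 - k12
  have q22 : e₂ k₂ = 60 * σ ^ 2 * y ^ 2 - 40 * lam * σ * a * t * y +
      (12 * lam * σ ^ 2 + 2 * lam * (τ + σ) * (τ + 4 * σ) + 8 * lam ^ 2 * a ^ 2) * t ^ 2 +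
      (12 * σ ^ 2 * (τ ^ 2 - σ ^ 2) - 2 * lam * a ^ 2 * (τ + 4 * σ) * (τ + σ)) := by
    have h2 := congrArg e₂ k₂_eq
    simp only [map_sub, map_add, Derivation.leibniz, Derivation.leibniz_pow, deriv_ofNat,
      smul_eq_mul, nsmul_eq_mul, e2σ, e2y, hl, h.τ_const, h.e₂_a, h.e₂_t] at h2
    push_cast at h2
    rw [h2]
    ring
  -- functions constant along the fibres: `|∇K|²`, `ΔK` and `Hess K (J ∇K, J ∇K)`
  set z := k₁ ^ 2 + k₂ ^ 2 with hz
  have z3 : e₃ z = 0 := by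
    simp only [hz, map_add, Derivation.leibniz_pow, smul_eq_mul, nsmul_eq_mul, k₁3, k₂3]
    push_cast
    ring
  set H₁₁ := e₁ k₁ - ρ * k₂ with hH₁₁
  set H₁₂ := e₂ k₁ with hH₁₂
  set H₂₂ := e₂ k₂ with hH₂₂
  have H11 : e₃ H₁₁ = 2 * G * H₁₂ := by
    have c1 := h.comm₁₃ k₁
    rw [k₁3, Derivation.leibniz, smul_eq_mul, smul_eq_mul, h.e₁_G] at c1
    simp only [hH₁₁, map_sub, Derivation.leibniz, smul_eq_mul, k₂3]
    linear_combination -c1 + G * k12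
  have H12 : e₃ H₁₂ = G * (H₂₂ - H₁₁) := by
    have c1 := h.comm₂₃ k₁
    rw [k₁3, Derivation.leibniz, smul_eq_mul, smul_eq_mul, h.e₂_G] at c1
    linear_combination -c1
  have H22 : e₃ H₂₂ = -(2 * G * H₁₂) := by
    have c1 := h.comm₂₃ k₂
    rw [k₂3, Derivation.leibniz, map_neg, smul_eq_mul, smul_eq_mul, h.e₂_G] at c1
    linear_combination -c1 - G * k12
  set Δ := H₁₁ + H₂₂ with hΔ
  have Δ3 : e₃ Δ = 0 := by rw [hΔ, map_add, H11, H22]; ring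
  set Ξ := H₁₁ * k₂ ^ 2 - 2 * H₁₂ * k₁ * k₂ + H₂₂ * k₁ ^ 2 with hΞ
  have Ξ3 : e₃ Ξ = 0 := by
    simp only [hΞ, map_add, map_sub, Derivation.leibniz, Derivation.leibniz_pow, deriv_ofNat,
      smul_eq_mul, nsmul_eq_mul, H11, H12, H22, k₁3, k₂3]
    push_cast
    ring
  -- the polynomial equation satisfied by `σ`
  set c₀ := 12 * σ ^ 2 * (τ ^ 2 - σ ^ 2) - 2 * (lam * a ^ 2) * (τ + 4 * σ) * (τ + σ) with hc₀
  set g := 5 * τ * (lam * a ^ 2) * (τ + 4 * σ) + 36 * σ ^ 4 +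
    6 * σ ^ 2 * (τ + σ) * (τ + 4 * σ) + 24 * (lam * a ^ 2) * σ ^ 2 with hg
  have r1 : 12 * σ ^ 2 * Δ - 5 * z - 4 * g * (lam - lam * a ^ 2) - 24 * σ ^ 2 * c₀ =
      20 * lam * (τ + 2 * σ) * (a * t * k₂) := by
    rw [hΔ, hH₁₁, q11, q22, hz, k₁_eq, k₂_eq, hc₀, hg]
    linear_combination 4 * lam * g * hat
  have r2 : 3 * σ ^ 2 * (Ξ - c₀ * z) = g * lam * t ^ 2 * k₁ ^ 2 := by
    rw [hΞ, hH₁₁, q11, q21, q22, hz, k₁_eq, k₂_eq, hc₀, hg]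
    ring
  have r3 : g * (12 * σ ^ 2 * Δ - 5 * z - 4 * g * (lam - lam * a ^ 2) - 24 * σ ^ 2 * c₀) ^ 2 +
      1200 * σ ^ 2 * (τ + 2 * σ) ^ 2 * (lam * a ^ 2) * (Ξ - c₀ * z) -
      400 * (τ + 2 * σ) ^ 2 * g * (lam * a ^ 2) * (lam - lam * a ^ 2) * z = 0 := by
    rw [r1]
    linear_combination 400 * (τ + 2 * σ) ^ 2 * (lam * a ^ 2) * r2 +
      400 * (τ + 2 * σ) ^ 2 * g * lam ^ 2 * a ^ 2 * z * hat
  have hL : K - τ ^ 2 - 3 * σ ^ 2 = lam * a ^ 2 := by rw [hK]; ring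
  have r4 : (twistPolynomial τ lam K z Δ Ξ).eval σ * e₃ σ ^ (0 + 1) = 0 := by
    simp only [twistPolynomial, twistS, twistG, twistC, twistL, Polynomial.eval_add,
      Polynomial.eval_sub, Polynomial.eval_mul, Polynomial.eval_pow, Polynomial.eval_C,
      Polynomial.eval_X, Polynomial.eval_ofNat, hL]
    linear_combination e₃ σ * r3
  obtain ⟨N, hN⟩ := exists_coeff_mul_pow_eq_zero e₃ σ 16 0 _
    (coeff_twistPolynomial_const τ lam K z Δ Ξ e₃ (h.τ_const e₃) (hl e₃) K3 z3 Δ3 Ξ3)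
    (natDegree_twistPolynomial τ lam K z Δ Ξ) r4
  refine ⟨N, ?_⟩
  rw [coeff_twistPolynomial] at hN
  have h5 : algebraMap ℝ A ((Nat.factorial 16 : ℝ) * 248832) * e₃ σ ^ N = 0 := by
    rw [map_mul, map_natCast, map_ofNat]
    linear_combination -hN
  have h6 := congrArg (fun r => algebraMap ℝ A ((Nat.factorial 16 : ℝ) * 248832)⁻¹ * r) h5
  simp only [mul_zero] at h6
  rwa [← mul_assoc, ← map_mul, inv_mul_cancel₀ (by positivity), map_one, one_mul] at h6

end SubmersionFrame

/-! ### Where the tension field does not vanish -/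

section Reduced

variable {A : Type*} [CommRing A] [IsReduced A]

lemma mul_eq_zero_of_mul_pow_eq_zero {g f : A} (n : ℕ) (h : g * f ^ n = 0) : g * f = 0 := by
  have h2 : (g * f) ^ (n + 1) = 0 := by
    rw [mul_pow, pow_succ, pow_succ]
    linear_combination g ^ n * f * h
  exact pow_eq_zero_iff (by omega) |>.1 h2

variable [Algebra ℝ A]

/-- The annihilator of an element of a reduced ring is stable under derivations. This allows to
argue on the open set `g ≠ 0` without leaving the ring: an equation `f = 0` on this set is written
`g * f = 0`. -/
lemma mul_deriv_eq_zero (D : Derivation ℝ A A) {g f : A} (h : g * f = 0) : g * D f = 0 := by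
  have h1 := congrArg D h
  rw [Derivation.leibniz, map_zero, smul_eq_mul, smul_eq_mul] at h1
  have h2 : (g * D f) ^ 2 = 0 := by linear_combination g * D f * h1 - D f * D g * h
  exact pow_eq_zero_iff two_ne_zero |>.1 h2

lemma deriv_eq_zero_of_aeval_mul_eq_zero (D : Derivation ℝ A A) {p : Polynomial ℝ} (hp : p ≠ 0)
    {σ : A} (h : Polynomial.aeval σ p * D σ = 0) : D σ = 0 := by
  have h0 : (p.map (algebraMap ℝ A)).eval σ * D σ ^ (0 + 1) = 0 := by
    rwa [Polynomial.eval_map_algebraMap, zero_add, pow_one]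
  obtain ⟨k, hk⟩ := exists_coeff_mul_pow_eq_zero D σ p.natDegree 0 _
    (fun i => by rw [Polynomial.coeff_map, D.map_algebraMap])
    (Polynomial.natDegree_map_le) h0
  have hc : (p.natDegree.factorial : ℝ) * p.coeff p.natDegree ≠ 0 :=
    mul_ne_zero (by positivity) (Polynomial.leadingCoeff_ne_zero.2 hp)
  rw [Polynomial.coeff_map, ← map_natCast (algebraMap ℝ A), ← map_mul] at hk
  have h6 := congrArg (fun r => algebraMap ℝ A (p.natDegree.factorial * p.coeff p.natDegree)⁻¹ * r)
    hk
  simp only [mul_zero] at h6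
  rw [← mul_assoc, ← map_mul, inv_mul_cancel₀ hc, map_one, one_mul] at h6
  exact eq_zero_of_pow_eq_zero h6

end Reduced

/-- The frame `SubmersionFrame` of a biharmonic Riemannian submersion: the two components of the
bitension field vanish. -/
structure BiharmonicFrame {A : Type*} [CommRing A] [Algebra ℝ A] (M τ a t u σ ρ G x y : A)
    (e₁ e₂ e₃ : Derivation ℝ A A) : Prop extends
    SubmersionFrame M τ a t u σ ρ G x y e₁ e₂ e₃ where
  bitension₁ : e₁ (e₁ x - ρ * y) - ρ * (e₁ y + ρ * x) + e₂ (e₂ x) + e₃ (e₃ x - G * y) -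
    G * (e₃ y + G * x) - x * (e₁ x - ρ * y) - (ρ + y) * e₂ x +
    (e₂ ρ - ρ ^ 2 - 2 * σ * G) * x = 0
  bitension₂ : e₁ (e₁ y + ρ * x) + ρ * (e₁ x - ρ * y) + e₂ (e₂ y) + e₃ (e₃ y + G * x) +
    G * (e₃ x - G * y) - x * (e₁ y + ρ * x) - (ρ + y) * e₂ y +
    (e₂ ρ - ρ ^ 2 - 2 * σ * G) * y = 0

/-- O'Neill's formula for the curvature of the target. -/
lemma SubmersionFrame.curvature_eq {A : Type*} [CommRing A] [Algebra ℝ A]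
    {M τ a t u σ ρ G x y : A} {e₁ e₂ e₃ : Derivation ℝ A A}
    (h : SubmersionFrame M τ a t u σ ρ G x y e₁ e₂ e₃) :
    e₂ ρ - ρ ^ 2 - 2 * σ * G = τ ^ 2 + (4 * M - 4 * τ ^ 2) * a ^ 2 + 3 * σ ^ 2 := by
  have k := congrArg e₂ h.t_mul_ρ
  simp only [map_neg, map_add, Derivation.leibniz, smul_eq_mul, h.τ_const, h.e₂_t, h.e₂_a,
    h.e₂_σ] at k
  linear_combination u * k - 2 * u * σ * h.t_mul_G - u * ρ * h.t_mul_ρ - (e₂ ρ - ρ ^ 2 -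
    2 * σ * G - (τ ^ 2 + (4 * M - 4 * τ ^ 2) * a ^ 2 + 3 * σ ^ 2)) * h.t_mul_u

section

variable {A : Type*} [CommRing A] [Algebra ℝ A] {M τ a t u σ ρ G x y : A}
  {e₁ e₂ e₃ : Derivation ℝ A A}

lemma SubmersionFrame.lam_const (h : SubmersionFrame M τ a t u σ ρ G x y e₁ e₂ e₃)
    (D : Derivation ℝ A A) : D (4 * M - 4 * τ ^ 2) = 0 := by
  simp only [map_sub, Derivation.leibniz, Derivation.leibniz_pow, h.M_const, h.τ_const,
    deriv_ofNat, smul_zero, add_zero, sub_zero]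

lemma eq_zero_of_natCast_mul (n : ℕ) (hn : n ≠ 0) {r : A} (h : (n : A) * r = 0) : r = 0 := by
  have h6 := congrArg (fun r => algebraMap ℝ A (n : ℝ)⁻¹ * r) h
  simp only [mul_zero] at h6
  rwa [← map_natCast (algebraMap ℝ A), ← mul_assoc, ← map_mul,
    inv_mul_cancel₀ (Nat.cast_ne_zero.2 hn), map_one, one_mul] at h6

variable [IsReduced A]

lemma SubmersionFrame.e₃_σ (h : SubmersionFrame M τ a t u σ ρ G x y e₁ e₂ e₃) : e₃ σ = 0 := by
  obtain ⟨N, hN⟩ := h.e₃_σ_pow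
  exact eq_zero_of_pow_eq_zero hN

/-! ### The case `l² ≠ 4 m` -/

lemma SubmersionFrame.x_eq_zero (h : SubmersionFrame M τ a t u σ ρ G x y e₁ e₂ e₃) {linv : A}
    (hl : (4 * M - 4 * τ ^ 2) * linv = 1) : x = 0 := by
  have hax : x * a = 0 := by
    have := h.deriv_twist
    rw [h.e₃_σ, mul_zero, add_zero] at this
    linear_combination linv * u * this - (x * a * h.t_mul_u) - x * a * t * u * hl
  have h1 := mul_deriv_eq_zero e₃ hax
  rw [h.e₃_a] at h1
  have h2 : x ^ 2 = 0 := by linear_combination u * h1 - x ^ 2 * h.t_mul_u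
  exact eq_zero_of_pow_eq_zero h2

/-- If `l² ≠ 4 m`, all the functions of the frame are constant along the fibres. -/
lemma BiharmonicFrame.e₃_y (h : BiharmonicFrame M τ a t u σ ρ G x y e₁ e₂ e₃) {linv : A}
    (hl : (4 * M - 4 * τ ^ 2) * linv = 1) : e₃ y = 0 := by
  obtain rfl := h.x_eq_zero hl
  have hlc := h.lam_const
  have e2σ := h.e₂_σ
  have e2y := h.e₂_y
  have hs := h.e₃_σ
  have e1y := h.e₁_y
  have hb := h.bitension₂
  rw [h.curvature_eq] at hb
  set lam := 4 * M - 4 * τ ^ 2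
  clear_value lam
  have e1a := h.e₁_a
  have e2a := h.e₂_a
  have e3a := h.e₃_a
  have e1σ := h.e₁_σ
  set p := e₃ y with hp
  rw [hs] at e1y
  simp only [mul_zero, zero_mul, add_zero, sub_zero, zero_sub, map_zero] at *
  -- `p` vanishes where `σ ≠ 0` or `a ≠ 0`
  have pσ : p * σ = 0 := by
    have k := h.comm₁₂ y
    rw [e1y, e2y, map_zero] at k
    simp only [map_sub, map_add, Derivation.leibniz, Derivation.leibniz_pow, hlc, h.τ_const,
      smul_eq_mul, nsmul_eq_mul, e1σ, h.e₁_t, e1y, mul_zero, add_zero, sub_zero] at k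
    exact AdaptedFrame.eq_zero_of_add_self (by linear_combination k)
  have pa : p * a = 0 := by
    have k := mul_deriv_eq_zero e₂ pσ
    rw [e2σ] at k
    linear_combination -(linv * u) * k + 2 * linv * u * y * pσ - (p * a) * h.t_mul_u -
      p * a * t * u * hl
  have pτ : p * τ = 0 := by
    have k := mul_deriv_eq_zero e₂ pa
    rw [e2a] at k
    linear_combination -u * k - p * (τ + σ) * h.t_mul_u - pσ
  have pρ : p * ρ = 0 := by
    linear_combination u * p * h.t_mul_ρ - u * (τ + σ) * pa - p * ρ * h.t_mul_u
  have pG : p * G = 0 := by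
    linear_combination u * p * h.t_mul_G + u * t * pτ - u * t * pσ - u * y * pa - p * G * h.t_mul_u
  have pt : p * t ^ 2 = p := by linear_combination p * h.sq_add_sq - a * pa
  have pe2y : p * (e₂ y - (lam + y ^ 2)) = 0 := by
    rw [e2y]; linear_combination τ * pτ - σ * pσ + lam * pt
  have e2e2 : p * e₂ (e₂ y) = 2 * p * y * (lam + y ^ 2) := by
    have k := mul_deriv_eq_zero e₂ pe2y
    simp only [map_sub, map_add, Derivation.leibniz_pow, hlc, smul_eq_mul, nsmul_eq_mul] at k
    push_cast at k
    linear_combination k + 2 * y * pe2y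
  -- the bitension equation where `p ≠ 0`
  have e3p : p * (e₃ p + y * (lam + y ^ 2)) = 0 := by
    rw [e1y, map_zero] at hb
    linear_combination p * hb - e2e2 + y * pe2y + (ρ * y + e₂ y) * pρ + G * y * pG -
      y * lam * a * pa - y * τ * pτ - 3 * y * σ * pσ
  have e2p : e₂ p = 3 * y * p := by
    have k := h.comm₂₃ y
    rw [e1y, e2y] at k
    simp only [map_sub, map_add, Derivation.leibniz, Derivation.leibniz_pow, hlc, h.τ_const,
      smul_eq_mul, nsmul_eq_mul, hs, h.e₃_t, ← hp, mul_zero, add_zero, sub_zero] at k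
    push_cast at k
    linear_combination k
  have e1p : p * e₁ p = 0 := by
    have k := h.comm₁₃ y
    rw [e1y, map_zero] at k
    linear_combination p * k - e₂ y * pG
  have k1 : p * (3 * p ^ 2 - (y ^ 4 - lam ^ 2)) = 0 := by
    have k := h.comm₂₃ p
    have k' := mul_deriv_eq_zero e₂ e3p
    rw [e2p] at k
    simp only [map_add, Derivation.leibniz, Derivation.leibniz_pow, deriv_ofNat, hlc, ← hp,
      smul_eq_mul, nsmul_eq_mul, mul_zero, add_zero, zero_add] at k k'
    push_cast at k'
    linear_combination k' - p * k - 4 * y * e3p - (lam + 3 * y ^ 2) * pe2y - G * e1p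
  have k2 : p * (10 * y ^ 3 + 6 * lam * y) = 0 := by
    have k := mul_deriv_eq_zero e₃ k1
    simp only [map_sub, Derivation.leibniz, Derivation.leibniz_pow, deriv_ofNat, hlc, ← hp,
      smul_eq_mul, nsmul_eq_mul, mul_zero, add_zero, sub_zero] at k
    push_cast at k
    rw [mul_comm]
    refine mul_eq_zero_of_mul_pow_eq_zero 2 ?_
    linear_combination -k + 6 * p * e3p
  have k3 : p * (5 * y ^ 2 + lam) = 0 := by
    have k := mul_deriv_eq_zero e₃ k2
    simp only [map_add, Derivation.leibniz, Derivation.leibniz_pow, deriv_ofNat, hlc, ← hp,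
      smul_eq_mul, nsmul_eq_mul, mul_zero, add_zero] at k
    push_cast at k
    rw [mul_comm]
    refine mul_eq_zero_of_mul_pow_eq_zero 2 (eq_zero_of_natCast_mul 6 (by norm_num) ?_)
    linear_combination k
  have k4 : p * y = 0 := by
    have k := mul_deriv_eq_zero e₃ k3
    simp only [map_add, Derivation.leibniz, Derivation.leibniz_pow, deriv_ofNat, hlc, ← hp,
      smul_eq_mul, nsmul_eq_mul, mul_zero, add_zero] at k
    push_cast at k
    rw [mul_comm]
    refine mul_eq_zero_of_mul_pow_eq_zero 2 (eq_zero_of_natCast_mul 10 (by norm_num) ?_)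
    linear_combination k
  exact eq_zero_of_pow_eq_zero (n := 2) (by linear_combination mul_deriv_eq_zero e₃ k4)

/-- An overdetermined system: if `v w q ≠ 0`, then eliminating `lam`, and then `w / v`, from the
algebraic equation and from its first two derivatives shows that `q` is a root of a polynomial with
constant coefficients, so that `D q = -2 v q` vanishes. -/
lemma mul_eq_zero_of_overdetermined (D : Derivation ℝ A A) {lam q v w s : A} (hlam : D lam = 0)
    (hq : D q = -2 * q * v) (hw : v * (D w + (v - w) * w - lam * q) = 0)
    (hv : D v = -D w) (hs : (1 - q) * s = 1)
    (h : v * (lam * (q * (w * (1 - q) + 4 * q * v)) + w ^ 2 * (3 * v * q + w * (1 - q))) = 0) :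
    v * w * q = 0 := by
  -- first derivative
  have h2 : v * w * q * (w ^ 2 * (1 - q) + w * v * (1 - q) * (1 + 12 * q) +
      4 * v ^ 2 * q * (1 + 7 * q)) = 0 := by
    have k := mul_deriv_eq_zero D h
    simp only [map_add, map_sub, Derivation.leibniz, Derivation.leibniz_pow, deriv_ofNat, hlam, hq,
      hv, Derivation.map_one_eq_zero, smul_eq_mul, nsmul_eq_mul, mul_zero, add_zero, zero_sub] at k
    push_cast at k
    rw [mul_comm]
    refine mul_eq_zero_of_mul_pow_eq_zero 3 ?_
    have k2 : v * (lam ^ 2 * (-5 * q ^ 3 + q ^ 2) + lam * (-11 * q ^ 2 * w ^ 2 +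
        15 * q ^ 2 * w * v - 16 * q ^ 2 * v ^ 2 + 4 * q * w ^ 2 - 3 * q * w * v) +
        (-6 * q * w ^ 4 + 14 * q * w ^ 3 * v - 12 * q * w ^ 2 * v ^ 2 + 3 * w ^ 4 -
        3 * w ^ 3 * v)) = 0 := by
      linear_combination k - (lam * q * (1 - 5 * q) + 6 * w * v * q + 3 * w ^ 2 * (1 - q) -
        3 * w ^ 2 * q) * hw
    linear_combination v * (q * (w * (1 - q) + 4 * q * v)) ^ 2 * k2 -
      v * ((-11 * q ^ 2 * w ^ 2 + 15 * q ^ 2 * w * v - 16 * q ^ 2 * v ^ 2 + 4 * q * w ^ 2 -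
        3 * q * w * v) * (q * (w * (1 - q) + 4 * q * v)) + (-5 * q ^ 3 + q ^ 2) *
        (lam * (q * (w * (1 - q) + 4 * q * v)) - w ^ 2 * (3 * v * q + w * (1 - q)))) * h
  -- second derivative, reduced modulo the first one
  set α := 3456 * q ^ 5 - 5184 * q ^ 4 + 1248 * q ^ 3 + 584 * q ^ 2 - 80 * q - 24 with hα
  set β := -8064 * q ^ 5 + 5120 * q ^ 4 + 1568 * q ^ 3 - 320 * q ^ 2 - 96 * q with hβ
  have h3 : v * w * q * (α * w + β * v) = 0 := by
    have k := mul_deriv_eq_zero D h2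
    simp only [map_add, map_sub, Derivation.leibniz, Derivation.leibniz_pow, deriv_ofNat, hq,
      hv, Derivation.map_one_eq_zero, smul_eq_mul, nsmul_eq_mul, mul_zero, add_zero, zero_sub,
      zero_add] at k
    push_cast at k
    have k2 : v * w * q * (lam * (12 * q ^ 3 * w - 68 * q ^ 3 * v - 13 * q ^ 2 * w +
        3 * q ^ 2 * v + q * w + q * v) + (12 * q ^ 2 * w ^ 3 - 80 * q ^ 2 * w ^ 2 * v +
        116 * q ^ 2 * w * v ^ 2 - 112 * q ^ 2 * v ^ 3 - 13 * q * w ^ 3 + 18 * q * w ^ 2 * v -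
        25 * q * w * v ^ 2 - 8 * q * v ^ 3 + w ^ 3 - w * v ^ 2)) = 0 := by
      linear_combination k - w * q * (2 * w * (1 - q) + (v - w) * (1 - q) * (1 + 12 * q) -
        8 * v * q * (1 + 7 * q)) * hw
    have k3 : v * w * q * (q ^ 2 * (q - 1) * v ^ 3 * (α * w + β * v)) = 0 := by
      rw [hα, hβ]
      linear_combination (1 - q) ^ 2 * ((q * (w * (1 - q) + 4 * q * v)) * k2 -
        w * q * (12 * q ^ 3 * w - 68 * q ^ 3 * v - 13 * q ^ 2 * w + 3 * q ^ 2 * v +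
          q * w + q * v) * h) -
        (288 * q ^ 6 * v ^ 2 - 24 * q ^ 5 * w * v - 512 * q ^ 5 * v ^ 2 + 64 * q ^ 4 * w * v +
        184 * q ^ 4 * v ^ 2 - 57 * q ^ 3 * w * v + 72 * q ^ 3 * v ^ 2 + 18 * q ^ 2 * w * v -
        32 * q ^ 2 * v ^ 2 - q * w * v) * h2
    rw [mul_comm]
    refine mul_eq_zero_of_mul_pow_eq_zero 4 ?_
    linear_combination -s * w ^ 3 * q * k3 -
      (α * w + β * v) * (v * w * q) ^ 4 * hs
  set γ := β ^ 2 * (1 - q) - α * β * (1 - q) * (1 + 12 * q) + 4 * α ^ 2 * q * (1 + 7 * q) with hγ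
  have h4 : γ * (v * w * q) = 0 := by
    refine mul_eq_zero_of_mul_pow_eq_zero 3 ?_
    linear_combination (w ^ 2 * q ^ 2) * (α ^ 2 * h2 -
      ((1 - q) * (α * w - β * v) + v * α * (1 - q) * (1 + 12 * q)) * h3)
  have h5 : (w • D) q = 0 := by
    have hD : (w • D) q = -2 * (v * w * q) := by
      rw [Derivation.smul_apply, hq, smul_eq_mul]; ring
    set a : Polynomial ℝ := 3456 * .X ^ 5 - 5184 * .X ^ 4 + 1248 * .X ^ 3 + 584 * .X ^ 2 -
      80 * .X - 24 with ha
    set b : Polynomial ℝ := -8064 * .X ^ 5 + 5120 * .X ^ 4 + 1568 * .X ^ 3 - 320 * .X ^ 2 -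
      96 * .X with hb
    refine deriv_eq_zero_of_aeval_mul_eq_zero (w • D) (p := b ^ 2 * (1 - .X) - a * b * (1 - .X) *
      (1 + 12 * .X) + 4 * a ^ 2 * .X * (1 + 7 * .X)) ?_ ?_
    · intro h0
      have := congrArg (Polynomial.eval 2) h0
      norm_num [ha, hb] at this
    · have hn : ∀ (n : ℕ) [n.AtLeastTwo], Polynomial.aeval q (ofNat(n) : Polynomial ℝ) = ofNat(n) :=
        fun n _ => map_ofNat _ n
      have hA : Polynomial.aeval q a = α := by simp [ha, hα, hn]
      have hB : Polynomial.aeval q b = β := by simp [hb, hβ, hn]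
      have hC : Polynomial.aeval q (b ^ 2 * (1 - .X) - a * b * (1 - .X) * (1 + 12 * .X) +
          4 * a ^ 2 * .X * (1 + 7 * .X)) = γ := by
        simp [hA, hB, hγ, hn]
      rw [hC, hD]
      linear_combination -2 * h4
  refine eq_zero_of_natCast_mul 2 two_ne_zero ?_
  rw [Derivation.smul_apply, hq, smul_eq_mul] at h5
  linear_combination -h5

lemma BiharmonicFrame.τ_add_σ (h : BiharmonicFrame M τ a t u σ ρ G x y e₁ e₂ e₃) {linv : A}
    (hl : (4 * M - 4 * τ ^ 2) * linv = 1) : τ + σ = 0 := by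
  have e3y := h.e₃_y hl
  obtain rfl := h.x_eq_zero hl
  have hlc := h.lam_const
  have e2σ := h.e₂_σ
  have e2y := h.e₂_y
  have hs := h.e₃_σ
  have e1y := h.e₁_y
  have hb := h.bitension₂
  rw [h.curvature_eq] at hb
  set lam := 4 * M - 4 * τ ^ 2
  clear_value lam
  have e1a := h.e₁_a
  have e2a := h.e₂_a
  have e2t := h.e₂_t
  have e1x := h.e₁_x
  have hat := h.sq_add_sq
  have htu := h.t_mul_u
  have hG := h.t_mul_G
  have hρ := h.t_mul_ρ
  have hτ := h.τ_const
  rw [hs] at e1y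
  simp only [mul_zero, zero_mul, add_zero, sub_zero, zero_sub, map_zero] at *
  set v := τ + σ with hv
  set w := τ - σ with hw
  -- `G = 0` where `v ≠ 0`
  have vG : v * G = 0 := by
    linear_combination u * v * hG - u * y * hρ - u * t * e1x - v * G * htu
  have vy : v * (a * y - t * w) = 0 := by linear_combination v * hG - t * vG
  set q := a ^ 2 with hq
  set D := (a * u) • e₂ with hD
  have Dq : D q = -2 * q * v := by
    rw [hD, Derivation.smul_apply, hq, Derivation.leibniz_pow, e2a]
    simp only [smul_eq_mul, nsmul_eq_mul]
    push_cast
    linear_combination -2 * a ^ 2 * v * htu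
  have Dσ : D σ = a * u * (2 * σ * y - lam * a * t) := by
    rw [hD, Derivation.smul_apply, e2σ, smul_eq_mul]
  have Dv : D v = -D w := by rw [hv, hw, map_add, map_sub, hτ]; ring
  have Dw : v * (D w + (v - w) * w - lam * q) = 0 := by
    have : D w = -(a * u * (2 * σ * y - lam * a * t)) := by rw [hw, map_sub, hτ, Dσ, zero_sub]
    rw [this]
    linear_combination -2 * σ * u * vy + v * (lam * a ^ 2 - 2 * σ * w) * htu
  have e2e2y : e₂ (e₂ y) = -2 * σ * (2 * σ * y - lam * a * t) + 2 * lam * t * a * v +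
      2 * y * (v * w + lam * t ^ 2 + y ^ 2) := by
    have k := congrArg e₂ e2y
    simp only [map_sub, map_add, Derivation.leibniz, Derivation.leibniz_pow, hlc, hτ,
      smul_eq_mul, nsmul_eq_mul, e2σ, e2t, mul_zero, add_zero, zero_sub] at k
    push_cast at k
    linear_combination k + 2 * y * e2y
  have alg : v * (lam * (q * (w * (1 - q) + 4 * q * v)) +
      w ^ 2 * (3 * v * q + w * (1 - q))) = 0 := by
    have hq1 : 1 - q = t ^ 2 := by linear_combination -hat
    have : t ^ 3 * (v * (lam * (q * (w * t ^ 2 + 4 * q * v)) +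
        w ^ 2 * (3 * v * q + w * t ^ 2))) = 0 := by
      rw [e1y, e2e2y, e2y] at hb
      simp only [e3y, map_zero] at hb
      rw [hq]
      clear_value v w
      subst hv hw
      linear_combination (τ + σ) * a ^ 3 * t ^ 2 * hb +
        (τ + σ) * a ^ 3 * (y * (t * ρ - a * (τ + σ)) + t * (τ ^ 2 - σ ^ 2 + lam * t ^ 2 + y ^ 2)) *
          hρ + a ^ 3 * t ^ 2 * G * y * vG -
        (t ^ 2 * (a ^ 2 * y ^ 2 + a * y * t * (τ - σ) + t ^ 2 * (τ - σ) ^ 2) +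
          a * (a * (τ + σ) * t) * (a * y + t * (τ - σ)) +
          a ^ 2 * (-a ^ 2 * (τ + σ) ^ 2 + t ^ 2 * (-4 * σ ^ 2 + (τ ^ 2 - σ ^ 2 + lam * t ^ 2)) +
            t ^ 2 * (τ ^ 2 + lam * a ^ 2 + 3 * σ ^ 2))) * vy
    rw [hq1]
    linear_combination u ^ 3 * this - (v * (lam * (q * (w * t ^ 2 + 4 * q * v)) +
        w ^ 2 * (3 * v * q + w * t ^ 2))) * (t ^ 2 * u ^ 2 + t * u + 1) * htu
  have hs : (1 - q) * u ^ 2 = 1 := by linear_combination (1 + t * u) * htu - u ^ 2 * hat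
  have k1 := mul_eq_zero_of_overdetermined D (hlc D) Dq Dw Dv hs alg
  -- where `a v ≠ 0`, `w = 0`, and `D w = lam a²`
  have k2 : v * a * w = 0 := by
    rw [mul_right_comm, ]
    refine mul_eq_zero_of_mul_pow_eq_zero 2 ?_
    linear_combination k1
  have k3 : v * a = 0 := by
    have k := mul_deriv_eq_zero D k2
    refine mul_eq_zero_of_mul_pow_eq_zero 3 ?_
    linear_combination linv * (k + (v - w) * k2 - a * Dw) - v * a ^ 3 * hl
  have k := mul_deriv_eq_zero e₂ k3
  rw [e2a] at k
  exact eq_zero_of_pow_eq_zero (n := 2) (by linear_combination -u * k - v ^ 2 * htu)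

/-- The conclusion on the open set where the tension field does not vanish. -/
structure IsFlatFrame (M τ a ρ G x y : A) : Prop where
  norm_sq : (x ^ 2 + y ^ 2) * (x ^ 2 + y ^ 2 + 4 * M) = 0
  angle : (x ^ 2 + y ^ 2) * ((4 * M - 4 * τ ^ 2) * a ^ 2 + 4 * τ ^ 2) = 0
  mul_ρ : (x ^ 2 + y ^ 2) * ρ = 0
  mul_G : (x ^ 2 + y ^ 2) * G = 0

lemma BiharmonicFrame.isFlatFrame_of_ne (h : BiharmonicFrame M τ a t u σ ρ G x y e₁ e₂ e₃)
    {linv : A} (hl : (4 * M - 4 * τ ^ 2) * linv = 1) : IsFlatFrame M τ a ρ G x y := by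
  have hv := h.τ_add_σ hl
  have e3y := h.e₃_y hl
  obtain rfl := h.x_eq_zero hl
  obtain rfl : σ = -τ := by linear_combination hv
  have hlc := h.lam_const
  have e2σ := h.e₂_σ
  have e2y := h.e₂_y
  have hs := h.e₃_σ
  have e1y := h.e₁_y
  have hb := h.bitension₂
  rw [h.curvature_eq] at hb
  set lam := 4 * M - 4 * τ ^ 2 with hlam
  clear_value lam
  have e2a := h.e₂_a
  have e2t := h.e₂_t
  have hat := h.sq_add_sq
  have htu := h.t_mul_u
  have hG := h.t_mul_G
  have hτ := h.τ_const
  have ρ0 : ρ = 0 := by linear_combination u * h.t_mul_ρ - ρ * htu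
  subst ρ0
  rw [hs] at e1y
  simp only [e3y, e1y, map_neg, hτ, mul_zero, zero_mul, add_zero, sub_zero, zero_sub, map_zero,
    neg_zero, zero_add, add_neg_cancel] at hb e2σ e2y e2a e2t hG
  have k1 : 2 * τ * y + lam * a * t = 0 := by linear_combination e2σ
  have e2y' : e₂ y = lam * t ^ 2 + y ^ 2 := by rw [e2y]; ring
  have k2 : τ * (lam * t ^ 2 + y ^ 2) = 0 := by
    have k := congrArg e₂ k1
    simp only [map_add, Derivation.leibniz, hτ, hlc, deriv_ofNat, e2a, e2t, e2y', smul_eq_mul,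
      mul_zero, add_zero, map_zero] at k
    refine eq_zero_of_natCast_mul 2 two_ne_zero ?_
    linear_combination k
  have k3 : lam * a ^ 2 * y ^ 2 + 4 * τ ^ 2 * y ^ 2 = 0 := by
    have : t ^ 2 * (lam * (lam * a ^ 2 * y ^ 2 + 4 * τ ^ 2 * y ^ 2)) = 0 := by
      linear_combination (lam * a * t - 2 * τ * y) * y ^ 2 * k1 + 4 * τ * y ^ 2 * k2
    linear_combination u ^ 2 * linv * this - (1 + t * u) * (linv * lam) *
      (lam * a ^ 2 * y ^ 2 + 4 * τ ^ 2 * y ^ 2) * htu -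
      (lam * a ^ 2 * y ^ 2 + 4 * τ ^ 2 * y ^ 2) * hl
  have k4 : y * G = 0 := by
    have : t ^ 2 * (lam * (y * G)) = 0 := by
      linear_combination lam * t * y * hG - y ^ 2 * k1 + 2 * y * k2
    linear_combination u ^ 2 * linv * this - (1 + t * u) * (linv * lam) * (y * G) * htu -
      y * G * hl
  have e2e2y : e₂ (e₂ y) = 2 * y * (lam * t ^ 2 + y ^ 2) := by
    have k := congrArg e₂ e2y'
    simp only [map_add, Derivation.leibniz, Derivation.leibniz_pow, hlc, smul_eq_mul,
      nsmul_eq_mul, e2t, mul_zero, add_zero] at k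
    push_cast at k
    linear_combination k + 2 * y * e2y'
  have k5 : y ^ 2 * (y ^ 2 + 4 * M) = 0 := by
    rw [e2e2y, e2y'] at hb
    linear_combination y * hb + G * y * k4 - y ^ 2 * lam * hat - y ^ 2 * hlam
  exact ⟨by linear_combination k5, by rw [← hlam]; linear_combination k3, by ring,
    by linear_combination y * k4⟩

end

/-! ### The case `l² = 4 m` -/

section

variable {A : Type*} [CommRing A] [Algebra ℝ A] [IsReduced A] {M τ a t u σ ρ G x y : A}
  {e₁ e₂ e₃ : Derivation ℝ A A}

/-- If `l² = 4 m`, the frame satisfies the equations of a space of constant curvature. -/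
lemma BiharmonicFrame.relations_of_eq (h : BiharmonicFrame M τ a t u σ ρ G x y e₁ e₂ e₃)
    (hM : M = τ ^ 2) : ∃ P₁ P₂ : A,
      x * σ = 0 ∧ y * σ = 0 ∧
      e₁ (x ^ 2 + y ^ 2) = 2 * x * (τ ^ 2 - σ ^ 2 + (x ^ 2 + y ^ 2)) ∧
      e₂ (x ^ 2 + y ^ 2) = 2 * y * (τ ^ 2 - σ ^ 2 + (x ^ 2 + y ^ 2)) ∧
      e₃ (x ^ 2 + y ^ 2) = 2 * (x * P₁ + y * P₂) ∧
      e₃ (x * P₁ + y * P₂) = P₁ ^ 2 + P₂ ^ 2 -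
        (3 * (τ ^ 2 - σ ^ 2) + (x ^ 2 + y ^ 2)) * (x ^ 2 + y ^ 2) ∧
      3 * P₁ ^ 2 = (7 * (τ ^ 2 - σ ^ 2) + (x ^ 2 + y ^ 2) + 12 * σ ^ 2) * x ^ 2 -
        (3 * (τ ^ 2 - σ ^ 2) + (x ^ 2 + y ^ 2)) * (τ ^ 2 - σ ^ 2) ∧
      3 * (P₁ * P₂) = (7 * (τ ^ 2 - σ ^ 2) + (x ^ 2 + y ^ 2) + 12 * σ ^ 2) * (x * y) ∧
      3 * P₂ ^ 2 = (7 * (τ ^ 2 - σ ^ 2) + (x ^ 2 + y ^ 2) + 12 * σ ^ 2) * y ^ 2 -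
        (3 * (τ ^ 2 - σ ^ 2) + (x ^ 2 + y ^ 2)) * (τ ^ 2 - σ ^ 2) := by
  subst hM
  have hl : 4 * τ ^ 2 - 4 * τ ^ 2 = 0 := by ring
  have hb1 := h.bitension₁
  have hb2 := h.bitension₂
  rw [h.curvature_eq, hl] at hb1 hb2
  have e1σ := h.e₁_σ
  have e2σ : e₂ σ = 2 * σ * y := by rw [h.e₂_σ]; ring
  have e3σ := h.e₃_σ
  have e1G := h.e₁_G
  have e2G := h.e₂_G
  have hτ := h.τ_const
  obtain ⟨b, hb⟩ : ∃ b, b = τ ^ 2 - σ ^ 2 := ⟨_, rfl⟩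
  have e1x : e₁ x = b + x ^ 2 + ρ * y := by rw [h.e₁_x, hb]
  have e1y : e₁ y = x * y - ρ * x := by rw [h.e₁_y, e3σ]; ring
  have e2x : e₂ x = x * y := by rw [h.e₂_x, e3σ]; ring
  have e2y : e₂ y = b + y ^ 2 := by rw [h.e₂_y, hb]; ring
  have e1b : e₁ b = -(4 * σ ^ 2 * x) := by
    rw [hb, map_sub, Derivation.leibniz_pow, Derivation.leibniz_pow, hτ, e1σ]
    simp only [smul_eq_mul, nsmul_eq_mul]; push_cast; ring
  have e2b : e₂ b = -(4 * σ ^ 2 * y) := by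
    rw [hb, map_sub, Derivation.leibniz_pow, Derivation.leibniz_pow, hτ, e2σ]
    simp only [smul_eq_mul, nsmul_eq_mul]; push_cast; ring
  have e3b : e₃ b = 0 := by
    rw [hb, map_sub, Derivation.leibniz_pow, Derivation.leibniz_pow, hτ, e3σ]
    simp only [smul_zero, sub_zero]
  have hK : τ ^ 2 + 0 * a ^ 2 + 3 * σ ^ 2 = b + 4 * σ ^ 2 := by rw [hb]; ring
  rw [hK] at hb1 hb2
  rw [← hb]
  have hxx : e₁ x - ρ * y = b + x ^ 2 := by rw [e1x]; ring
  have hxy : e₁ y + ρ * x = x * y := by rw [e1y]; ring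
  rw [hxx, hxy, e2x] at hb1
  rw [hxx, hxy, e2y] at hb2
  have k1 := h.comm₁₃ x
  have k2 := h.comm₂₃ x
  have k3 := h.comm₁₃ y
  have k4 := h.comm₂₃ y
  have k5 := h.comm₁₃ σ
  have k6 := h.comm₂₃ σ
  obtain ⟨P₁, hP₁⟩ : ∃ P, P = e₃ x - G * y := ⟨_, rfl⟩
  obtain ⟨P₂, hP₂⟩ : ∃ P, P = e₃ y + G * x := ⟨_, rfl⟩
  rw [← hP₁, ← hP₂] at hb1 hb2
  have e3x : e₃ x = P₁ + G * y := by rw [hP₁]; ring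
  have e3y : e₃ y = P₂ - G * x := by rw [hP₂]; ring
  -- the covariant derivatives of the field `P = (P₁, P₂)`
  simp only [e3x, e1x, e2x, map_add, Derivation.leibniz, Derivation.leibniz_pow, smul_eq_mul,
    nsmul_eq_mul, e3y, e1y, e2y, e3b, e1G, e2G] at k1 k2
  simp only [e3y, e1y, e2y, map_add, map_sub, Derivation.leibniz, Derivation.leibniz_pow,
    smul_eq_mul, nsmul_eq_mul, e3x, e1x, e2x, e3b, e1G, e2G] at k3 k4
  simp only [e1σ, e2σ, e3σ, map_zero, Derivation.leibniz, deriv_ofNat, smul_eq_mul, e3x, e3y,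
    mul_zero, add_zero] at k5 k6
  push_cast at k1 k2 k3 k4
  have P11 : e₁ P₁ = ρ * P₂ + 3 * x * P₁ := by linear_combination k1
  have P21 : e₂ P₁ = x * P₂ + 2 * y * P₁ := by linear_combination k2
  have P12 : e₁ P₂ = -ρ * P₁ + y * P₁ + 2 * x * P₂ := by linear_combination k3
  have P22 : e₂ P₂ = 3 * y * P₂ := by linear_combination k4
  have P31 : e₃ P₁ = G * P₂ - (3 * b + (x ^ 2 + y ^ 2)) * x := by
    simp only [map_add, Derivation.leibniz, Derivation.leibniz_pow, smul_eq_mul, nsmul_eq_mul,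
      e1b, e1x, e2x, e2y] at hb1
    push_cast at hb1
    linear_combination hb1
  have P32 : e₃ P₂ = -G * P₁ - (3 * b + (x ^ 2 + y ^ 2)) * y := by
    simp only [map_add, Derivation.leibniz, Derivation.leibniz_pow, smul_eq_mul, nsmul_eq_mul,
      e2b, e1x, e1y, e2y] at hb2
    push_cast at hb2
    linear_combination hb2
  have e1h : e₁ (x ^ 2 + y ^ 2) = 2 * x * (b + (x ^ 2 + y ^ 2)) := by
    simp only [map_add, Derivation.leibniz_pow, smul_eq_mul, nsmul_eq_mul, e1x, e1y]
    push_cast; ring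
  have e2h : e₂ (x ^ 2 + y ^ 2) = 2 * y * (b + (x ^ 2 + y ^ 2)) := by
    simp only [map_add, Derivation.leibniz_pow, smul_eq_mul, nsmul_eq_mul, e2x, e2y]
    push_cast; ring
  have e3h : e₃ (x ^ 2 + y ^ 2) = 2 * (x * P₁ + y * P₂) := by
    simp only [map_add, Derivation.leibniz_pow, smul_eq_mul, nsmul_eq_mul, e3x, e3y]
    push_cast; ring
  -- `σ` and the tension field have disjoint supports
  have σP₁ : σ * P₁ = 0 := eq_zero_of_natCast_mul 2 two_ne_zero (by linear_combination -k5)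
  have σP₂ : σ * P₂ = 0 := eq_zero_of_natCast_mul 2 two_ne_zero (by linear_combination -k6)
  have σx : σ * x * (3 * b + (x ^ 2 + y ^ 2)) = 0 := by
    have k := mul_deriv_eq_zero e₃ σP₁
    rw [P31] at k
    linear_combination G * σP₂ - k
  have σy : σ * y * (3 * b + (x ^ 2 + y ^ 2)) = 0 := by
    have k := mul_deriv_eq_zero e₃ σP₂
    rw [P32] at k
    linear_combination -G * σP₁ - k
  have key : ∀ (D : Derivation ℝ A A) (r : A), D σ = 2 * σ * r → D b = -(4 * σ ^ 2 * r) →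
      D (x ^ 2 + y ^ 2) = 2 * r * (b + (x ^ 2 + y ^ 2)) →
      σ * r * (3 * b + (x ^ 2 + y ^ 2)) = 0 → r * σ = 0 := by
    intro D r hσ hDb hh hr
    have c1 := mul_deriv_eq_zero D hr
    rw [map_add, Derivation.leibniz, deriv_ofNat, hh, hDb, smul_zero, add_zero, smul_eq_mul] at c1
    have c2 : (-12 * σ ^ 2 + 2 * b + 2 * (x ^ 2 + y ^ 2)) * (r * σ) = 0 :=
      mul_eq_zero_of_mul_pow_eq_zero 2 (by linear_combination σ * c1)
    have c3 : r * σ * (b + 3 * σ ^ 2) = 0 :=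
      eq_zero_of_natCast_mul 4 (by norm_num) (by linear_combination 2 * hr - c2)
    have c4 := mul_deriv_eq_zero D c3
    simp only [map_add, Derivation.leibniz, deriv_ofNat, hDb, Derivation.leibniz_pow, hσ,
      smul_eq_mul, nsmul_eq_mul, mul_zero, add_zero] at c4
    push_cast at c4
    have c5 : 8 * r ^ 2 * (r * σ) = 0 := by
      refine mul_eq_zero_of_mul_pow_eq_zero 3 ?_
      linear_combination r ^ 3 * c4
    have c6 : r * σ * (r ^ 2) = 0 :=
      eq_zero_of_natCast_mul 8 (by norm_num) (by linear_combination c5)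
    have c7 := mul_eq_zero_of_mul_pow_eq_zero 2 c6
    exact eq_zero_of_pow_eq_zero (n := 2) (by linear_combination σ * c7)
  -- the commutators of covariant derivatives, applied to `P`
  have k7 := h.comm₁₃ P₁
  have k8 := h.comm₁₃ P₂
  have k9 := h.comm₂₃ P₂
  simp only [P31, P11, P21, map_add, map_sub, Derivation.leibniz, Derivation.leibniz_pow,
    smul_eq_mul, nsmul_eq_mul, P32, P12, e1b, e1G, e1x, e1y, e3x, deriv_ofNat] at k7
  simp only [P32, P12, P22, map_add, map_sub, map_neg, Derivation.leibniz, Derivation.leibniz_pow,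
    smul_eq_mul, nsmul_eq_mul, P31, P11, e1b, e1G, e1x, e1y, e3x, e3y, deriv_ofNat] at k8
  simp only [P32, P22, P21, map_add, map_sub, map_neg, Derivation.leibniz, Derivation.leibniz_pow,
    smul_eq_mul, nsmul_eq_mul, P12, e2b, e2G, e2x, e2y, e3y, deriv_ofNat] at k9
  push_cast at k7 k8 k9
  refine ⟨P₁, P₂, key e₁ x e1σ e1b e1h σx, key e₂ y e2σ e2b e2h σy, e1h, e2h, e3h, ?_, ?_, ?_, ?_⟩
  · simp only [map_add, Derivation.leibniz, smul_eq_mul, e3x, e3y, P31, P32]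
    ring
  · linear_combination -k7
  · linear_combination -k8
  · linear_combination -k9

/-- A biharmonic Riemannian submersion from a BCV space with `l² = 4 m` is harmonic. -/
lemma BiharmonicFrame.norm_sq_eq_zero {τ₀ : ℝ}
    (h : BiharmonicFrame M (algebraMap ℝ A τ₀) a t u σ ρ G x y e₁ e₂ e₃)
    (hM : M = algebraMap ℝ A τ₀ ^ 2) : x ^ 2 + y ^ 2 = 0 := by
  obtain ⟨P₁, P₂, xσ, yσ, e1h, e2h, e3h, e3π, q11, q12, q22⟩ := h.relations_of_eq hM
  set H := x ^ 2 + y ^ 2 with hH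
  clear_value H
  by_cases hτ : τ₀ = 0
  · subst hτ
    simp only [map_zero] at *
    have key : ∀ g : A, g * σ = 0 → g * H = 0 := by
      intro g hg
      obtain ⟨p, hp⟩ : ∃ p, p = x * P₁ + y * P₂ := ⟨_, rfl⟩
      rw [← hp] at e3π e3h
      have c1 : g * (3 * p ^ 2 - H ^ 3) = 0 := by
        rw [hp]
        linear_combination g * (x ^ 2 * q11 + 2 * x * y * q12 + y ^ 2 * q22) +
          σ * (5 * (x ^ 2 + y ^ 2) ^ 2 + (H - 3 * σ ^ 2) * (x ^ 2 + y ^ 2)) * hg -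
          g * H * (x ^ 2 + y ^ 2 + H) * hH
      have c2 : g * (3 * e₃ p + 2 * H ^ 2) = 0 := by
        rw [e3π]
        linear_combination g * q11 + g * q22 - g * H * hH + σ * (5 * (x ^ 2 + y ^ 2) +
          2 * (H - 3 * σ ^ 2) + 9 * H) * hg
      have c3 := mul_deriv_eq_zero e₃ c1
      simp only [map_sub, Derivation.leibniz, Derivation.leibniz_pow, deriv_ofNat, e3h,
        smul_eq_mul, nsmul_eq_mul, mul_zero, add_zero] at c3
      push_cast at c3
      have c4 : g * (H ^ 2 * p) = 0 :=
        eq_zero_of_natCast_mul 10 (by norm_num) (by linear_combination 2 * p * c2 - c3)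
      exact mul_eq_zero_of_mul_pow_eq_zero 5 (by linear_combination 3 * p * c4 - H ^ 2 * c1)
    have hx := key x xσ
    have hy := key y yσ
    exact eq_zero_of_pow_eq_zero (n := 2) (by linear_combination x * hx + y * hy + H * hH)
  · set τ := algebraMap ℝ A τ₀ with hτ₀
    have hun : τ * algebraMap ℝ A τ₀⁻¹ = 1 := by
      rw [hτ₀, ← map_mul, mul_inv_cancel₀ hτ, map_one]
    have key : ∀ (D : Derivation ℝ A A) (r : A), r * σ = 0 →
        D H = 2 * r * (τ ^ 2 - σ ^ 2 + H) → r = 0 := by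
      intro D r hr hD
      have c1 : r * (τ ^ 2 * (9 * τ ^ 6 - 15 * τ ^ 4 * H - 9 * τ ^ 2 * H ^ 2 - H ^ 3)) = 0 := by
        obtain ⟨b, hb⟩ : ∃ b, b = τ ^ 2 - σ ^ 2 := ⟨_, rfl⟩
        rw [← hb] at q11 q12 q22
        -- the matrix `(3 Pᵢ Pⱼ)` has determinant zero
        have det : (3 * b + H) * b * ((3 * b + H) * b - (7 * b + H + 12 * σ ^ 2) * H) = 0 := by
          linear_combination -(3 * P₂ ^ 2) * q11 -
            ((7 * b + H + 12 * σ ^ 2) * x ^ 2 - (3 * b + H) * b) * q22 +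
            (3 * (P₁ * P₂) + (7 * b + H + 12 * σ ^ 2) * (x * y)) * q12 -
            (3 * b + H) * b * (7 * b + H + 12 * σ ^ 2) * hH
        have hrb : r * (b - τ ^ 2) = 0 := by rw [hb]; linear_combination -σ * hr
        linear_combination r * det + 12 * σ * (3 * b + H) * b * H * hr -
          (9 * (b ^ 3 + b ^ 2 * τ ^ 2 + b * τ ^ 4 + τ ^ 6) -
            15 * H * (b ^ 2 + b * τ ^ 2 + τ ^ 4) - 9 * H ^ 2 * (b + τ ^ 2) - H ^ 3) * hrb
      have c2 : r * (9 * τ ^ 6 - 15 * τ ^ 4 * H - 9 * τ ^ 2 * H ^ 2 - H ^ 3) = 0 := by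
        linear_combination algebraMap ℝ A τ₀⁻¹ ^ 2 * c1 -
          (τ * algebraMap ℝ A τ₀⁻¹ + 1) *
          (r * (9 * τ ^ 6 - 15 * τ ^ 4 * H - 9 * τ ^ 2 * H ^ 2 - H ^ 3)) * hun
      have c3 : D H = 0 := by
        refine deriv_eq_zero_of_aeval_mul_eq_zero D (p := .C (9 * τ₀ ^ 6) -
          .C (15 * τ₀ ^ 4) * .X - .C (9 * τ₀ ^ 2) * .X ^ 2 - .X ^ 3) ?_ ?_
        · intro h0
          have := congrArg (Polynomial.eval 0) h0
          simp at this
          exact hτ this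
        · rw [hD]
          simp only [map_sub, map_mul, map_pow, Polynomial.aeval_C, Polynomial.aeval_X,
            map_ofNat, ← hτ₀]
          linear_combination 2 * (τ ^ 2 - σ ^ 2 + H) * c2
      have c4 : r * (τ ^ 2 + H) = 0 := by
        refine eq_zero_of_natCast_mul 2 two_ne_zero ?_
        linear_combination c3 - hD + 2 * σ * hr
      refine eq_zero_of_natCast_mul 16 (by norm_num) ?_
      have c5 : r * τ ^ 6 * 16 = 0 := by
        linear_combination c2 + (H ^ 2 + 8 * τ ^ 2 * H + 7 * τ ^ 4) * c4
      have h6 : τ ^ 6 * algebraMap ℝ A τ₀⁻¹ ^ 6 = 1 := by rw [← mul_pow, hun, one_pow]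
      push_cast
      linear_combination algebraMap ℝ A τ₀⁻¹ ^ 6 * c5 - 16 * r * h6
    rw [hH, key e₁ x xσ e1h, key e₂ y yσ e2h]
    ring

/-- Where the tension field of a biharmonic Riemannian submersion from a BCV space does not vanish,
its norm is `√(-4 m)`, the fibres make a constant angle with the vertical axis and the frame of
`SubmersionFrame` is parallel along horizontal curves. -/
theorem BiharmonicFrame.isFlatFrame {m τ₀ : ℝ}
    (h : BiharmonicFrame (algebraMap ℝ A m) (algebraMap ℝ A τ₀) a t u σ ρ G x y e₁ e₂ e₃) :
    IsFlatFrame (algebraMap ℝ A m) (algebraMap ℝ A τ₀) a ρ G x y := by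
  by_cases hm : m = τ₀ ^ 2
  · have h0 := h.norm_sq_eq_zero (by rw [hm, map_pow])
    exact ⟨by rw [h0, zero_mul], by rw [h0, zero_mul], by rw [h0, zero_mul], by rw [h0, zero_mul]⟩
  · have hne : 4 * m - 4 * τ₀ ^ 2 ≠ 0 := fun h0 => hm (by linarith)
    refine h.isFlatFrame_of_ne (linv := algebraMap ℝ A (4 * m - 4 * τ₀ ^ 2)⁻¹) ?_
    have : (4 * algebraMap ℝ A m - 4 * algebraMap ℝ A τ₀ ^ 2) =
        algebraMap ℝ A (4 * m - 4 * τ₀ ^ 2) := by simp only [map_sub, map_mul, map_pow, map_ofNat]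
    rw [this, ← map_mul, mul_inv_cancel₀ hne, map_one]

end

/-! ### The algebra of smooth functions on an open set -/

section SmoothAlgebra

variable {n : ℕ}

/-- The algebra of smooth functions on an open subset `O` of `ℝⁿ`. -/
def smoothAlgebra (O : TopologicalSpace.Opens (EuclideanSpace ℝ (Fin n))) :
    Subalgebra ℝ (O → ℝ) where
  carrier := {f | ∃ F : EuclideanSpace ℝ (Fin n) → ℝ, ContDiffOn ℝ ∞ F O ∧ ∀ x : O, f x = F x}
  mul_mem' := by
    rintro f g ⟨F, hF, hf⟩ ⟨G, hG, hg⟩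
    exact ⟨fun x => F x * G x, hF.mul hG, fun x => by simp [hf, hg]⟩
  add_mem' := by
    rintro f g ⟨F, hF, hf⟩ ⟨G, hG, hg⟩
    exact ⟨fun x => F x + G x, hF.add hG, fun x => by simp [hf, hg]⟩
  algebraMap_mem' := fun r => ⟨fun _ => r, contDiffOn_const, fun _ => rfl⟩

variable {O : TopologicalSpace.Opens (EuclideanSpace ℝ (Fin n))}

namespace smoothAlgebra

instance : IsReduced (smoothAlgebra O) :=
  isReduced_of_injective (smoothAlgebra O).val Subtype.val_injective

/-- The value of an element of `smoothAlgebra O` at a point of `O`. -/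
def eval (x : O) : smoothAlgebra O →ₐ[ℝ] ℝ :=
  (Pi.evalAlgHom ℝ (fun _ : O => ℝ) x).comp (smoothAlgebra O).val

@[ext] lemma ext_eval {f g : smoothAlgebra O} (h : ∀ x, eval x f = eval x g) : f = g :=
  Subtype.ext (funext h)

/-- The smooth function on `O` given by a function on `ℝⁿ` which is smooth on `O`. -/
def mk (F : EuclideanSpace ℝ (Fin n) → ℝ) (hF : ContDiffOn ℝ ∞ F O) : smoothAlgebra O :=
  ⟨fun x => F x, F, hF, fun _ => rfl⟩

@[simp] lemma eval_mk (F : EuclideanSpace ℝ (Fin n) → ℝ) (hF : ContDiffOn ℝ ∞ F O) (x : O) :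
    eval x (mk F hF) = F x := rfl

/-- An extension to `ℝⁿ` of a smooth function on `O`. -/
def rep (f : smoothAlgebra O) : EuclideanSpace ℝ (Fin n) → ℝ := f.2.choose

lemma contDiffOn_rep (f : smoothAlgebra O) : ContDiffOn ℝ ∞ (rep f) O := f.2.choose_spec.1

@[simp] lemma rep_apply (f : smoothAlgebra O) (x : O) : rep f x = eval x f :=
  (f.2.choose_spec.2 x).symm

lemma contDiffOn_of_eval {f : smoothAlgebra O} {F : EuclideanSpace ℝ (Fin n) → ℝ}
    (h : ∀ x, eval x f = F x) : ContDiffOn ℝ ∞ F O :=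
  (contDiffOn_rep f).congr fun x hx => by rw [← h ⟨x, hx⟩, ← rep_apply]

lemma differentiableAt_rep (f : smoothAlgebra O) (x : O) : DifferentiableAt ℝ (rep f) x :=
  ((contDiffOn_rep f).contDiffAt (O.2.mem_nhds x.2)).differentiableAt (by simp)

lemma fderiv_congr {F G : EuclideanSpace ℝ (Fin n) → ℝ} (h : ∀ x : O, F x = G x) (x : O) :
    fderiv ℝ F x = fderiv ℝ G x := by
  refine Filter.EventuallyEq.fderiv_eq ?_
  filter_upwards [O.2.mem_nhds x.2] with y hy using h ⟨y, hy⟩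

lemma contDiffOn_pd {F : EuclideanSpace ℝ (Fin n) → ℝ} (hF : ContDiffOn ℝ ∞ F O) (i : Fin n) :
    ContDiffOn ℝ ∞ (pd i F) O := by
  have h := hF.fderiv_of_isOpen O.2 (m := ∞) le_rfl
  exact h.clm_apply contDiffOn_const

/-- The partial derivatives, as derivations. -/
def partialDeriv (i : Fin n) : Derivation ℝ (smoothAlgebra O) (smoothAlgebra O) :=
  Derivation.mk'
    { toFun := fun f => mk (pd i (rep f)) (contDiffOn_pd (contDiffOn_rep f) i)
      map_add' := fun f g => by
        ext x
        change pd i (rep (f + g)) x = pd i (rep f) x + pd i (rep g) x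
        rw [pd, fderiv_congr (G := rep f + rep g)
          (fun y => by simp), fderiv_add (differentiableAt_rep f x) (differentiableAt_rep g x)]
        rfl
      map_smul' := fun r f => by
        ext x
        change pd i (rep (r • f)) x = r • pd i (rep f) x
        rw [pd, fderiv_congr (G := r • rep f)
          (fun y => by simp), fderiv_const_smul (differentiableAt_rep f x)]
        rfl }
    (fun f g => by
      ext x
      change pd i (rep (f * g)) x = eval x f * pd i (rep g) x + eval x g * pd i (rep f) x
      rw [pd, fderiv_congr (G := rep f * rep g) (fun y => by simp),
        fderiv_mul (differentiableAt_rep f x) (differentiableAt_rep g x)]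
      simp [pd])

lemma eval_partialDeriv_of_eval {f : smoothAlgebra O} {F : EuclideanSpace ℝ (Fin n) → ℝ}
    (h : ∀ x, eval x f = F x) (i : Fin n) (x : O) : eval x (partialDeriv i f) = pd i F x := by
  change pd i (rep f) x = _
  rw [pd, fderiv_congr (fun y => (rep_apply f y).trans (h y))]
  rfl

lemma exists_inv_sqrt {f : smoothAlgebra O} (hf : ∀ x, 0 < eval x f) :
    ∃ s : smoothAlgebra O, s ^ 2 * f = 1 ∧ ∀ x, 0 < eval x s := by
  have hpos : ∀ x ∈ (O : Set (EuclideanSpace ℝ (Fin n))), 0 < rep f x := fun x hx => by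
    rw [rep_apply f ⟨x, hx⟩]; exact hf _
  refine ⟨mk (fun x => (Real.sqrt (rep f x))⁻¹) (((contDiffOn_rep f).sqrt fun x hx =>
    (hpos x hx).ne').inv fun x hx => (Real.sqrt_pos.2 (hpos x hx)).ne'), ?_, fun x => ?_⟩
  · ext x
    rw [map_mul, map_pow, eval_mk, inv_pow, Real.sq_sqrt (hpos x x.2).le, rep_apply, map_one,
      inv_mul_cancel₀ (hf x).ne']
  · exact inv_pos.2 (Real.sqrt_pos.2 (hpos x x.2))

lemma exists_inv {f : smoothAlgebra O} (hf : ∀ x, eval x f ≠ 0) :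
    ∃ s : smoothAlgebra O, f * s = 1 := by
  refine ⟨mk (fun x => (rep f x)⁻¹) ((contDiffOn_rep f).inv fun x hx => ?_), ?_⟩
  · rw [rep_apply f ⟨x, hx⟩]; exact hf _
  · ext x
    simp [hf x]

/-- The module of vector fields on `O`. -/
def vectorFields (O : TopologicalSpace.Opens (EuclideanSpace ℝ (Fin n))) :
    Submodule (smoothAlgebra O) (Derivation ℝ (smoothAlgebra O) (smoothAlgebra O)) :=
  Submodule.span (smoothAlgebra O) (Set.range partialDeriv)

/-- The vector field with the given components. -/
def field (v : Fin n → smoothAlgebra O) : Derivation ℝ (smoothAlgebra O) (smoothAlgebra O) :=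
  ∑ i, v i • partialDeriv i

lemma field_apply (v : Fin n → smoothAlgebra O) (f : smoothAlgebra O) :
    field v f = ∑ i, v i * partialDeriv i f := by
  have : ∀ s : Finset (Fin n), (∑ i ∈ s, v i • partialDeriv i) f =
      ∑ i ∈ s, v i * partialDeriv i f := by
    intro s
    induction s using Finset.cons_induction with
    | empty => simp
    | cons i s hi ih => rw [Finset.sum_cons, Derivation.add_apply, ih, Finset.sum_cons]; rfl
  exact this _

lemma exists_eq_field {D : Derivation ℝ (smoothAlgebra O) (smoothAlgebra O)}
    (hD : D ∈ vectorFields O) : ∃ v, D = field v := by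
  obtain ⟨v, hv⟩ := (Submodule.mem_span_range_iff_exists_fun _).1 hD
  exact ⟨v, hv.symm⟩

lemma eval_field_of_eval (v : Fin n → smoothAlgebra O) {f : smoothAlgebra O}
    {F : EuclideanSpace ℝ (Fin n) → ℝ} (h : ∀ x, eval x f = F x) (x : O) :
    eval x (field v f) = fderiv ℝ F x (WithLp.toLp 2 fun i => eval x (v i)) := by
  have : (WithLp.toLp 2 fun i => eval x (v i)) =
      ∑ i, eval x (v i) • EuclideanSpace.single i (1 : ℝ) := by
    ext j
    simp [Finset.sum_apply, Pi.single_apply]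
  rw [field_apply, map_sum, this, map_sum]
  refine Finset.sum_congr rfl fun i _ => ?_
  rw [map_mul, eval_partialDeriv_of_eval h, map_smul, smul_eq_mul]
  rfl

end smoothAlgebra

end SmoothAlgebra

/-! ### Maps into a surface in local coordinates -/

/-- A smooth map `f` from an open set `O ⊆ ℝ³` to an open set `T ⊆ ℝ²` with a Riemannian metric
`H` (only the non-degeneracy of `H` is required). -/
structure CoordinateMap (O : TopologicalSpace.Opens (EuclideanSpace ℝ (Fin 3)))
    (T : TopologicalSpace.Opens (EuclideanSpace ℝ (Fin 2)))
    (f : EuclideanSpace ℝ (Fin 3) → EuclideanSpace ℝ (Fin 2))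
    (H : EuclideanSpace ℝ (Fin 2) → Matrix (Fin 2) (Fin 2) ℝ) : Prop where
  smooth : ContDiffOn ℝ ∞ f O
  mapsTo : Set.MapsTo f O T
  metric_smooth : ∀ α β, ContDiffOn ℝ ∞ (fun y => H y α β) T
  metric_symm : ∀ y ∈ T, ∀ α β, H y α β = H y β α
  metric_det : ∀ y ∈ T, (H y).det ≠ 0

lemma christoffel_symm {n : ℕ} (g : EuclideanSpace ℝ (Fin n) → Matrix (Fin n) (Fin n) ℝ)
    (x : EuclideanSpace ℝ (Fin n))
    (hg : ∀ i j l, pd l (fun y => g y i j) x = pd l (fun y => g y j i) x) (k i j : Fin n) :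
    christoffel g k i j x = christoffel g k j i x := by
  unfold christoffel
  congr 1
  refine Finset.sum_congr rfl fun l _ => ?_
  rw [hg i j l]
  ring

/-- The Levi-Civita connection is metric. -/
lemma pd_metric {n : ℕ} (g : EuclideanSpace ℝ (Fin n) → Matrix (Fin n) (Fin n) ℝ)
    (x : EuclideanSpace ℝ (Fin n)) (hx : ∀ i j, g x i j = g x j i)
    (hg : ∀ i j l, pd l (fun y => g y i j) x = pd l (fun y => g y j i) x)
    (hdet : (g x).det ≠ 0) (i j l : Fin n) :
    pd l (fun y => g y i j) x =
      ∑ k, (g x k j * christoffel g k l i x + g x i k * christoffel g k l j x) := by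
  have lower : ∀ m i j, ∑ k, g x m k * christoffel g k i j x =
      (1 / 2) * (pd i (fun y => g y j m) x + pd j (fun y => g y i m) x -
        pd m (fun y => g y i j) x) := by
    intro m i j
    have hinv := Matrix.mul_nonsing_inv (g x) (isUnit_iff_ne_zero.2 hdet)
    set w : Fin n → ℝ := fun l =>
      pd i (fun y => g y j l) x + pd j (fun y => g y i l) x - pd l (fun y => g y i j) x with hw
    have h1 : ∀ k, christoffel g k i j x = (1 / 2) * ((g x)⁻¹.mulVec w) k := fun k => rfl
    have h2 : ∑ k, g x m k * ((g x)⁻¹.mulVec w) k = w m := by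
      have := congrFun (Matrix.mulVec_mulVec w (g x) (g x)⁻¹) m
      rw [hinv, Matrix.one_mulVec] at this
      exact this
    change _ = (1 / 2) * w m
    rw [← h2, Finset.mul_sum]
    refine Finset.sum_congr rfl fun k _ => ?_
    rw [h1]; ring
  rw [Finset.sum_add_distrib, lower i l j]
  have : ∑ k, g x k j * christoffel g k l i x = ∑ k, g x j k * christoffel g k l i x :=
    Finset.sum_congr rfl fun k _ => by rw [hx k j]
  rw [this, lower j l i, hg j i l]
  rw [hg l j i, hg j l i]
  ring

namespace CoordinateMap

open smoothAlgebra

variable {O : TopologicalSpace.Opens (EuclideanSpace ℝ (Fin 3))}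
  {T : TopologicalSpace.Opens (EuclideanSpace ℝ (Fin 2))}
  {f : EuclideanSpace ℝ (Fin 3) → EuclideanSpace ℝ (Fin 2)}
  {H : EuclideanSpace ℝ (Fin 2) → Matrix (Fin 2) (Fin 2) ℝ}

/-- The composition of a smooth function on the target with the map. -/
def comp (h : CoordinateMap O T f H) (q : EuclideanSpace ℝ (Fin 2) → ℝ)
    (hq : ContDiffOn ℝ ∞ q T) : smoothAlgebra O :=
  smoothAlgebra.mk (fun x => q (f x)) (hq.comp h.smooth h.mapsTo)

@[simp] lemma eval_comp (h : CoordinateMap O T f H) (q : EuclideanSpace ℝ (Fin 2) → ℝ)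
    (hq : ContDiffOn ℝ ∞ q T) (x : O) : eval x (h.comp q hq) = q (f x) := rfl

lemma contDiffOn_coord (h : CoordinateMap O T f H) (α : Fin 2) :
    ContDiffOn ℝ ∞ (fun x => f x α) O :=
  (contDiff_piLp_apply 2 (i := α)).comp_contDiffOn h.smooth

/-- The coordinates of the map. -/
def coord (h : CoordinateMap O T f H) (α : Fin 2) : smoothAlgebra O :=
  smoothAlgebra.mk (fun x => f x α) (h.contDiffOn_coord α)

@[simp] lemma eval_coord (h : CoordinateMap O T f H) (α : Fin 2) (x : O) :
    eval x (h.coord α) = f x α := rfl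

lemma differentiableAt (h : CoordinateMap O T f H) (x : O) : DifferentiableAt ℝ f x :=
  (h.smooth.contDiffAt (O.2.mem_nhds x.2)).differentiableAt (by simp)

lemma field_comp (h : CoordinateMap O T f H) {q : EuclideanSpace ℝ (Fin 2) → ℝ}
    (hq : ContDiffOn ℝ ∞ q T) {D : Derivation ℝ (smoothAlgebra O) (smoothAlgebra O)}
    (hD : D ∈ vectorFields O) :
    D (h.comp q hq) = ∑ δ, h.comp (pd δ q) (contDiffOn_pd hq δ) * D (h.coord δ) := by
  obtain ⟨v, rfl⟩ := exists_eq_field hD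
  ext x
  have hqx : DifferentiableAt ℝ q (f x) :=
    (hq.contDiffAt (T.2.mem_nhds (h.mapsTo x.2))).differentiableAt (by simp)
  rw [eval_field_of_eval v (F := fun x => q (f x)) (h.eval_comp q hq), map_sum]
  set w := (WithLp.toLp 2 fun i => eval x (v i) : EuclideanSpace ℝ (Fin 3)) with hw
  have h1 : fderiv ℝ (fun x => q (f x)) x w = fderiv ℝ q (f x) (fderiv ℝ f x w) := by
    have := fderiv_comp (x : EuclideanSpace ℝ (Fin 3)) hqx (h.differentiableAt x)
    exact congrArg (fun L => L w) this
  have h2 : ∀ δ, fderiv ℝ (fun x => f x δ) x w = fderiv ℝ f x w δ := fun δ => by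
    have := ((EuclideanSpace.proj (𝕜 := ℝ) δ).hasFDerivAt.comp (x : EuclideanSpace ℝ (Fin 3))
      (h.differentiableAt x).hasFDerivAt).fderiv
    exact congrArg (fun L => L w) this
  have h4 : fderiv ℝ f x w = ∑ δ, fderiv ℝ f x w δ • EuclideanSpace.single δ (1 : ℝ) := by
    ext j
    fin_cases j <;> simp
  rw [h1, h4, map_sum]
  refine Finset.sum_congr rfl fun δ _ => ?_
  rw [map_mul, eval_comp, eval_field_of_eval v (F := fun x => f x δ) (h.eval_coord δ), h2, map_smul,
    smul_eq_mul, mul_comm]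
  rfl

lemma contDiffOn_inv (h : CoordinateMap O T f H) (α β : Fin 2) :
    ContDiffOn ℝ ∞ (fun y => (H y)⁻¹ α β) T := by
  have h1 : ∀ y ∈ (T : Set (EuclideanSpace ℝ (Fin 2))), (H y)⁻¹ α β =
      (H y 0 0 * H y 1 1 - H y 0 1 * H y 1 0)⁻¹ *
        !![H y 1 1, -H y 0 1; -H y 1 0, H y 0 0] α β := by
    intro y hy
    rw [Matrix.inv_def, Matrix.det_fin_two, Matrix.adjugate_fin_two, Ring.inverse_eq_inv']
    rfl
  have hm := h.metric_smooth
  refine ContDiffOn.congr ?_ h1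
  refine ContDiffOn.mul (ContDiffOn.inv (((hm 0 0).mul (hm 1 1)).sub ((hm 0 1).mul (hm 1 0)))
    fun y hy => ?_) ?_
  · have := h.metric_det y hy
    rwa [Matrix.det_fin_two] at this
  · fin_cases α <;> fin_cases β
    · exact hm 1 1
    · exact (hm 0 1).neg
    · exact (hm 1 0).neg
    · exact hm 0 0

lemma contDiffOn_christoffel (h : CoordinateMap O T f H) (α β γ : Fin 2) :
    ContDiffOn ℝ ∞ (christoffel H α β γ) T := by
  unfold christoffel
  refine contDiffOn_const.mul (ContDiffOn.sum fun δ _ => ?_)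
  exact (h.contDiffOn_inv α δ).mul (((contDiffOn_pd (h.metric_smooth γ δ) β).add
    (contDiffOn_pd (h.metric_smooth β δ) γ)).sub (contDiffOn_pd (h.metric_smooth β γ) δ))

lemma pd_metric_symm (h : CoordinateMap O T f H) (x : O) (α β γ : Fin 2) :
    pd γ (fun y => H y α β) (f x) = pd γ (fun y => H y β α) (f x) := by
  unfold pd
  rw [Filter.EventuallyEq.fderiv_eq]
  filter_upwards [T.2.mem_nhds (h.mapsTo x.2)] with y hy using h.metric_symm y hy α β

/-- The geometry of the pull-back of the tangent bundle of the target. -/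
def geometry (h : CoordinateMap O T f H) :
    PullbackGeometry (smoothAlgebra O) (vectorFields O) where
  f := h.coord
  metric α β := h.comp (fun y => H y α β) (h.metric_smooth α β)
  Γ α β γ := h.comp (christoffel H α β γ) (h.contDiffOn_christoffel α β γ)
  dΓ δ α β γ := h.comp (pd δ (christoffel H α β γ))
    (contDiffOn_pd (h.contDiffOn_christoffel α β γ) δ)
  metric_symm α β := by
    ext x
    exact h.metric_symm _ (h.mapsTo x.2) α β
  Γ_symm α β γ := by
    ext x
    exact christoffel_symm H (f x) (fun α β γ => h.pd_metric_symm x α β γ) α β γ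
  deriv_metric := by
    intro D hD α β
    rw [h.field_comp _ hD]
    refine Finset.sum_congr rfl fun γ _ => ?_
    congr 1
    ext x
    rw [eval_comp, pd_metric H (f x) (h.metric_symm _ (h.mapsTo x.2))
      (fun α β γ => h.pd_metric_symm x α β γ) (h.metric_det _ (h.mapsTo x.2)), map_sum]
    refine Finset.sum_congr rfl fun δ _ => ?_
    simp only [map_add, map_mul, eval_comp]
  deriv_Γ := by
    intro D hD α β γ
    exact h.field_comp _ hD

end CoordinateMap

/-! ### The standard frame of a BCV space -/

namespace smoothAlgebra

/-- The coordinate functions of `ℝⁿ`. -/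
def coordinate {n : ℕ} (O : TopologicalSpace.Opens (EuclideanSpace ℝ (Fin n))) (i : Fin n) :
    smoothAlgebra O :=
  mk (fun p => p i) (contDiff_piLp_apply 2 (i := i)).contDiffOn

@[simp] lemma eval_coordinate {n : ℕ} {O : TopologicalSpace.Opens (EuclideanSpace ℝ (Fin n))}
    (i : Fin n) (x : O) : eval x (coordinate O i) = (x : EuclideanSpace ℝ (Fin n)) i := rfl

lemma partialDeriv_coordinate {n : ℕ} {O : TopologicalSpace.Opens (EuclideanSpace ℝ (Fin n))}
    (i j : Fin n) : partialDeriv i (coordinate O j) = if i = j then 1 else 0 := by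
  ext x
  rw [eval_partialDeriv_of_eval (F := fun p => p j) (eval_coordinate j)]
  have : fderiv ℝ (fun p : EuclideanSpace ℝ (Fin n) => p j) (x : EuclideanSpace ℝ (Fin n)) =
      EuclideanSpace.proj j := (EuclideanSpace.proj (𝕜 := ℝ) j).fderiv
  rw [pd, this]
  by_cases h : i = j
  · simp [h]
  · simp [h, Ne.symm h]

lemma partialDeriv_comm {n : ℕ} {O : TopologicalSpace.Opens (EuclideanSpace ℝ (Fin n))}
    (i j : Fin n) (f : smoothAlgebra O) :
    partialDeriv i (partialDeriv j f) = partialDeriv j (partialDeriv i f) := by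
  ext x
  have key : ∀ i j, eval x (partialDeriv i (partialDeriv j f)) =
      fderiv ℝ (fderiv ℝ (rep f)) x (EuclideanSpace.single i 1) (EuclideanSpace.single j 1) := by
    intro i j
    rw [eval_partialDeriv_of_eval (F := pd j (rep f))
      (fun y => eval_partialDeriv_of_eval (fun z => (rep_apply f z).symm) j y)]
    have hd : DifferentiableAt ℝ (fderiv ℝ (rep f)) x :=
      (((contDiffOn_rep f).fderiv_of_isOpen O.2 (m := ∞) le_rfl).contDiffAt
        (O.2.mem_nhds x.2)).differentiableAt (by simp)
    unfold pd
    rw [fderiv_clm_apply hd (differentiableAt_const _)]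
    simp
  rw [key, key]
  have h2 : ContDiffAt ℝ 2 (rep f) x :=
    (((contDiffOn_rep f).contDiffAt (O.2.mem_nhds x.2))).of_le (WithTop.coe_le_coe.2 le_top)
  exact (h2.isSymmSndFDerivAt (by simp)) _ _

end smoothAlgebra

open smoothAlgebra

section Frame

variable (m l : ℝ) (O : TopologicalSpace.Opens (EuclideanSpace ℝ (Fin 3)))

/-- The function `F = 1 + m (x² + y²)`. -/
def smoothF : smoothAlgebra O :=
  1 + algebraMap ℝ _ m * (coordinate O 0 ^ 2 + coordinate O 1 ^ 2)

/-- The first field `E₁ = F ∂_x - (l y / 2) ∂_z` of the standard orthonormal frame. -/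
def frame₁ : Derivation ℝ (smoothAlgebra O) (smoothAlgebra O) :=
  smoothF m O • partialDeriv 0 - (algebraMap ℝ _ (l / 2) * coordinate O 1) • partialDeriv 2

/-- The second field `E₂ = F ∂_y + (l x / 2) ∂_z` of the standard orthonormal frame. -/
def frame₂ : Derivation ℝ (smoothAlgebra O) (smoothAlgebra O) :=
  smoothF m O • partialDeriv 1 + (algebraMap ℝ _ (l / 2) * coordinate O 0) • partialDeriv 2

/-- The third field `E₃ = ∂_z` of the standard orthonormal frame. -/
def frame₃ : Derivation ℝ (smoothAlgebra O) (smoothAlgebra O) := partialDeriv 2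

variable {m l O}

lemma eval_smoothF (x : O) : eval x (smoothF m O) = bcvF m x := by
  simp only [smoothF, map_add, map_mul, map_one, map_pow, eval_coordinate, AlgHom.commutes]
  rfl

lemma partialDeriv_smoothF (i : Fin 3) : partialDeriv i (smoothF m O) = 2 * algebraMap ℝ _ m *
    (coordinate O 0 * partialDeriv i (coordinate O 0) +
      coordinate O 1 * partialDeriv i (coordinate O 1)) := by
  simp only [smoothF, map_add, Derivation.leibniz, Derivation.leibniz_pow,
    Derivation.map_algebraMap, Derivation.map_one_eq_zero, smul_eq_mul, nsmul_eq_mul]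
  push_cast
  ring

lemma frame₁_apply (f : smoothAlgebra O) : frame₁ m l O f = smoothF m O * partialDeriv 0 f -
    (algebraMap ℝ _ (l / 2) * coordinate O 1) * partialDeriv 2 f := rfl

lemma frame₂_apply (f : smoothAlgebra O) : frame₂ m l O f = smoothF m O * partialDeriv 1 f +
    (algebraMap ℝ _ (l / 2) * coordinate O 0) * partialDeriv 2 f := rfl

lemma frame₃_apply (f : smoothAlgebra O) : frame₃ O f = partialDeriv 2 f := rfl

lemma partialDeriv_mem (i : Fin 3) : partialDeriv i ∈ vectorFields O :=
  Submodule.subset_span ⟨i, rfl⟩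

lemma frame₁_mem : frame₁ m l O ∈ vectorFields O := by
  have : frame₁ m l O = smoothF m O • partialDeriv 0 +
      (-(algebraMap ℝ _ (l / 2) * coordinate O 1)) • partialDeriv 2 := by
    ext1 f
    rw [frame₁_apply, Derivation.add_apply, Derivation.smul_apply, Derivation.smul_apply,
      smul_eq_mul, smul_eq_mul]
    ring
  rw [this]
  exact Submodule.add_mem _ (Submodule.smul_mem _ _ (partialDeriv_mem 0))
    (Submodule.smul_mem _ _ (partialDeriv_mem 2))

lemma frame₂_mem : frame₂ m l O ∈ vectorFields O := by
  unfold frame₂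
  exact Submodule.add_mem _ (Submodule.smul_mem _ _ (partialDeriv_mem 1))
    (Submodule.smul_mem _ _ (partialDeriv_mem 2))

lemma frame₃_mem : frame₃ O ∈ vectorFields O := partialDeriv_mem 2

variable (m l O)

lemma bcvFrame : BCVFrame (algebraMap ℝ _ m) (2 * algebraMap ℝ _ (l / 2)) (coordinate O 0)
    (coordinate O 1) (frame₁ m l O) (frame₂ m l O) (frame₃ O) where
  M_const D := D.map_algebraMap m
  L_const D := by rw [Derivation.leibniz, D.map_algebraMap, deriv_ofNat, smul_zero, smul_zero,
    add_zero]
  E₁_X := by rw [frame₁_apply]; simp [partialDeriv_coordinate, smoothF]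
  E₁_Y := by rw [frame₁_apply]; simp [partialDeriv_coordinate]
  E₂_X := by rw [frame₂_apply]; simp [partialDeriv_coordinate]
  E₂_Y := by rw [frame₂_apply]; simp [partialDeriv_coordinate, smoothF]
  E₃_X := by rw [frame₃_apply]; simp [partialDeriv_coordinate]
  E₃_Y := by rw [frame₃_apply]; simp [partialDeriv_coordinate]
  bracket₁₂ := by
    ext1 f
    simp only [Derivation.commutator_apply, Derivation.add_apply, Derivation.smul_apply,
      smul_eq_mul, frame₁_apply, frame₂_apply, frame₃_apply, map_sub, map_add, Derivation.leibniz,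
      partialDeriv_smoothF, partialDeriv_coordinate, Derivation.map_algebraMap,
      partialDeriv_comm 1 0, partialDeriv_comm 2 0, partialDeriv_comm 2 1]
    simp [smoothF]
    ring
  bracket₁₃ := by
    ext1 f
    simp only [Derivation.commutator_apply,
      smul_eq_mul, frame₁_apply, frame₃_apply, map_sub, Derivation.leibniz,
      partialDeriv_smoothF, partialDeriv_coordinate, Derivation.map_algebraMap,
      partialDeriv_comm 2 0]
    simp
  bracket₂₃ := by
    ext1 f
    simp only [Derivation.commutator_apply,
      smul_eq_mul, frame₂_apply, frame₃_apply, map_add, Derivation.leibniz,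
      partialDeriv_smoothF, partialDeriv_coordinate, Derivation.map_algebraMap,
      partialDeriv_comm 2 1]
    simp

end Frame

/-! ### Tension and bitension in coordinates and in the standard frame -/

/-- The matrix of the metric of a BCV space, where `W = 1 / F` and `τ = l / 2`. -/
def metricMatrix {A : Type*} [CommRing A] (τ W X Y : A) : Matrix (Fin 3) (Fin 3) A :=
  !![W ^ 2 + (τ * Y * W) ^ 2, -(τ ^ 2 * X * Y * W ^ 2), τ * Y * W;
    -(τ ^ 2 * X * Y * W ^ 2), W ^ 2 + (τ * X * W) ^ 2, -(τ * X * W);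
    τ * Y * W, -(τ * X * W), 1]

/-- The inverse of `metricMatrix`. -/
def invMetricMatrix {A : Type*} [CommRing A] (τ F X Y : A) : Matrix (Fin 3) (Fin 3) A :=
  !![F ^ 2, 0, -(τ * Y * F); 0, F ^ 2, τ * X * F;
    -(τ * Y * F), τ * X * F, 1 + τ ^ 2 * (X ^ 2 + Y ^ 2)]

lemma metricMatrix_mul {A : Type*} [CommRing A] {τ F W X Y : A} (h : F * W = 1) :
    metricMatrix τ W X Y * invMetricMatrix τ F X Y = 1 := by
  ext1 i j
  fin_cases i <;> fin_cases j <;>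
  simp [metricMatrix, invMetricMatrix, Matrix.mul_apply, Fin.sum_univ_three] <;> grind

lemma sum_invMetricMatrix_mul {A : Type*} [CommRing A] [Algebra ℝ A] {τ M F W X Y : A}
    (D : Fin 3 → Derivation ℝ A A) (hτ : ∀ i, D i τ = 0)
    (hX : D 0 X = 1 ∧ D 1 X = 0 ∧ D 2 X = 0) (hY : D 0 Y = 0 ∧ D 1 Y = 1 ∧ D 2 Y = 0)
    (hF : F = 1 + M * (X ^ 2 + Y ^ 2)) (h : F * W = 1)
    (hW : D 0 W = -(2 * M * X * W ^ 2) ∧ D 1 W = -(2 * M * Y * W ^ 2) ∧ D 2 W = 0)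
    (k : Fin 3) :
    ∑ i, ∑ j, invMetricMatrix τ F X Y i j *
      (D i (metricMatrix τ W X Y j k) + D j (metricMatrix τ W X Y i k) -
        D k (metricMatrix τ W X Y i j)) = 0 := by
  fin_cases k <;>
  simp [metricMatrix, invMetricMatrix, Fin.sum_univ_three, Derivation.leibniz,
    Derivation.leibniz_pow, hτ, hX, hY, hW] <;>
  clear hX hY hW hτ <;> grind

section Metric

variable {m l : ℝ} {O : TopologicalSpace.Opens (EuclideanSpace ℝ (Fin 3))}

lemma eval_algebraMap (r : ℝ) (x : O) : eval x (algebraMap ℝ (smoothAlgebra O) r) = r :=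
  AlgHom.commutes _ r

lemma exists_inv_smoothF (hO : (O : Set (EuclideanSpace ℝ (Fin 3))) ⊆ bcvDomain m) :
    ∃ W : smoothAlgebra O, smoothF m O * W = 1 :=
  exists_inv fun x => by rw [eval_smoothF]; exact (hO x.2).ne'

lemma bcvMetric_eq (p : EuclideanSpace ℝ (Fin 3)) :
    bcvMetric m l p = metricMatrix (l / 2) (bcvF m p)⁻¹ (p 0) (p 1) := by
  ext i j
  fin_cases i <;> fin_cases j <;>
  simp [metricMatrix, bcvMetric, bcvForm, Matrix.vecMulVec] <;> ring

lemma bcvMetric_inv {p : EuclideanSpace ℝ (Fin 3)} (hp : p ∈ bcvDomain m) :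
    (bcvMetric m l p)⁻¹ = invMetricMatrix (l / 2) (bcvF m p) (p 0) (p 1) := by
  rw [bcvMetric_eq]
  exact Matrix.inv_eq_right_inv (metricMatrix_mul (mul_inv_cancel₀ (ne_of_gt hp)))

lemma map_metricMatrix {A B : Type*} [CommRing A] [CommRing B] (φ : A →+* B) (τ W X Y : A)
    (i j : Fin 3) : φ (metricMatrix τ W X Y i j) = metricMatrix (φ τ) (φ W) (φ X) (φ Y) i j := by
  fin_cases i <;> fin_cases j <;> simp [metricMatrix]

lemma map_invMetricMatrix {A B : Type*} [CommRing A] [CommRing B] (φ : A →+* B) (τ F X Y : A)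
    (i j : Fin 3) :
    φ (invMetricMatrix τ F X Y i j) = invMetricMatrix (φ τ) (φ F) (φ X) (φ Y) i j := by
  fin_cases i <;> fin_cases j <;> simp [invMetricMatrix]

lemma eval_metricMatrix {W : smoothAlgebra O} (hW : smoothF m O * W = 1) (x : O) (i j : Fin 3) :
    eval x (metricMatrix (algebraMap ℝ _ (l / 2)) W (coordinate O 0) (coordinate O 1) i j) =
      bcvMetric m l x i j := by
  have h1 : bcvF m x * eval x W = 1 := by rw [← eval_smoothF, ← map_mul, hW, map_one]
  have h2 : eval x W = (bcvF m x)⁻¹ := eq_inv_of_mul_eq_one_right h1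
  have := map_metricMatrix (eval x : smoothAlgebra O →+* ℝ) (algebraMap ℝ _ (l / 2)) W
    (coordinate O 0) (coordinate O 1) i j
  simp only [RingHom.coe_coe, h2, eval_algebraMap, eval_coordinate] at this
  rw [this, bcvMetric_eq]

lemma eval_invMetricMatrix (hO : (O : Set (EuclideanSpace ℝ (Fin 3))) ⊆ bcvDomain m) (x : O)
    (i j : Fin 3) :
    eval x (invMetricMatrix (algebraMap ℝ _ (l / 2)) (smoothF m O) (coordinate O 0)
      (coordinate O 1) i j) = (bcvMetric m l x)⁻¹ i j := by
  have := map_invMetricMatrix (eval x : smoothAlgebra O →+* ℝ) (algebraMap ℝ _ (l / 2))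
    (smoothF m O) (coordinate O 0) (coordinate O 1) i j
  simp only [RingHom.coe_coe, eval_algebraMap, eval_coordinate, eval_smoothF] at this
  rw [this, bcvMetric_inv (hO x.2)]

/-- The Laplacian has no first order term in the coordinates of a BCV space: `∑ gⁱʲ Γᵏᵢⱼ = 0`. -/
lemma sum_inv_mul_christoffel (hO : (O : Set (EuclideanSpace ℝ (Fin 3))) ⊆ bcvDomain m) (x : O)
    (k : Fin 3) :
    ∑ i, ∑ j, (bcvMetric m l x)⁻¹ i j * christoffel (bcvMetric m l) k i j x = 0 := by
  obtain ⟨W, hW⟩ := exists_inv_smoothF hO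
  have hD : ∀ i, partialDeriv i W = -W ^ 2 * partialDeriv i (smoothF m O) := by
    intro i
    have := congrArg (partialDeriv i) hW
    rw [Derivation.leibniz, Derivation.map_one_eq_zero, smul_eq_mul, smul_eq_mul] at this
    linear_combination W * this - partialDeriv i W * hW
  have hpd : ∀ i j k, pd k (fun y => bcvMetric m l y i j) x = eval x (partialDeriv k
      (metricMatrix (algebraMap ℝ _ (l / 2)) W (coordinate O 0) (coordinate O 1) i j)) :=
    fun i j k => (eval_partialDeriv_of_eval (fun y => eval_metricMatrix hW y i j) k x).symm
  have key := fun k => sum_invMetricMatrix_mul (A := smoothAlgebra O)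
    (τ := algebraMap ℝ _ (l / 2)) (F := smoothF m O) (M := algebraMap ℝ _ m) partialDeriv
    (fun i => Derivation.map_algebraMap _ _) (X := coordinate O 0) (Y := coordinate O 1)
    (by simp [partialDeriv_coordinate]) (by simp [partialDeriv_coordinate]) rfl hW
    (by
      rw [hD, hD, hD, partialDeriv_smoothF, partialDeriv_smoothF, partialDeriv_smoothF]
      simp only [partialDeriv_coordinate]
      refine ⟨?_, ?_, ?_⟩ <;> simp <;> ring) k
  have key2 : ∀ k, ∑ i, ∑ j, (bcvMetric m l x)⁻¹ i j *
      (pd i (fun y => bcvMetric m l y j k) x + pd j (fun y => bcvMetric m l y i k) x -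
        pd k (fun y => bcvMetric m l y i j) x) = 0 := by
    intro k
    have := congrArg (eval x) (key k)
    simp only [map_sum, map_mul, map_add, map_sub, map_zero, eval_invMetricMatrix hO, ← hpd] at this
    exact this
  have h1 : ∑ i, ∑ j, (bcvMetric m l x)⁻¹ i j * christoffel (bcvMetric m l) k i j x =
      (1 / 2) * ∑ k', (bcvMetric m l x)⁻¹ k k' * ∑ i, ∑ j, (bcvMetric m l x)⁻¹ i j *
      (pd i (fun y => bcvMetric m l y j k') x + pd j (fun y => bcvMetric m l y i k') x -
        pd k' (fun y => bcvMetric m l y i j) x) := by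
    simp only [christoffel, Fin.sum_univ_three]
    ring
  rw [h1]
  simp only [key2, mul_zero, Finset.sum_const_zero]

end Metric

namespace CoordinateMap

variable {m l : ℝ} {O : TopologicalSpace.Opens (EuclideanSpace ℝ (Fin 3))}
  {T : TopologicalSpace.Opens (EuclideanSpace ℝ (Fin 2))}
  {f : EuclideanSpace ℝ (Fin 3) → EuclideanSpace ℝ (Fin 2)}
  {H : EuclideanSpace ℝ (Fin 2) → Matrix (Fin 2) (Fin 2) ℝ}

lemma eval_cov_partialDeriv (h : CoordinateMap O T f H) (i : Fin 3) {W : Fin 2 → smoothAlgebra O}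
    {V : EuclideanSpace ℝ (Fin 3) → Fin 2 → ℝ} (hV : ∀ x α, eval x (W α) = V x α) (x : O)
    (α : Fin 2) :
    eval x (h.geometry.cov (partialDeriv i) W α) = pullbackDeriv H f i V x α := by
  have h1 : ∀ β, eval x (partialDeriv i (h.coord β)) = pd i (fun y => f y β) x := fun β =>
    eval_partialDeriv_of_eval (h.eval_coord β) i x
  simp only [PullbackGeometry.cov, map_add, map_sum, map_mul, pullbackDeriv]
  rw [eval_partialDeriv_of_eval (F := fun y => V y α) (fun y => hV y α) i x]
  congr 1
  refine Finset.sum_congr rfl fun β _ => Finset.sum_congr rfl fun γ _ => ?_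
  rw [hV]
  congr 2
  exact h1 β

lemma eval_push_partialDeriv (h : CoordinateMap O T f H) (i : Fin 3) (x : O) (α : Fin 2) :
    eval x (h.geometry.push (partialDeriv i) α) = pd i (fun y => f y α) x :=
  eval_partialDeriv_of_eval (h.eval_coord α) i x

end CoordinateMap

section Frame

variable {m l : ℝ} {O : TopologicalSpace.Opens (EuclideanSpace ℝ (Fin 3))}

variable (m l O) in
/-- The field `∑ ∇_{Eᵢ} Eᵢ`. -/
def frameZ : Derivation ℝ (smoothAlgebra O) (smoothAlgebra O) :=
  (2 * algebraMap ℝ _ m * coordinate O 0) • frame₁ m l O +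
    (2 * algebraMap ℝ _ m * coordinate O 1) • frame₂ m l O

variable (P : PullbackGeometry (smoothAlgebra O) (vectorFields O))

lemma sum_cov_frame (W : Fin 3 → Fin 2 → smoothAlgebra O) (α : Fin 2) :
    (P.cov (frame₁ m l O) (smoothF m O • W 0 - (algebraMap ℝ _ (l / 2) * coordinate O 1) • W 2) +
      P.cov (frame₂ m l O) (smoothF m O • W 1 + (algebraMap ℝ _ (l / 2) * coordinate O 0) • W 2) +
      P.cov (frame₃ O) (W 2) - ((2 * algebraMap ℝ _ m * coordinate O 0) •
        (smoothF m O • W 0 - (algebraMap ℝ _ (l / 2) * coordinate O 1) • W 2) +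
      (2 * algebraMap ℝ _ m * coordinate O 1) •
        (smoothF m O • W 1 + (algebraMap ℝ _ (l / 2) * coordinate O 0) • W 2))) α =
    ∑ i, ∑ j, invMetricMatrix (algebraMap ℝ _ (l / 2)) (smoothF m O) (coordinate O 0)
      (coordinate O 1) i j * P.cov (partialDeriv i) (W j) α := by
  have hF := fun i => partialDeriv_smoothF (m := m) (O := O) i
  simp only [partialDeriv_coordinate] at hF
  simp only [frame₁, frame₂, frame₃, P.cov_sub_left, P.cov_add_left, P.cov_smul_left, P.cov_sub,
    P.cov_add, P.cov_smul, Pi.add_apply, Pi.sub_apply, Pi.smul_apply, smul_eq_mul, hF,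
    Derivation.leibniz, Derivation.map_algebraMap, partialDeriv_coordinate]
  simp [Fin.sum_univ_three, invMetricMatrix]
  ring

lemma frameTension_eq_sum (α : Fin 2) :
    P.frameTension (frame₁ m l O) (frame₂ m l O) (frame₃ O) (frameZ m l O) α =
    ∑ i, ∑ j, invMetricMatrix (algebraMap ℝ _ (l / 2)) (smoothF m O) (coordinate O 0)
      (coordinate O 1) i j * P.cov (partialDeriv i) (P.push (partialDeriv j)) α := by
  rw [← sum_cov_frame (m := m) P (fun j => P.push (partialDeriv j))]
  simp only [PullbackGeometry.frameTension, frameZ, P.push_add, P.push_smul]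
  have h1 : P.push (frame₁ m l O) = smoothF m O • P.push (partialDeriv 0) -
    (algebraMap ℝ _ (l / 2) * coordinate O 1) • P.push (partialDeriv 2) := by
    rw [frame₁, P.push_sub, P.push_smul, P.push_smul]
  have h2 : P.push (frame₂ m l O) = smoothF m O • P.push (partialDeriv 1) +
    (algebraMap ℝ _ (l / 2) * coordinate O 0) • P.push (partialDeriv 2) := by
    rw [frame₂, P.push_add, P.push_smul, P.push_smul]
  rw [h1, h2]
  rfl

lemma frameLaplacian_eq_sum (W : Fin 2 → smoothAlgebra O) (α : Fin 2) :
    P.frameLaplacian (frame₁ m l O) (frame₂ m l O) (frame₃ O) (frameZ m l O) W α =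
    ∑ i, ∑ j, invMetricMatrix (algebraMap ℝ _ (l / 2)) (smoothF m O) (coordinate O 0)
      (coordinate O 1) i j * P.cov (partialDeriv i) (P.cov (partialDeriv j) W) α := by
  rw [← sum_cov_frame (m := m) P (fun j => P.cov (partialDeriv j) W)]
  simp only [PullbackGeometry.frameLaplacian, frameZ, P.cov_add_left, P.cov_smul_left]
  have h1 : P.cov (frame₁ m l O) W = smoothF m O • P.cov (partialDeriv 0) W -
    (algebraMap ℝ _ (l / 2) * coordinate O 1) • P.cov (partialDeriv 2) W := by
    rw [frame₁, P.cov_sub_left, P.cov_smul_left, P.cov_smul_left]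
  have h2 : P.cov (frame₂ m l O) W = smoothF m O • P.cov (partialDeriv 1) W +
    (algebraMap ℝ _ (l / 2) * coordinate O 0) • P.cov (partialDeriv 2) W := by
    rw [frame₂, P.cov_add_left, P.cov_smul_left, P.cov_smul_left]
  rw [h1, h2]
  rfl

lemma sum_curvOp_frame (V : Fin 2 → smoothAlgebra O) (α : Fin 2) :
    (P.curvOp (P.push (frame₁ m l O)) V (P.push (frame₁ m l O)) +
      P.curvOp (P.push (frame₂ m l O)) V (P.push (frame₂ m l O)) +
      P.curvOp (P.push (frame₃ O)) V (P.push (frame₃ O))) α =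
    ∑ i, ∑ j, invMetricMatrix (algebraMap ℝ _ (l / 2)) (smoothF m O) (coordinate O 0)
      (coordinate O 1) i j * P.curvOp (P.push (partialDeriv i)) V (P.push (partialDeriv j)) α := by
  have h1 : P.push (frame₁ m l O) = smoothF m O • P.push (partialDeriv 0) +
    (-(algebraMap ℝ _ (l / 2) * coordinate O 1)) • P.push (partialDeriv 2) := by
    ext1 α
    rw [frame₁, P.push_sub, P.push_smul, P.push_smul]
    simp only [Pi.add_apply, Pi.sub_apply, Pi.smul_apply, smul_eq_mul]
    ring
  have h2 : P.push (frame₂ m l O) = smoothF m O • P.push (partialDeriv 1) +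
    (algebraMap ℝ _ (l / 2) * coordinate O 0) • P.push (partialDeriv 2) := by
    rw [frame₂, P.push_add, P.push_smul, P.push_smul]
  rw [h1, h2, frame₃]
  simp only [P.curvOp_add_left, P.curvOp_add_right, P.curvOp_smul_left, P.curvOp_smul_right,
    Pi.add_apply, Pi.smul_apply, smul_eq_mul]
  simp [Fin.sum_univ_three, invMetricMatrix]
  ring

end Frame

namespace CoordinateMap

variable {m l : ℝ} {O : TopologicalSpace.Opens (EuclideanSpace ℝ (Fin 3))}
  {T : TopologicalSpace.Opens (EuclideanSpace ℝ (Fin 2))}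
  {f : EuclideanSpace ℝ (Fin 3) → EuclideanSpace ℝ (Fin 2)}
  {H : EuclideanSpace ℝ (Fin 2) → Matrix (Fin 2) (Fin 2) ℝ}

lemma sum_sub_christoffel (hO : (O : Set (EuclideanSpace ℝ (Fin 3))) ⊆ bcvDomain m) (x : O)
    (N : Fin 3 → Fin 3 → ℝ) (d : Fin 3 → ℝ) :
    ∑ i, ∑ j, (bcvMetric m l x)⁻¹ i j *
      (N i j - ∑ k, christoffel (bcvMetric m l) k i j x * d k) =
    ∑ i, ∑ j, (bcvMetric m l x)⁻¹ i j * N i j := by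
  have h := fun k => sum_inv_mul_christoffel (l := l) hO x k
  simp only [Fin.sum_univ_three] at h ⊢
  linear_combination -d 0 * h 0 - d 1 * h 1 - d 2 * h 2

/-- The tension field of a map on a BCV space is computed in the standard frame. -/
lemma eval_frameTension (h : CoordinateMap O T f H)
    (hO : (O : Set (EuclideanSpace ℝ (Fin 3))) ⊆ bcvDomain m) (x : O) (α : Fin 2) :
    eval x (h.geometry.frameTension (frame₁ m l O) (frame₂ m l O) (frame₃ O) (frameZ m l O) α) =
      BCV.tension (bcvMetric m l) H f x α := by
  rw [frameTension_eq_sum, BCV.tension, sum_sub_christoffel hO x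
    (fun i j => pullbackDeriv H f i (fun z β => pd j (fun y => f y β) z) x α)
    (fun k => pd k (fun y => f y α) x)]
  simp only [map_sum, map_mul, eval_invMetricMatrix hO]
  refine Finset.sum_congr rfl fun i _ => Finset.sum_congr rfl fun j _ => ?_
  congr 1
  exact h.eval_cov_partialDeriv i (fun y β => h.eval_push_partialDeriv j y β) x α

lemma eval_frameBitension (h : CoordinateMap O T f H)
    (hO : (O : Set (EuclideanSpace ℝ (Fin 3))) ⊆ bcvDomain m) (x : O) (α : Fin 2) :
    eval x (h.geometry.frameBitension (frame₁ m l O) (frame₂ m l O) (frame₃ O) (frameZ m l O) α) =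
      BCV.bitension (bcvMetric m l) H f x α := by
  have hT := fun y β => h.eval_frameTension (l := l) hO y β
  rw [PullbackGeometry.frameBitension, Pi.sub_apply, sum_curvOp_frame, frameLaplacian_eq_sum,
    BCV.bitension, roughLaplacian, sum_sub_christoffel hO x
    (fun i j => pullbackDeriv H f i (pullbackDeriv H f j (BCV.tension (bcvMetric m l) H f)) x α)
    (fun k => pullbackDeriv H f k (BCV.tension (bcvMetric m l) H f) x α)]
  simp only [map_sum, map_mul, map_sub, eval_invMetricMatrix hO]
  congr 1
  · refine Finset.sum_congr rfl fun i _ => Finset.sum_congr rfl fun j _ => ?_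
    congr 1
    exact h.eval_cov_partialDeriv i (fun y β => h.eval_cov_partialDeriv j hT y β) x α
  · refine Finset.sum_congr rfl fun i _ => Finset.sum_congr rfl fun j _ => ?_
    congr 1
    simp only [PullbackGeometry.curvOp, map_sum, map_mul, hT, h.eval_push_partialDeriv]
    refine Finset.sum_congr rfl fun β _ => Finset.sum_congr rfl fun γ _ =>
      Finset.sum_congr rfl fun δ _ => ?_
    congr 3

end CoordinateMap

/-! ### Adapted frames of Riemannian submersions -/

/-- A Riemannian submersion from an open subset `O` of a BCV space to an open subset `T` of the
plane with a Riemannian metric `H`. -/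
structure LocalSubmersion (m l : ℝ) (O : TopologicalSpace.Opens (EuclideanSpace ℝ (Fin 3)))
    (T : TopologicalSpace.Opens (EuclideanSpace ℝ (Fin 2)))
    (f : EuclideanSpace ℝ (Fin 3) → EuclideanSpace ℝ (Fin 2))
    (H : EuclideanSpace ℝ (Fin 2) → Matrix (Fin 2) (Fin 2) ℝ) : Prop
    extends CoordinateMap O T f H where
  subset : (O : Set (EuclideanSpace ℝ (Fin 3))) ⊆ bcvDomain m
  surjective : ∀ p ∈ O, Function.Surjective (fderiv ℝ f p)
  isometry : ∀ p ∈ O, ∀ v w : EuclideanSpace ℝ (Fin 3),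
    (∀ u, fderiv ℝ f p u = 0 → ∑ i, ∑ j, bcvMetric m l p i j * v i * u j = 0) →
    (∀ u, fderiv ℝ f p u = 0 → ∑ i, ∑ j, bcvMetric m l p i j * w i * u j = 0) →
    ∑ α, ∑ β, H (f p) α β * fderiv ℝ f p v α * fderiv ℝ f p w β =
      ∑ i, ∑ j, bcvMetric m l p i j * v i * w j

/-- The components of a tangent vector in the standard frame. -/
def frameCoeff (m l : ℝ) (p v : EuclideanSpace ℝ (Fin 3)) : Fin 3 → ℝ :=
  ![v 0 / bcvF m p, v 1 / bcvF m p, v 2 + l / 2 * (p 1 * v 0 - p 0 * v 1) / bcvF m p]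

/-- The tangent vector with the given components in the standard frame. -/
def frameVec (m l : ℝ) (p : EuclideanSpace ℝ (Fin 3)) (ε : Fin 3 → ℝ) :
    EuclideanSpace ℝ (Fin 3) :=
  WithLp.toLp 2 ![bcvF m p * ε 0, bcvF m p * ε 1, l / 2 * (p 0 * ε 1 - p 1 * ε 0) + ε 2]

lemma frameCoeff_frameVec {m l : ℝ} {p : EuclideanSpace ℝ (Fin 3)} (hp : p ∈ bcvDomain m)
    (ε : Fin 3 → ℝ) : frameCoeff m l p (frameVec m l p ε) = ε := by
  have : bcvF m p ≠ 0 := ne_of_gt hp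
  ext i
  fin_cases i
  · simp [frameCoeff, frameVec, this]
  · simp [frameCoeff, frameVec, this]
  · simp [frameCoeff, frameVec]; field_simp; ring

lemma bcvMetric_eq_frameCoeff {m l : ℝ} {p : EuclideanSpace ℝ (Fin 3)} (hp : p ∈ bcvDomain m)
    (v w : EuclideanSpace ℝ (Fin 3)) :
    ∑ i, ∑ j, bcvMetric m l p i j * v i * w j =
      ∑ i, frameCoeff m l p v i * frameCoeff m l p w i := by
  have : bcvF m p ≠ 0 := ne_of_gt hp
  simp [bcvMetric_eq, metricMatrix, frameCoeff, Fin.sum_univ_three]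
  field_simp
  ring

section

variable {m l : ℝ} {O : TopologicalSpace.Opens (EuclideanSpace ℝ (Fin 3))}

variable (m l O) in
/-- The vector field with the given components in the standard frame. -/
def frameField (ε : Fin 3 → smoothAlgebra O) : Derivation ℝ (smoothAlgebra O) (smoothAlgebra O) :=
  ε 0 • frame₁ m l O + ε 1 • frame₂ m l O + ε 2 • frame₃ O

lemma frameField_apply (ε : Fin 3 → smoothAlgebra O) (r : smoothAlgebra O) :
    frameField m l O ε r = ε 0 * frame₁ m l O r + ε 1 * frame₂ m l O r + ε 2 * frame₃ O r := rfl

lemma frameField_mem (ε : Fin 3 → smoothAlgebra O) : frameField m l O ε ∈ vectorFields O :=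
  Submodule.add_mem _ (Submodule.add_mem _ (Submodule.smul_mem _ _ frame₁_mem)
    (Submodule.smul_mem _ _ frame₂_mem)) (Submodule.smul_mem _ _ frame₃_mem)

lemma fderiv_eq_frameCoeff {r : smoothAlgebra O} {R : EuclideanSpace ℝ (Fin 3) → ℝ}
    (h : ∀ x, eval x r = R x) {p : O} (hp : (p : EuclideanSpace ℝ (Fin 3)) ∈ bcvDomain m)
    (v : EuclideanSpace ℝ (Fin 3)) :
    fderiv ℝ R p v = frameCoeff m l p v 0 * eval p (frame₁ m l O r) +
      frameCoeff m l p v 1 * eval p (frame₂ m l O r) +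
      frameCoeff m l p v 2 * eval p (frame₃ O r) := by
  have hF : bcvF m p ≠ 0 := ne_of_gt hp
  have h1 : v = ∑ i, v i • EuclideanSpace.single i (1 : ℝ) := by
    ext j
    fin_cases j <;> simp [Fin.sum_univ_three]
  have h2 : fderiv ℝ R p v = ∑ i, v i * eval p (partialDeriv i r) := by
    conv_lhs => rw [h1]
    rw [map_sum]
    refine Finset.sum_congr rfl fun i _ => ?_
    rw [map_smul, smul_eq_mul, eval_partialDeriv_of_eval h]
    rfl
  rw [h2, frame₁_apply, frame₂_apply, frame₃_apply]
  simp only [map_sub, map_add, map_mul, eval_smoothF, eval_algebraMap, eval_coordinate,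
    Fin.sum_univ_three, frameCoeff, Matrix.cons_val_zero, Matrix.cons_val_one, Matrix.cons_val]
  field_simp
  ring

end

namespace LocalSubmersion

variable {m l : ℝ} {O : TopologicalSpace.Opens (EuclideanSpace ℝ (Fin 3))}
  {T : TopologicalSpace.Opens (EuclideanSpace ℝ (Fin 2))}
  {f : EuclideanSpace ℝ (Fin 3) → EuclideanSpace ℝ (Fin 2)}
  {H : EuclideanSpace ℝ (Fin 2) → Matrix (Fin 2) (Fin 2) ℝ}

lemma fderiv_coord (h : LocalSubmersion m l O T f H) (p : O) (v : EuclideanSpace ℝ (Fin 3))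
    (α : Fin 2) : fderiv ℝ f p v α = frameCoeff m l p v 0 * eval p (frame₁ m l O (h.coord α)) +
      frameCoeff m l p v 1 * eval p (frame₂ m l O (h.coord α)) +
      frameCoeff m l p v 2 * eval p (frame₃ O (h.coord α)) := by
  rw [← fderiv_eq_frameCoeff (R := fun x => f x α) (h.eval_coord α) (h.subset p.2) v]
  have := ((EuclideanSpace.proj (𝕜 := ℝ) α).hasFDerivAt.comp (p : EuclideanSpace ℝ (Fin 3))
    (h.differentiableAt p).hasFDerivAt).fderiv
  exact (congrArg (fun L => L v) this).symm

/-- The components in the standard frame of the cross product of the gradients of the coordinates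
of the map. -/
def cross (h : LocalSubmersion m l O T f H) : Fin 3 → smoothAlgebra O :=
  ![frame₂ m l O (h.coord 0) * frame₃ O (h.coord 1) -
      frame₃ O (h.coord 0) * frame₂ m l O (h.coord 1),
    frame₃ O (h.coord 0) * frame₁ m l O (h.coord 1) -
      frame₁ m l O (h.coord 0) * frame₃ O (h.coord 1),
    frame₁ m l O (h.coord 0) * frame₂ m l O (h.coord 1) -
      frame₂ m l O (h.coord 0) * frame₁ m l O (h.coord 1)]

lemma cross_ne_zero (h : LocalSubmersion m l O T f H) (p : O) :
    0 < eval p (h.cross 0 ^ 2 + h.cross 1 ^ 2 + h.cross 2 ^ 2) := by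
  obtain ⟨v, hv⟩ := h.surjective p p.2 (EuclideanSpace.single 0 1)
  obtain ⟨w, hw⟩ := h.surjective p p.2 (EuclideanSpace.single 1 1)
  have hv0 := congrArg (fun z => z 0) hv
  have hv1 := congrArg (fun z => z 1) hv
  have hw0 := congrArg (fun z => z 0) hw
  have hw1 := congrArg (fun z => z 1) hw
  simp only [h.fderiv_coord] at hv0 hv1 hw0 hw1
  simp at hv0 hv1 hw0 hw1
  simp only [map_add, map_pow]
  have h0 : ∀ i, 0 ≤ eval p (h.cross i) ^ 2 := fun i => sq_nonneg _
  by_contra! hneg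
  have c0 : eval p (h.cross 0) = 0 :=
    pow_eq_zero_iff two_ne_zero |>.1 (by linarith [h0 0, h0 1, h0 2])
  have c1 : eval p (h.cross 1) = 0 :=
    pow_eq_zero_iff two_ne_zero |>.1 (by linarith [h0 0, h0 1, h0 2])
  have c2 : eval p (h.cross 2) = 0 :=
    pow_eq_zero_iff two_ne_zero |>.1 (by linarith [h0 0, h0 1, h0 2])
  simp [cross] at c0 c1 c2
  set v' := frameCoeff m l p v
  set w' := frameCoeff m l p w
  generalize eval p (frame₁ m l O (h.coord 0)) = A₁ at *
  generalize eval p (frame₂ m l O (h.coord 0)) = A₂ at *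
  generalize eval p (frame₃ O (h.coord 0)) = A₃ at *
  generalize eval p (frame₁ m l O (h.coord 1)) = B₁ at *
  generalize eval p (frame₂ m l O (h.coord 1)) = B₂ at *
  generalize eval p (frame₃ O (h.coord 1)) = B₃ at *
  have : (1 : ℝ) = 0 := by
    linear_combination (v' 1 * w' 2 - v' 2 * w' 1) * c0 + (v' 2 * w' 0 - v' 0 * w' 2) * c1 +
      (v' 0 * w' 1 - v' 1 * w' 0) * c2 - (w' 0 * B₁ + w' 1 * B₂ + w' 2 * B₃) * hv0 - hw1 +
      (v' 0 * B₁ + v' 1 * B₂ + v' 2 * B₃) * hw0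
  exact one_ne_zero this

/-- In `ℝ³`, a unit vector `V` that is orthogonal to two independent vectors `A` and `B` spans the
orthogonal complement of `A` and `B`. -/
lemma _root_.BCV.dot_eq_zero_of_cross {A₁ A₂ A₃ B₁ B₂ B₃ V₁ V₂ V₃ E₁ E₂ E₃ η₁ η₂ η₃ : ℝ}
    (hw : 0 < (A₂ * B₃ - A₃ * B₂) ^ 2 + (A₃ * B₁ - A₁ * B₃) ^ 2 + (A₁ * B₂ - A₂ * B₁) ^ 2)
    (hVA : V₁ * A₁ + V₂ * A₂ + V₃ * A₃ = 0) (hVB : V₁ * B₁ + V₂ * B₂ + V₃ * B₃ = 0)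
    (hVV : V₁ ^ 2 + V₂ ^ 2 + V₃ ^ 2 = 1) (hEV : E₁ * V₁ + E₂ * V₂ + E₃ * V₃ = 0)
    (hηA : η₁ * A₁ + η₂ * A₂ + η₃ * A₃ = 0) (hηB : η₁ * B₁ + η₂ * B₂ + η₃ * B₃ = 0) :
    E₁ * η₁ + E₂ * η₂ + E₃ * η₃ = 0 := by
  obtain ⟨w₁, hw₁⟩ : ∃ w, w = A₂ * B₃ - A₃ * B₂ := ⟨_, rfl⟩
  obtain ⟨w₂, hw₂⟩ : ∃ w, w = A₃ * B₁ - A₁ * B₃ := ⟨_, rfl⟩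
  obtain ⟨w₃, hw₃⟩ : ∃ w, w = A₁ * B₂ - A₂ * B₁ := ⟨_, rfl⟩
  rw [← hw₁, ← hw₂, ← hw₃] at hw
  have key : ∀ a b c x y z : ℝ, x * A₁ + y * A₂ + z * A₃ = 0 → x * B₁ + y * B₂ + z * B₃ = 0 →
      (w₁ ^ 2 + w₂ ^ 2 + w₃ ^ 2) * (a * x + b * y + c * z) =
        (a * w₁ + b * w₂ + c * w₃) * (x * w₁ + y * w₂ + z * w₃) := by
    intro a b c x y z hA hB
    subst hw₁ hw₂ hw₃
    grind
  have k1 := key E₁ E₂ E₃ η₁ η₂ η₃ hηA hηB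
  have k2 := key E₁ E₂ E₃ V₁ V₂ V₃ hVA hVB
  have k3 := key V₁ V₂ V₃ V₁ V₂ V₃ hVA hVB
  rw [hEV, mul_zero] at k2
  have k4 : V₁ * w₁ + V₂ * w₂ + V₃ * w₃ ≠ 0 := by
    intro h0
    rw [h0] at k3
    have : w₁ ^ 2 + w₂ ^ 2 + w₃ ^ 2 = 0 := by
      linear_combination k3 - (w₁ ^ 2 + w₂ ^ 2 + w₃ ^ 2) * hVV
    exact hw.ne' this
  have k5 := (mul_eq_zero.1 k2.symm).resolve_right k4
  rw [k5, zero_mul] at k1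
  exact (mul_eq_zero.1 k1).resolve_left hw.ne'

/-- An orthonormal frame of vector fields whose last vector is vertical is adapted to the
submersion. -/
lemma adaptedFrame (h : LocalSubmersion m l O T f H) {ε₁ ε₂ ε₃ : Fin 3 → smoothAlgebra O}
    (h11 : ε₁ 0 ^ 2 + ε₁ 1 ^ 2 + ε₁ 2 ^ 2 = 1) (h22 : ε₂ 0 ^ 2 + ε₂ 1 ^ 2 + ε₂ 2 ^ 2 = 1)
    (h33 : ε₃ 0 ^ 2 + ε₃ 1 ^ 2 + ε₃ 2 ^ 2 = 1)
    (h12 : ε₁ 0 * ε₂ 0 + ε₁ 1 * ε₂ 1 + ε₁ 2 * ε₂ 2 = 0)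
    (h13 : ε₁ 0 * ε₃ 0 + ε₁ 1 * ε₃ 1 + ε₁ 2 * ε₃ 2 = 0)
    (h23 : ε₂ 0 * ε₃ 0 + ε₂ 1 * ε₃ 1 + ε₂ 2 * ε₃ 2 = 0)
    (hv : h.geometry.push (frameField m l O ε₃) = 0) :
    AdaptedFrame h.geometry (frameField m l O ε₁) (frameField m l O ε₂)
      (frameField m l O ε₃) := by
  have hvert : ∀ α, ε₃ 0 * frame₁ m l O (h.coord α) + ε₃ 1 * frame₂ m l O (h.coord α) +
      ε₃ 2 * frame₃ O (h.coord α) = 0 := fun α => congrFun hv α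
  -- vectors orthogonal to `ε₃` are horizontal
  have hhor : ∀ (ε : Fin 3 → smoothAlgebra O),
      ε 0 * ε₃ 0 + ε 1 * ε₃ 1 + ε 2 * ε₃ 2 = 0 → ∀ (p : O) (u : EuclideanSpace ℝ (Fin 3)),
      fderiv ℝ f p u = 0 → ∑ i, ∑ j, bcvMetric m l p i j *
        frameVec m l p (fun i => eval p (ε i)) i * u j = 0 := by
    intro ε hε p u hu
    rw [bcvMetric_eq_frameCoeff (h.subset p.2), frameCoeff_frameVec (h.subset p.2),
      Fin.sum_univ_three]
    have k0 := h.fderiv_coord p u 0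
    have k1 := h.fderiv_coord p u 1
    rw [hu] at k0 k1
    have e0 := congrArg (eval p) (hvert 0)
    have e1 := congrArg (eval p) (hvert 1)
    have e2 := congrArg (eval p) hε
    have e3 := congrArg (eval p) h33
    have hc := h.cross_ne_zero p
    simp [cross] at k0 k1 e0 e1 e2 e3 hc
    exact dot_eq_zero_of_cross hc e0 e1 e3 e2 k0.symm k1.symm
  have hinner : ∀ (ε ε' : Fin 3 → smoothAlgebra O),
      ε 0 * ε₃ 0 + ε 1 * ε₃ 1 + ε 2 * ε₃ 2 = 0 → ε' 0 * ε₃ 0 + ε' 1 * ε₃ 1 + ε' 2 * ε₃ 2 = 0 →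
      h.geometry.inner (h.geometry.push (frameField m l O ε))
        (h.geometry.push (frameField m l O ε')) = ε 0 * ε' 0 + ε 1 * ε' 1 + ε 2 * ε' 2 := by
    intro ε ε' hε hε'
    ext p
    have k := h.isometry p p.2 _ _ (hhor ε hε p) (hhor ε' hε' p)
    rw [bcvMetric_eq_frameCoeff (h.subset p.2), frameCoeff_frameVec (h.subset p.2),
      frameCoeff_frameVec (h.subset p.2), Fin.sum_univ_three] at k
    simp only [h.fderiv_coord, frameCoeff_frameVec (h.subset p.2)] at k
    simp only [map_add, map_mul]
    rw [← k]
    simp only [PullbackGeometry.inner, map_sum, map_mul]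
    refine Finset.sum_congr rfl fun α _ => Finset.sum_congr rfl fun β _ => ?_
    have hp : ∀ (ε : Fin 3 → smoothAlgebra O) α,
        eval p (h.geometry.push (frameField m l O ε) α) =
        eval p (ε 0) * eval p (frame₁ m l O (h.coord α)) +
        eval p (ε 1) * eval p (frame₂ m l O (h.coord α)) +
        eval p (ε 2) * eval p (frame₃ O (h.coord α)) := by
      intro ε α
      change eval p (frameField m l O ε (h.coord α)) = _
      rw [frameField_apply]
      simp only [map_add, map_mul]
    have hm : eval p (h.geometry.metric α β) = H (f p) α β := rfl
    rw [hp, hp, hm]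
  exact ⟨frameField_mem _, frameField_mem _, frameField_mem _, hv,
    by rw [hinner _ _ h13 h13]; linear_combination h11, by rw [hinner _ _ h13 h23, h12],
    by rw [hinner _ _ h23 h23]; linear_combination h22⟩

end LocalSubmersion

/-! ### The vertical direction of a Riemannian submersion -/

lemma SubmersionFrame.eq_of_frame {A : Type*} [CommRing A] [Algebra ℝ A]
    {𝒱 : Submodule A (Derivation ℝ A A)} {P : PullbackGeometry A 𝒱}
    {M τ a t u σ ρ G x y σ' ρ' G' x' y' : A} {e₁ e₂ e₃ : Derivation ℝ A A}
    (h : SubmersionFrame M τ a t u σ ρ G x y e₁ e₂ e₃)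
    (h' : SubmersionFrame M τ a t u σ' ρ' G' x' y' e₁ e₂ e₃) (hP : AdaptedFrame P e₁ e₂ e₃)
    (he₃ : ∀ r : A, r • e₃ = 0 → r = 0) : x = x' ∧ y = y' := by
  have hG : G = G' := by
    have k := congrArg P.push (h.bracket₂₃.symm.trans h'.bracket₂₃)
    simp only [P.push_add, P.push_smul, hP.vertical, smul_zero, add_zero] at k
    have k' : G • P.push e₁ + (0 : A) • P.push e₂ = G' • P.push e₁ + (0 : A) • P.push e₂ := by
      rw [k]
    exact (hP.coeff_eq k').1
  subst hG
  have k1 := h.bracket₁₃.symm.trans h'.bracket₁₃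
  have k2 := h.bracket₂₃.symm.trans h'.bracket₂₃
  have k1' := add_left_cancel k1
  have k2' := add_left_cancel k2
  exact ⟨sub_eq_zero.1 (he₃ _ (by rw [sub_smul, k1', sub_self])),
    sub_eq_zero.1 (he₃ _ (by rw [sub_smul, k2', sub_self]))⟩

lemma smoothAlgebra.continuousOn_of_eval {n : ℕ}
    {O : TopologicalSpace.Opens (EuclideanSpace ℝ (Fin n))}
    {f : smoothAlgebra O} {F : EuclideanSpace ℝ (Fin n) → ℝ}
    (h : ∀ x, eval x f = F x) : ContinuousOn F O :=
  (contDiffOn_of_eval h).continuousOn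

namespace LocalSubmersion

variable {m l : ℝ} {O : TopologicalSpace.Opens (EuclideanSpace ℝ (Fin 3))}
  {T : TopologicalSpace.Opens (EuclideanSpace ℝ (Fin 2))}
  {f : EuclideanSpace ℝ (Fin 3) → EuclideanSpace ℝ (Fin 2)}
  {H : EuclideanSpace ℝ (Fin 2) → Matrix (Fin 2) (Fin 2) ℝ}

lemma mono (h : LocalSubmersion m l O T f H)
    {O' : TopologicalSpace.Opens (EuclideanSpace ℝ (Fin 3))} (hO : O' ≤ O) :
    LocalSubmersion m l O' T f H where
  smooth := h.smooth.mono hO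
  mapsTo := h.mapsTo.mono_left hO
  metric_smooth := h.metric_smooth
  metric_symm := h.metric_symm
  metric_det := h.metric_det
  subset := fun _ hp => h.subset (hO hp)
  surjective p hp := h.surjective p (hO hp)
  isometry p hp := h.isometry p (hO hp)

lemma fderiv_frameVec (h : LocalSubmersion m l O T f H) (p : O) (ε : Fin 3 → smoothAlgebra O)
    (α : Fin 2) : fderiv ℝ f p (frameVec m l p fun i => eval p (ε i)) α =
      eval p (h.geometry.push (frameField m l O ε) α) := by
  rw [h.fderiv_coord, frameCoeff_frameVec (h.subset p.2)]
  change _ = eval p (frameField m l O ε (h.coord α))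
  rw [frameField_apply]
  simp only [map_add, map_mul]

lemma push_frameField_eq_zero (h : LocalSubmersion m l O T f H) {ε : Fin 3 → smoothAlgebra O} :
    h.geometry.push (frameField m l O ε) = 0 ↔
      ∀ p : O, fderiv ℝ f p (frameVec m l p fun i => eval p (ε i)) = 0 := by
  constructor
  · intro h0 p
    ext α
    rw [h.fderiv_frameVec, h0]
    exact map_zero _
  · intro h0
    ext α p
    rw [← h.fderiv_frameVec, h0]
    exact (map_zero _).symm

lemma fderiv_vertical (h : LocalSubmersion m l O T f H) (p : O) (α : Fin 2) :
    fderiv ℝ f p (EuclideanSpace.single 2 1) α = eval p (h.geometry.push (frame₃ O) α) := by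
  rw [h.fderiv_coord]
  simp [frameCoeff]
  rfl

/-- The unit vertical field of a Riemannian submersion is `t c E₁ + t d E₂ + a E₃`, where `(c, d)`
is a unit vector and `t ≠ 0`; `u` is the inverse of `t`. -/
structure VerticalFrame (h : LocalSubmersion m l O T f H) (a t u c d : smoothAlgebra O) :
    Prop where
  unit : c ^ 2 + d ^ 2 = 1
  sq_add_sq : a ^ 2 + t ^ 2 = 1
  t_mul_u : t * u = 1
  vertical : h.geometry.push (frameField m l O ![t * c, t * d, a]) = 0

lemma exists_verticalFrame (h : LocalSubmersion m l O T f H)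
    (hz : ∀ p ∈ O, fderiv ℝ f p (EuclideanSpace.single 2 1) ≠ 0) :
    ∃ a t u c d, h.VerticalFrame a t u c d := by
  obtain ⟨s, hs, hs0⟩ := exists_inv_sqrt h.cross_ne_zero
  have hpos : ∀ p, 0 < eval p ((s * h.cross 0) ^ 2 + (s * h.cross 1) ^ 2) := by
    intro p
    have hc := h.cross_ne_zero p
    have hsp := hs0 p
    simp only [map_add, map_mul, map_pow] at hc ⊢
    by_contra! hneg
    have q0 := sq_nonneg (eval p s * eval p (h.cross 0))
    have q1 := sq_nonneg (eval p s * eval p (h.cross 1))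
    have c0 : eval p (h.cross 0) = 0 := by
      have : (eval p s * eval p (h.cross 0)) ^ 2 = 0 := by linarith
      exact (mul_eq_zero.1 (pow_eq_zero_iff two_ne_zero |>.1 this)).resolve_left hsp.ne'
    have c1 : eval p (h.cross 1) = 0 := by
      have : (eval p s * eval p (h.cross 1)) ^ 2 = 0 := by linarith
      exact (mul_eq_zero.1 (pow_eq_zero_iff two_ne_zero |>.1 this)).resolve_left hsp.ne'
    rw [c0, c1] at hc
    have c2 : eval p (h.cross 2) ≠ 0 := by
      intro h2
      rw [h2] at hc
      simp at hc
    refine hz p p.2 ?_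
    ext α
    rw [h.fderiv_vertical]
    change eval p (frame₃ O (h.coord α)) = 0
    have e0 : eval p (frame₃ O (h.coord 0)) * eval p (h.cross 2) = 0 := by
      have : frame₃ O (h.coord 0) * h.cross 2 =
          -(frame₁ m l O (h.coord 0) * h.cross 0 + frame₂ m l O (h.coord 0) * h.cross 1) := by
        simp [cross]; ring
      rw [← map_mul, this, map_neg, map_add, map_mul, map_mul, c0, c1]
      simp
    have e1 : eval p (frame₃ O (h.coord 1)) * eval p (h.cross 2) = 0 := by
      have : frame₃ O (h.coord 1) * h.cross 2 =
          -(frame₁ m l O (h.coord 1) * h.cross 0 + frame₂ m l O (h.coord 1) * h.cross 1) := by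
        simp [cross]; ring
      rw [← map_mul, this, map_neg, map_add, map_mul, map_mul, c0, c1]
      simp
    fin_cases α
    · exact (mul_eq_zero.1 e0).resolve_right c2
    · exact (mul_eq_zero.1 e1).resolve_right c2
  obtain ⟨r, hr, -⟩ := exists_inv_sqrt hpos
  refine ⟨s * h.cross 2, r * ((s * h.cross 0) ^ 2 + (s * h.cross 1) ^ 2), r,
    r * (s * h.cross 0), r * (s * h.cross 1), ?_, ?_, ?_, ?_⟩
  · linear_combination hr
  · linear_combination hs + ((s * h.cross 0) ^ 2 + (s * h.cross 1) ^ 2) * hr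
  · linear_combination hr
  · ext1 α
    change frameField m l O _ (h.coord α) = 0
    rw [frameField_apply]
    fin_cases α
    · simp [cross] at hr ⊢
      linear_combination s * ((frame₂ m l O (h.coord 0) * frame₃ O (h.coord 1) -
        frame₃ O (h.coord 0) * frame₂ m l O (h.coord 1)) * frame₁ m l O (h.coord 0) +
        (frame₃ O (h.coord 0) * frame₁ m l O (h.coord 1) -
        frame₁ m l O (h.coord 0) * frame₃ O (h.coord 1)) * frame₂ m l O (h.coord 0)) * hr
    · simp [cross] at hr ⊢
      linear_combination s * ((frame₂ m l O (h.coord 0) * frame₃ O (h.coord 1) -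
        frame₃ O (h.coord 0) * frame₂ m l O (h.coord 1)) * frame₁ m l O (h.coord 1) +
        (frame₃ O (h.coord 0) * frame₁ m l O (h.coord 1) -
        frame₁ m l O (h.coord 0) * frame₃ O (h.coord 1)) * frame₂ m l O (h.coord 1)) * hr

namespace VerticalFrame

variable {h : LocalSubmersion m l O T f H} {a t u c d : smoothAlgebra O}

lemma adaptedFrame (v : h.VerticalFrame a t u c d) :
    AdaptedFrame h.geometry (frameField m l O ![-(a * c), -(a * d), t])
      (frameField m l O ![d, -c, 0]) (frameField m l O ![t * c, t * d, a]) := by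
  have h1 := v.unit
  have h2 := v.sq_add_sq
  refine h.adaptedFrame ?_ ?_ ?_ ?_ ?_ ?_ v.vertical <;> simp
  · linear_combination a ^ 2 * h1 + h2
  · linear_combination h1
  · linear_combination t ^ 2 * h1 + h2
  · ring
  · linear_combination -a * t * h1
  · ring

lemma exists_submersionFrame (v : h.VerticalFrame a t u c d) :
    ∃ σ ρ G x y : smoothAlgebra O, SubmersionFrame (algebraMap ℝ _ m) (algebraMap ℝ _ (l / 2))
      a t u σ ρ G x y (frameField m l O ![-(a * c), -(a * d), t])
      (frameField m l O ![d, -c, 0]) (frameField m l O ![t * c, t * d, a]) ∧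
      h.geometry.frameTension (frame₁ m l O) (frame₂ m l O) (frame₃ O) (frameZ m l O) =
        -(x • h.geometry.push (frameField m l O ![-(a * c), -(a * d), t]) +
          y • h.geometry.push (frameField m l O ![d, -c, 0])) ∧
      h.geometry.frameBitension (frame₁ m l O) (frame₂ m l O) (frame₃ O) (frameZ m l O) =
        h.geometry.frameBitension (frameField m l O ![-(a * c), -(a * d), t])
          (frameField m l O ![d, -c, 0]) (frameField m l O ![t * c, t * d, a])
          (x • frameField m l O ![-(a * c), -(a * d), t] +
            (ρ + y) • frameField m l O ![d, -c, 0]) := by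
  refine (bcvFrame m l O).exists_submersionFrame v.unit v.sq_add_sq v.t_mul_u ?_ ?_ ?_
    v.adaptedFrame
  · ext1 r
    simp only [frameField_apply, Derivation.add_apply, Derivation.smul_apply, smul_eq_mul]
    simp
    ring
  · ext1 r
    simp only [frameField_apply, Derivation.sub_apply, Derivation.smul_apply, smul_eq_mul]
    simp
    ring
  · ext1 r
    simp only [frameField_apply, Derivation.add_apply, Derivation.smul_apply, smul_eq_mul]
    simp
    ring

/-- The structure equations of a biharmonic Riemannian submersion. -/
lemma exists_biharmonicFrame (v : h.VerticalFrame a t u c d)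
    (hb : ∀ p ∈ O, bitension (bcvMetric m l) H f p = 0) :
    ∃ σ ρ G x y : smoothAlgebra O, BiharmonicFrame (algebraMap ℝ _ m) (algebraMap ℝ _ (l / 2))
      a t u σ ρ G x y (frameField m l O ![-(a * c), -(a * d), t])
      (frameField m l O ![d, -c, 0]) (frameField m l O ![t * c, t * d, a]) ∧
      h.geometry.frameTension (frame₁ m l O) (frame₂ m l O) (frame₃ O) (frameZ m l O) =
        -(x • h.geometry.push (frameField m l O ![-(a * c), -(a * d), t]) +
          y • h.geometry.push (frameField m l O ![d, -c, 0])) := by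
  obtain ⟨σ, ρ, G, x, y, hS, hT, hB⟩ := v.exists_submersionFrame
  have h0 : h.geometry.frameBitension (frame₁ m l O) (frame₂ m l O) (frame₃ O)
      (frameZ m l O) = 0 := by
    ext α p
    rw [h.eval_frameBitension h.subset, hb p p.2]
    exact (map_zero _).symm
  have hA := v.adaptedFrame
  refine ⟨σ, ρ, G, x, y, ?_, hT⟩
  rw [hB] at h0
  clear hT hB
  generalize frameField m l O ![-(a * c), -(a * d), t] = e₁ at *
  generalize frameField m l O ![d, -c, 0] = e₂ at *
  generalize frameField m l O ![t * c, t * d, a] = e₃ at *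
  obtain ⟨b1, b2⟩ := hA.frameBitension_eq hS.bracket₁₂ hS.bracket₁₃ hS.bracket₂₃
    rfl rfl rfl rfl rfl rfl rfl h0
  exact ⟨hS, b1, b2⟩

lemma eq_zero_of_smul (v : h.VerticalFrame a t u c d) {r : smoothAlgebra O}
    (hr : r • frameField m l O ![t * c, t * d, a] = 0) : r = 0 := by
  obtain ⟨W, hW⟩ := exists_inv_smoothF h.subset
  have k0 := congrArg (fun D : Derivation ℝ (smoothAlgebra O) (smoothAlgebra O) =>
    D (coordinate O 0)) hr
  have k1 := congrArg (fun D : Derivation ℝ (smoothAlgebra O) (smoothAlgebra O) =>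
    D (coordinate O 1)) hr
  have hF := bcvFrame m l O
  simp only [Derivation.smul_apply, frameField_apply, hF.E₁_X, hF.E₂_X, hF.E₃_X, hF.E₁_Y, hF.E₂_Y,
    hF.E₃_Y, Derivation.zero_apply, smul_eq_mul, mul_zero, add_zero, zero_add] at k0 k1
  simp only [Matrix.cons_val_zero, Matrix.cons_val_one] at k0 k1
  have hW' : (1 + algebraMap ℝ _ m * (coordinate O 0 ^ 2 + coordinate O 1 ^ 2)) * W = 1 := hW
  linear_combination (u * W * c) * k0 + (u * W * d) * k1 -
    r * ((u * t) * (c ^ 2 + d ^ 2) * hW' + (c ^ 2 + d ^ 2) * v.t_mul_u + v.unit)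

end VerticalFrame

end LocalSubmersion

/-! ### The tension field of a biharmonic Riemannian submersion -/

/-- The inner product of two vectors at the point `y`, for the metric with components `H`. -/
def pairing (H : EuclideanSpace ℝ (Fin 2) → Matrix (Fin 2) (Fin 2) ℝ)
    (y : EuclideanSpace ℝ (Fin 2)) (v w : Fin 2 → ℝ) : ℝ :=
  ∑ α, ∑ β, H y α β * v α * w β

lemma CoordinateMap.eval_inner {O : TopologicalSpace.Opens (EuclideanSpace ℝ (Fin 3))}
    {T : TopologicalSpace.Opens (EuclideanSpace ℝ (Fin 2))}
    {f : EuclideanSpace ℝ (Fin 3) → EuclideanSpace ℝ (Fin 2)}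
    {H : EuclideanSpace ℝ (Fin 2) → Matrix (Fin 2) (Fin 2) ℝ} (h : CoordinateMap O T f H)
    (W W' : Fin 2 → smoothAlgebra O) (p : O) :
    eval p (h.geometry.inner W W') =
      pairing H (f p) (fun α => eval p (W α)) (fun α => eval p (W' α)) := by
  simp only [PullbackGeometry.inner, pairing, map_sum, map_mul]
  rfl

namespace LocalSubmersion

variable {m l : ℝ} {O : TopologicalSpace.Opens (EuclideanSpace ℝ (Fin 3))}
  {T : TopologicalSpace.Opens (EuclideanSpace ℝ (Fin 2))}
  {f : EuclideanSpace ℝ (Fin 3) → EuclideanSpace ℝ (Fin 2)}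
  {H : EuclideanSpace ℝ (Fin 2) → Matrix (Fin 2) (Fin 2) ℝ}

/-- The open set where the Killing field `∂_z` is not vertical. -/
def slanted (h : LocalSubmersion m l O T f H) :
    TopologicalSpace.Opens (EuclideanSpace ℝ (Fin 3)) where
  carrier := {p | p ∈ O ∧ fderiv ℝ f p (EuclideanSpace.single 2 1) ≠ 0}
  is_open' := by
    have hc : ContinuousOn (fun p => fderiv ℝ f p (EuclideanSpace.single 2 1)) O :=
      ((h.smooth.continuousOn_fderiv_of_isOpen O.2 (by simp)).clm_apply continuousOn_const)
    exact hc.isOpen_inter_preimage O.2 isOpen_ne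

lemma slanted_le (h : LocalSubmersion m l O T f H) : h.slanted ≤ O := fun _ hp => hp.1

lemma continuousOn_tension (h : LocalSubmersion m l O T f H) :
    ContinuousOn (tension (bcvMetric m l) H f) O :=
  continuousOn_pi.2 fun α => continuousOn_of_eval fun x => h.eval_frameTension h.subset x α

lemma continuousOn_norm_tension (h : LocalSubmersion m l O T f H) :
    ContinuousOn (fun p => pairing H (f p) (tension (bcvMetric m l) H f p)
      (tension (bcvMetric m l) H f p)) O := by
  refine continuousOn_of_eval (f := h.geometry.inner
    (h.geometry.frameTension (frame₁ m l O) (frame₂ m l O) (frame₃ O) (frameZ m l O))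
    (h.geometry.frameTension (frame₁ m l O) (frame₂ m l O) (frame₃ O) (frameZ m l O)))
    fun x => ?_
  rw [h.eval_inner]
  simp only [h.eval_frameTension h.subset]

lemma continuousOn_norm_vertical (h : LocalSubmersion m l O T f H) :
    ContinuousOn (fun p => pairing H (f p) (fderiv ℝ f p (EuclideanSpace.single 2 1))
      (fderiv ℝ f p (EuclideanSpace.single 2 1))) O := by
  refine continuousOn_of_eval (f := h.geometry.inner
    (h.geometry.push (frame₃ O)) (h.geometry.push (frame₃ O))) fun x => ?_
  rw [h.eval_inner]
  simp only [← h.fderiv_vertical]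

variable {h : LocalSubmersion m l O T f H} {a t u c d : smoothAlgebra O}

lemma _root_.BCV.AdaptedFrame.inner_combination {A : Type*} [CommRing A] [Algebra ℝ A]
    {𝒱 : Submodule A (Derivation ℝ A A)} {P : PullbackGeometry A 𝒱}
    {e₁ e₂ e₃ : Derivation ℝ A A} (hP : AdaptedFrame P e₁ e₂ e₃) (x y : A) :
    P.inner (-(x • P.push e₁ + y • P.push e₂)) (-(x • P.push e₁ + y • P.push e₂)) =
      x ^ 2 + y ^ 2 := by
  have k : ∀ W, P.inner (-(x • P.push e₁ + y • P.push e₂)) W =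
      -(x * P.inner (P.push e₁) W + y * P.inner (P.push e₂) W) := fun W => by
    rw [P.inner_neg_left, P.inner_add_left, P.inner_smul_left, P.inner_smul_left]
  rw [k, P.inner_comm (P.push e₁), P.inner_comm (P.push e₂), k, k, hP.inner₁₁, hP.inner₁₂,
    P.inner_comm (P.push e₂), hP.inner₁₂, hP.inner₂₂]
  ring

namespace VerticalFrame

lemma norm_tension (v : h.VerticalFrame a t u c d) {x y : smoothAlgebra O}
    (hT : h.geometry.frameTension (frame₁ m l O) (frame₂ m l O) (frame₃ O) (frameZ m l O) =
        -(x • h.geometry.push (frameField m l O ![-(a * c), -(a * d), t]) +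
          y • h.geometry.push (frameField m l O ![d, -c, 0]))) (p : O) :
    pairing H (f p) (tension (bcvMetric m l) H f p) (tension (bcvMetric m l) H f p) =
      eval p x ^ 2 + eval p y ^ 2 := by
  have k := congrArg (eval p) (v.adaptedFrame.inner_combination x y)
  rw [← hT, h.eval_inner] at k
  simp only [h.eval_frameTension h.subset] at k
  rw [k]
  simp only [map_add, map_pow]

lemma norm_vertical (v : h.VerticalFrame a t u c d) (p : O) :
    pairing H (f p) (fderiv ℝ f p (EuclideanSpace.single 2 1))
      (fderiv ℝ f p (EuclideanSpace.single 2 1)) = eval p t ^ 2 := by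
  have hE : frame₃ O = t • frameField m l O ![-(a * c), -(a * d), t] +
      a • frameField m l O ![t * c, t * d, a] := by
    ext1 r
    simp only [frameField_apply, Derivation.add_apply, Derivation.smul_apply, smul_eq_mul]
    simp
    linear_combination -frame₃ O r * v.sq_add_sq
  have hA := v.adaptedFrame
  have k : h.geometry.push (frame₃ O) =
      t • h.geometry.push (frameField m l O ![-(a * c), -(a * d), t]) := by
    rw [hE, PullbackGeometry.push_add, PullbackGeometry.push_smul, PullbackGeometry.push_smul,
      hA.vertical, smul_zero, add_zero]
  have k2 : h.geometry.inner (h.geometry.push (frame₃ O)) (h.geometry.push (frame₃ O)) =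
      t ^ 2 := by
    rw [k, PullbackGeometry.inner_smul_left, PullbackGeometry.inner_comm,
      PullbackGeometry.inner_smul_left, hA.inner₁₁]
    ring
  have k3 := congrArg (eval p) k2
  rw [h.eval_inner] at k3
  simp only [← h.fderiv_vertical, map_pow] at k3
  exact k3

end VerticalFrame

/-- Where `∂_z` is not vertical and the tension field does not vanish, the norm of the tension field
and of the horizontal part of `∂_z` are determined by `m` and `l`. -/
lemma norms_of_ne_zero (h : LocalSubmersion m l O T f H)
    (hb : ∀ p ∈ O, bitension (bcvMetric m l) H f p = 0) {p : EuclideanSpace ℝ (Fin 3)}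
    (hp : p ∈ O) (hz : fderiv ℝ f p (EuclideanSpace.single 2 1) ≠ 0)
    (hT : tension (bcvMetric m l) H f p ≠ 0) :
    m < 0 ∧
    pairing H (f p) (tension (bcvMetric m l) H f p) (tension (bcvMetric m l) H f p) = -4 * m ∧
    (4 * m - l ^ 2) * pairing H (f p) (fderiv ℝ f p (EuclideanSpace.single 2 1))
      (fderiv ℝ f p (EuclideanSpace.single 2 1)) = 4 * m := by
  have h' := h.mono h.slanted_le
  have hp' : p ∈ h.slanted := ⟨hp, hz⟩
  obtain ⟨a, t, u, c, d, v⟩ := h'.exists_verticalFrame fun q hq => hq.2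
  obtain ⟨σ, ρ, G, x, y, hB, hT'⟩ := v.exists_biharmonicFrame fun q hq => hb q hq.1
  have hF := hB.isFlatFrame
  have hN := v.norm_tension hT' ⟨p, hp'⟩
  have hs := v.norm_vertical ⟨p, hp'⟩
  have f1 := congrArg (eval ⟨p, hp'⟩) hF.norm_sq
  have f2 := congrArg (eval ⟨p, hp'⟩) hF.angle
  have f3 := congrArg (eval ⟨p, hp'⟩) v.sq_add_sq
  have hT'' : ∀ α, tension (bcvMetric m l) H f p α = -(eval ⟨p, hp'⟩ x *
      eval ⟨p, hp'⟩ (h'.geometry.push (frameField m l _ ![-(a * c), -(a * d), t]) α) +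
      eval ⟨p, hp'⟩ y * eval ⟨p, hp'⟩ (h'.geometry.push (frameField m l _ ![d, -c, 0]) α)) := by
    intro α
    have := h'.eval_frameTension (l := l) h'.subset ⟨p, hp'⟩ α
    rw [← this, hT']
    simp
  simp only [map_add, map_mul, map_sub, map_pow, eval_algebraMap, map_ofNat, map_zero,
    map_one] at f1 f2 f3
  have hpos : 0 < eval ⟨p, hp'⟩ x ^ 2 + eval ⟨p, hp'⟩ y ^ 2 := by
    by_contra! hneg
    have q0 := sq_nonneg (eval ⟨p, hp'⟩ x)
    have q1 := sq_nonneg (eval ⟨p, hp'⟩ y)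
    have x0 : eval ⟨p, hp'⟩ x = 0 := pow_eq_zero_iff two_ne_zero |>.1 (by linarith)
    have y0 : eval ⟨p, hp'⟩ y = 0 := pow_eq_zero_iff two_ne_zero |>.1 (by linarith)
    apply hT
    ext α
    rw [hT'', x0, y0]
    simp
  rw [← hN] at f1 f2 hpos
  rw [hs]
  have g1 := (mul_eq_zero.1 f1).resolve_left hpos.ne'
  have g2 := (mul_eq_zero.1 f2).resolve_left hpos.ne'
  refine ⟨?_, ?_, ?_⟩
  · simp only at hpos g1; linarith
  · simp only at g1; linarith
  · linear_combination -g2 + (4 * m - l ^ 2) * f3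

/-- The tension field only depends on the fibres. -/
lemma tension_eq_zero_of_ker_le (h : LocalSubmersion m l O T f H)
    {T' : TopologicalSpace.Opens (EuclideanSpace ℝ (Fin 2))}
    {f' : EuclideanSpace ℝ (Fin 3) → EuclideanSpace ℝ (Fin 2)}
    {H' : EuclideanSpace ℝ (Fin 2) → Matrix (Fin 2) (Fin 2) ℝ}
    (h' : LocalSubmersion m l O T' f' H')
    (hker : ∀ p ∈ O, ∀ v, fderiv ℝ f p v = 0 → fderiv ℝ f' p v = 0)
    {p : EuclideanSpace ℝ (Fin 3)} (hp : p ∈ O)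
    (hz : fderiv ℝ f p (EuclideanSpace.single 2 1) ≠ 0)
    (hT : tension (bcvMetric m l) H f p = 0) : tension (bcvMetric m l) H' f' p = 0 := by
  have k := h.mono h.slanted_le
  have k' := h'.mono h.slanted_le
  have hp' : p ∈ h.slanted := ⟨hp, hz⟩
  obtain ⟨a, t, u, c, d, v⟩ := k.exists_verticalFrame fun q hq => hq.2
  have v' : k'.VerticalFrame a t u c d := ⟨v.unit, v.sq_add_sq, v.t_mul_u,
    k'.push_frameField_eq_zero.2 fun q => hker q q.2.1 _ (k.push_frameField_eq_zero.1 v.vertical q)⟩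
  obtain ⟨σ, ρ, G, x, y, hS, hT1, -⟩ := v.exists_submersionFrame
  obtain ⟨σ', ρ', G', x', y', hS', hT2, -⟩ := v'.exists_submersionFrame
  obtain ⟨rfl, rfl⟩ := hS.eq_of_frame hS' v.adaptedFrame fun r hr => v.eq_zero_of_smul hr
  have hN := v.norm_tension hT1 ⟨p, hp'⟩
  simp only [hT, pairing, Pi.zero_apply, mul_zero, Finset.sum_const_zero] at hN
  have q0 := sq_nonneg (eval ⟨p, hp'⟩ x)
  have q1 := sq_nonneg (eval ⟨p, hp'⟩ y)
  have x0 : eval ⟨p, hp'⟩ x = 0 := pow_eq_zero_iff two_ne_zero |>.1 (by linarith)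
  have y0 : eval ⟨p, hp'⟩ y = 0 := pow_eq_zero_iff two_ne_zero |>.1 (by linarith)
  ext α
  have := k'.eval_frameTension (l := l) k'.subset ⟨p, hp'⟩ α
  rw [← this, hT2]
  simp [x0, y0]

/-- If the fibres are the vertical lines, the submersion is harmonic. -/
lemma tension_eq_zero_of_vertical (h : LocalSubmersion m l O T f H)
    (hz : ∀ p ∈ O, fderiv ℝ f p (EuclideanSpace.single 2 1) = 0)
    {p : EuclideanSpace ℝ (Fin 3)} (hp : p ∈ O) : tension (bcvMetric m l) H f p = 0 := by
  have hA := h.adaptedFrame (ε₁ := ![1, 0, 0]) (ε₂ := ![0, 1, 0]) (ε₃ := ![0, 0, 1])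
    (by simp) (by simp) (by simp) (by simp) (by simp) (by simp) (by
      rw [h.push_frameField_eq_zero]
      intro q
      rw [← hz q q.2]
      congr 1
      ext i
      fin_cases i <;> simp [frameVec])
  have e1 : frameField m l O ![1, 0, 0] = frame₁ m l O := by
    ext1 r; rw [frameField_apply]; simp
  have e2 : frameField m l O ![0, 1, 0] = frame₂ m l O := by
    ext1 r; rw [frameField_apply]; simp
  have e3 : frameField m l O ![0, 0, 1] = frame₃ O := by
    ext1 r; rw [frameField_apply]; simp
  rw [e1, e2, e3] at hA
  have hT := hA.frameTension_eq (x := 0) (y := 0) (bcvFrame m l O).bracket₁₂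
  have hZ : (0 + 2 * algebraMap ℝ (smoothAlgebra O) m * coordinate O 0) • frame₁ m l O +
      (0 - -(2 * algebraMap ℝ (smoothAlgebra O) m * coordinate O 1)) • frame₂ m l O =
      frameZ m l O := by
    rw [zero_add, zero_sub, neg_neg]; rfl
  rw [hZ, zero_smul, zero_smul, add_zero, neg_zero] at hT
  ext α
  have := h.eval_frameTension (l := l) h.subset ⟨p, hp⟩ α
  rw [← this, hT]
  simp

end LocalSubmersion

/-! ### Flat coordinates -/

namespace AdaptedFrame

variable {A : Type*} [CommRing A] [Algebra ℝ A] {𝒱 : Submodule A (Derivation ℝ A A)}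
  {P : PullbackGeometry A 𝒱} {e₁ e₂ e₃ : Derivation ℝ A A}

/-- The one-forms dual to a parallel frame are closed. -/
lemma closed_of_parallel {X Y : Derivation ℝ A A} (hX : X ∈ 𝒱) (hY : Y ∈ 𝒱)
    (hXY : ⁅X, Y⁆ = 0) {W : Fin 2 → A} (hW : ∀ X ∈ 𝒱, P.cov X W = 0) :
    X (P.inner (P.push Y) W) = Y (P.inner (P.push X) W) := by
  have hz : ∀ V, P.inner V 0 = 0 := fun V => by simp [PullbackGeometry.inner]
  rw [P.deriv_inner hX, P.deriv_inner hY, hW X hX, hW Y hY, hz, hz, add_zero, add_zero]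
  have := P.cov_push_sub X Y
  have h0 : P.push (0 : Derivation ℝ A A) = 0 := by ext; simp [PullbackGeometry.push]
  rw [hXY, h0, sub_eq_zero] at this
  rw [this]

lemma cov_combination_eq_zero {W : Fin 2 → A} (h1 : P.cov e₁ W = 0) (h2 : P.cov e₂ W = 0)
    (h3 : P.cov e₃ W = 0) (r₁ r₂ r₃ : A) : P.cov (r₁ • e₁ + r₂ • e₂ + r₃ • e₃) W = 0 := by
  simp only [P.cov_add_left, P.cov_smul_left, h1, h2, h3, smul_zero, add_zero]

/-- If its connection form vanishes, the frame `df(e₁)`, `df(e₂)` is parallel. -/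
lemma parallel (h : AdaptedFrame P e₁ e₂ e₃) {s x y : A} (h12 : ⁅e₁, e₂⁆ = s • e₃)
    (h13 : ⁅e₁, e₃⁆ = x • e₃) (h23 : ⁅e₂, e₃⁆ = y • e₃) :
    (P.cov e₁ (P.push e₁) = 0 ∧ P.cov e₂ (P.push e₁) = 0 ∧ P.cov e₃ (P.push e₁) = 0) ∧
    (P.cov e₁ (P.push e₂) = 0 ∧ P.cov e₂ (P.push e₂) = 0 ∧ P.cov e₃ (P.push e₂) = 0) := by
  have k : ∀ r : A, r • e₃ = (0 : A) • e₁ + (0 : A) • e₂ + r • e₃ := fun r => by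
    rw [zero_smul, zero_smul, zero_add, zero_add]
  obtain ⟨a1, a2, a3, a4⟩ := h.horizontal_bracket (h12.trans (k s))
  obtain ⟨-, -, -, a5, a6⟩ := h.vertical_bracket (h13.trans (k x)) (h23.trans (k y))
  simp only [neg_zero, zero_smul] at a1 a2 a3 a4 a5 a6
  exact ⟨⟨a1, a3, a5⟩, a2, a4, a6⟩

lemma inner_eq (h : AdaptedFrame P e₁ e₂ e₃) (W W' : Fin 2 → A) :
    P.inner W W' = P.inner W (P.push e₁) * P.inner W' (P.push e₁) +
      P.inner W (P.push e₂) * P.inner W' (P.push e₂) := by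
  conv_lhs => rw [h.expand W]
  rw [P.inner_add_left, P.inner_smul_left, P.inner_smul_left, P.inner_comm _ W',
    P.inner_comm _ W']

end AdaptedFrame

lemma SubmersionFrame.parallel {A : Type*} [CommRing A] [Algebra ℝ A]
    {𝒱 : Submodule A (Derivation ℝ A A)} {P : PullbackGeometry A 𝒱} {M τ a t u σ x y : A}
    {e₁ e₂ e₃ : Derivation ℝ A A} (h : SubmersionFrame M τ a t u σ 0 0 x y e₁ e₂ e₃)
    (hP : AdaptedFrame P e₁ e₂ e₃) :
    (P.cov e₁ (P.push e₁) = 0 ∧ P.cov e₂ (P.push e₁) = 0 ∧ P.cov e₃ (P.push e₁) = 0) ∧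
    (P.cov e₁ (P.push e₂) = 0 ∧ P.cov e₂ (P.push e₂) = 0 ∧ P.cov e₃ (P.push e₂) = 0) := by
  refine hP.parallel (s := -(2 * σ)) (x := x) (y := y) ?_ ?_ ?_
  · rw [h.bracket₁₂, neg_zero, zero_smul, zero_sub, neg_smul (2 * σ)]
  · rw [h.bracket₁₃, neg_zero, zero_smul, zero_add]
  · rw [h.bracket₂₃, zero_smul, zero_add]

namespace LocalSubmersion

variable {m l : ℝ} {O : TopologicalSpace.Opens (EuclideanSpace ℝ (Fin 3))}
  {T : TopologicalSpace.Opens (EuclideanSpace ℝ (Fin 2))}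
  {f : EuclideanSpace ℝ (Fin 3) → EuclideanSpace ℝ (Fin 2)}
  {H : EuclideanSpace ℝ (Fin 2) → Matrix (Fin 2) (Fin 2) ℝ}
  {h : LocalSubmersion m l O T f H} {a t u c d : smoothAlgebra O}

/-- A field along the map which is parallel in the directions of the adapted frame is parallel. -/
lemma VerticalFrame.cov_eq_zero (v : h.VerticalFrame a t u c d) {W : Fin 2 → smoothAlgebra O}
    (h1 : h.geometry.cov (frameField m l O ![-(a * c), -(a * d), t]) W = 0)
    (h2 : h.geometry.cov (frameField m l O ![d, -c, 0]) W = 0)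
    (h3 : h.geometry.cov (frameField m l O ![t * c, t * d, a]) W = 0) :
    ∀ X ∈ vectorFields O, h.geometry.cov X W = 0 := by
  obtain ⟨w, hw⟩ := exists_inv_smoothF h.subset
  have k1 := v.unit
  have k2 := v.sq_add_sq
  have g : ∀ ε : Fin 3 → smoothAlgebra O, h.geometry.cov (frameField m l O ε) W = 0 := by
    intro ε
    have : frameField m l O ε =
        (-(a * c) * ε 0 - a * d * ε 1 + t * ε 2) • frameField m l O ![-(a * c), -(a * d), t] +
        (d * ε 0 - c * ε 1) • frameField m l O ![d, -c, 0] +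
        (t * c * ε 0 + t * d * ε 1 + a * ε 2) • frameField m l O ![t * c, t * d, a] := by
      ext1 r
      simp only [frameField_apply, Derivation.add_apply, Derivation.smul_apply, smul_eq_mul]
      simp
      linear_combination -(ε 0 * frame₁ m l O r + ε 1 * frame₂ m l O r) * k1 -
        (ε 2 * frame₃ O r + (c * ε 0 + d * ε 1) *
        (c * frame₁ m l O r + d * frame₂ m l O r)) * k2
    rw [this]
    exact AdaptedFrame.cov_combination_eq_zero h1 h2 h3 _ _ _
  intro X hX
  obtain ⟨q, rfl⟩ := exists_eq_field hX
  have : field q = frameField m l O ![w * q 0, w * q 1, q 2 + algebraMap ℝ _ (l / 2) * w *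
      (coordinate O 1 * q 0 - coordinate O 0 * q 1)] := by
    ext1 r
    rw [field_apply, frameField_apply, Fin.sum_univ_three, frame₁_apply, frame₂_apply,
      frame₃_apply]
    simp only [Matrix.cons_val_zero, Matrix.cons_val_one, Matrix.cons_val]
    linear_combination -(q 0 * partialDeriv 0 r + q 1 * partialDeriv 1 r) * hw
  rw [this, g]

lemma fderiv_apply_eq_push (h : LocalSubmersion m l O T f H) (p : O)
    (v : EuclideanSpace ℝ (Fin 3)) (α : Fin 2) : fderiv ℝ f p v α =
      eval p (h.geometry.push (field fun i => algebraMap ℝ _ (v i)) α) := by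
  change _ = eval p (field _ (h.coord α))
  rw [eval_field_of_eval (F := fun x => f x α) _ (h.eval_coord α)]
  simp only [eval_algebraMap]
  have := ((EuclideanSpace.proj (𝕜 := ℝ) α).hasFDerivAt.comp (p : EuclideanSpace ℝ (Fin 3))
    (h.differentiableAt p).hasFDerivAt).fderiv
  exact (congrArg (fun L => L v) this).symm

lemma eval_inner_push_field (h : LocalSubmersion m l O T f H) (p : O)
    (v : EuclideanSpace ℝ (Fin 3)) (W : Fin 2 → smoothAlgebra O) :
    eval p (h.geometry.inner (h.geometry.push (field fun i => algebraMap ℝ _ (v i))) W) =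
      ∑ i, eval p (h.geometry.inner (h.geometry.push (partialDeriv i)) W) * v i := by
  rw [field, Fin.sum_univ_three, PullbackGeometry.push_add, PullbackGeometry.push_add,
    PullbackGeometry.push_smul, PullbackGeometry.push_smul, PullbackGeometry.push_smul,
    PullbackGeometry.inner_add_left, PullbackGeometry.inner_add_left,
    PullbackGeometry.inner_smul_left, PullbackGeometry.inner_smul_left,
    PullbackGeometry.inner_smul_left]
  simp only [map_add, map_mul, eval_algebraMap, Fin.sum_univ_three]
  ring

lemma pairing_fderiv (h : LocalSubmersion m l O T f H)
    {e₁ e₂ e₃ : Derivation ℝ (smoothAlgebra O) (smoothAlgebra O)}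
    (hA : AdaptedFrame h.geometry e₁ e₂ e₃) (p : O) (v w : EuclideanSpace ℝ (Fin 3)) :
    pairing H (f p) (fderiv ℝ f p v) (fderiv ℝ f p w) =
      (∑ i, eval p (h.geometry.inner (h.geometry.push (partialDeriv i))
        (h.geometry.push e₁)) * v i) *
      (∑ i, eval p (h.geometry.inner (h.geometry.push (partialDeriv i))
        (h.geometry.push e₁)) * w i) +
      (∑ i, eval p (h.geometry.inner (h.geometry.push (partialDeriv i))
        (h.geometry.push e₂)) * v i) *
      (∑ i, eval p (h.geometry.inner (h.geometry.push (partialDeriv i))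
        (h.geometry.push e₂)) * w i) := by
  have key := congrArg (eval p) (hA.inner_eq
    (h.geometry.push (field fun i => algebraMap ℝ _ (v i)))
    (h.geometry.push (field fun i => algebraMap ℝ _ (w i))))
  rw [h.eval_inner, map_add, map_mul, map_mul, h.eval_inner_push_field, h.eval_inner_push_field,
    h.eval_inner_push_field, h.eval_inner_push_field] at key
  rw [← key]
  congr 1 <;> ext α <;> exact h.fderiv_apply_eq_push _ _ _

lemma exists_parallel_frame (h : LocalSubmersion m l O T f H)
    (hb : ∀ p ∈ O, bitension (bcvMetric m l) H f p = 0)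
    (hz : ∀ p ∈ O, fderiv ℝ f p (EuclideanSpace.single 2 1) ≠ 0)
    (hT : ∀ p ∈ O, tension (bcvMetric m l) H f p ≠ 0) :
    ∃ e₁ e₂ e₃ : Derivation ℝ (smoothAlgebra O) (smoothAlgebra O),
      AdaptedFrame h.geometry e₁ e₂ e₃ ∧
      (∀ X ∈ vectorFields O, h.geometry.cov X (h.geometry.push e₁) = 0) ∧
      ∀ X ∈ vectorFields O, h.geometry.cov X (h.geometry.push e₂) = 0 := by
  obtain ⟨a, t, u, c, d, v⟩ := h.exists_verticalFrame hz
  obtain ⟨σ, ρ, G, x, y, hB, hT'⟩ := v.exists_biharmonicFrame hb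
  have hF := hB.isFlatFrame
  have hA := v.adaptedFrame
  have hne : ∀ p, eval p (x ^ 2 + y ^ 2) ≠ 0 := by
    intro p
    have hn := (h.norms_of_ne_zero hb p.2 (hz p p.2) (hT p p.2))
    rw [map_add, map_pow, map_pow, ← v.norm_tension hT' p, hn.2.1]
    linarith [hn.1]
  have hρ : ρ = 0 := by
    ext p
    have := congrArg (eval p) hF.mul_ρ
    rw [map_mul, map_zero] at this
    rw [(mul_eq_zero.1 this).resolve_left (hne p), map_zero]
  have hG : G = 0 := by
    ext p
    have := congrArg (eval p) hF.mul_G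
    rw [map_mul, map_zero] at this
    rw [(mul_eq_zero.1 this).resolve_left (hne p), map_zero]
  subst hρ hG
  obtain ⟨⟨a1, a3, a5⟩, a2, a4, a6⟩ := hB.parallel hA
  exact ⟨_, _, _, hA, v.cov_eq_zero a1 a3 a5, v.cov_eq_zero a2 a4 a6⟩

/-- Where the tension field does not vanish, the target is flat: the metric of the target is pulled
back to a sum of squares of closed one-forms. -/
lemma exists_closed_forms (h : LocalSubmersion m l O T f H)
    (hb : ∀ p ∈ O, bitension (bcvMetric m l) H f p = 0)
    (hz : ∀ p ∈ O, fderiv ℝ f p (EuclideanSpace.single 2 1) ≠ 0)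
    (hT : ∀ p ∈ O, tension (bcvMetric m l) H f p ≠ 0) :
    ∃ θ : Fin 2 → Fin 3 → smoothAlgebra O,
      (∀ k i j, partialDeriv i (θ k j) = partialDeriv j (θ k i)) ∧
      ∀ (p : O) (v w : EuclideanSpace ℝ (Fin 3)), pairing H (f p) (fderiv ℝ f p v)
        (fderiv ℝ f p w) = ∑ k, (∑ i, eval p (θ k i) * v i) * ∑ i, eval p (θ k i) * w i := by
  obtain ⟨e₁, e₂, e₃, hA, p1, p2⟩ := h.exists_parallel_frame hb hz hT
  refine ⟨fun k i => ![h.geometry.inner (h.geometry.push (partialDeriv i)) (h.geometry.push e₁),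
    h.geometry.inner (h.geometry.push (partialDeriv i)) (h.geometry.push e₂)] k,
    fun k i j => ?_, fun p q w => ?_⟩
  · have hcomm : ⁅(partialDeriv i : Derivation ℝ (smoothAlgebra O) (smoothAlgebra O)),
        (partialDeriv j : Derivation ℝ (smoothAlgebra O) (smoothAlgebra O))⁆ = 0 := by
      ext1 r
      rw [Derivation.commutator_apply, partialDeriv_comm, sub_self]
      rfl
    have hc : ∀ W, (∀ X ∈ vectorFields O, h.geometry.cov X W = 0) →
        partialDeriv i (h.geometry.inner (h.geometry.push (partialDeriv j)) W) =
        partialDeriv j (h.geometry.inner (h.geometry.push (partialDeriv i)) W) := fun W hW =>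
      AdaptedFrame.closed_of_parallel (P := h.geometry) (partialDeriv_mem i) (partialDeriv_mem j)
        hcomm hW
    fin_cases k
    · exact hc _ p1
    · exact hc _ p2
  · rw [h.pairing_fderiv hA, Fin.sum_univ_two]
    rfl

end LocalSubmersion

/-- The Poincaré lemma for a closed one-form on a ball. -/
lemma smoothAlgebra.exists_primitive {n : ℕ}
    {O : TopologicalSpace.Opens (EuclideanSpace ℝ (Fin n))} {θ : Fin n → smoothAlgebra O}
    (hθ : ∀ i j, partialDeriv i (θ j) = partialDeriv j (θ i)) {p : EuclideanSpace ℝ (Fin n)}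
    {r : ℝ} (hball : Metric.ball p r ⊆ O) :
    ∃ U : EuclideanSpace ℝ (Fin n) → ℝ, ContDiffOn ℝ ∞ U (Metric.ball p r) ∧
      ∀ q : O, (q : EuclideanSpace ℝ (Fin n)) ∈ Metric.ball p r → ∃ L : _ →L[ℝ] ℝ,
        HasFDerivAt U L q ∧ ∀ v, L v = ∑ i, eval q (θ i) * v i := by
  obtain ⟨η, hη⟩ : ∃ η : EuclideanSpace ℝ (Fin n) → EuclideanSpace ℝ (Fin n) →L[ℝ] ℝ,
      η = fun q => ∑ i, rep (θ i) q • EuclideanSpace.proj i := ⟨_, rfl⟩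
  have hη' : ∀ (q : O) v, η q v = ∑ i, eval q (θ i) * v i := by
    intro q v
    rw [hη]
    simp only [sum_apply, smul_apply, smul_eq_mul, rep_apply]
    rfl
  have hs : ContDiffOn ℝ ∞ η (Metric.ball p r) := by
    rw [hη]
    exact ContDiffOn.sum fun i _ => ((contDiffOn_rep (θ i)).mono hball).smul contDiffOn_const
  have hd : ∀ q ∈ Metric.ball p r, DifferentiableAt ℝ η q := fun q hq =>
    (hs.contDiffAt (Metric.isOpen_ball.mem_nhds hq)).differentiableAt (by simp)
  have hdη : ∀ (q : O), (q : EuclideanSpace ℝ (Fin n)) ∈ Metric.ball p r → ∀ v w,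
      fderiv ℝ η q v w = ∑ j, ∑ i, eval q (partialDeriv j (θ i)) * v j * w i := by
    intro q hq v w
    have h1 : fderiv ℝ η q v w = fderiv ℝ (fun q => η q w) q v := by
      rw [fderiv_clm_apply (hd q hq) (differentiableAt_const _)]
      simp
    have h2 : ∀ x : O, eval x (∑ i, algebraMap ℝ _ (w i) * θ i) = η x w := by
      intro x
      rw [hη', map_sum]
      refine Finset.sum_congr rfl fun i _ => ?_
      rw [map_mul, AlgHom.commutes, mul_comm]
      rfl
    have h3 := eval_field_of_eval (fun i => algebraMap ℝ _ (v i)) (F := fun q => η q w) h2 q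
    simp only [AlgHom.commutes] at h3
    rw [h1]
    refine h3.symm.trans ?_
    rw [field_apply, map_sum]
    refine Finset.sum_congr rfl fun j _ => ?_
    rw [map_mul, AlgHom.commutes, map_sum, map_sum, Finset.mul_sum]
    refine Finset.sum_congr rfl fun i _ => ?_
    rw [Derivation.leibniz, Derivation.map_algebraMap, smul_zero, add_zero, smul_eq_mul, map_mul,
      AlgHom.commutes]
    change v j * (w i * _) = _
    ring
  obtain ⟨U, hU⟩ := (convex_ball p r).exists_forall_hasFDerivAt_of_fderiv_symmetric
    Metric.isOpen_ball (hs.differentiableOn (by simp)) fun q hq v w => by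
      rw [hdη ⟨q, hball hq⟩ hq, hdη ⟨q, hball hq⟩ hq, Finset.sum_comm]
      refine Finset.sum_congr rfl fun i _ => Finset.sum_congr rfl fun j _ => ?_
      rw [hθ]
      ring
  refine ⟨U, (contDiffOn_infty_iff_fderiv_of_isOpen Metric.isOpen_ball).2
    ⟨fun q hq => (hU q hq).differentiableAt.differentiableWithinAt,
      hs.congr fun q hq => (hU q hq).fderiv⟩, fun q hq => ⟨η q, hU q hq, hη' q⟩⟩

/-- A smooth map whose derivative at `x` is injective is a local diffeomorphism at `x`. -/
lemma exists_local_diffeomorphism {E : Type*} [NormedAddCommGroup E] [NormedSpace ℝ E]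
    [FiniteDimensional ℝ E] {g : E → E} {s : Set E} (hs : IsOpen s) (hg : ContDiffOn ℝ ∞ g s)
    {x : E} (hx : x ∈ s) (hinj : Function.Injective (fderiv ℝ g x)) :
    ∃ G : OpenPartialHomeomorph E E, (∀ y, G y = g y) ∧ x ∈ G.source ∧ G.source ⊆ s ∧
      ContDiffOn ℝ ∞ G.symm G.target := by
  have : CompleteSpace E := FiniteDimensional.complete ℝ E
  have hgx : ContDiffAt ℝ ∞ g x := hg.contDiffAt (hs.mem_nhds hx)
  set L : E ≃L[ℝ] E :=
    (LinearEquiv.ofInjectiveEndo (fderiv ℝ g x).toLinearMap hinj).toContinuousLinearEquiv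
  have hL : (L : E →L[ℝ] E) = fderiv ℝ g x := by ext; rfl
  have hd : HasFDerivAt g (L : E →L[ℝ] E) x := by
    rw [hL]; exact (hgx.differentiableAt (by simp)).hasFDerivAt
  set s' := s ∩ fderiv ℝ g ⁻¹' Set.range ((↑) : (E ≃L[ℝ] E) → E →L[ℝ] E)
  have hs' : IsOpen s' :=
    (hg.continuousOn_fderiv_of_isOpen hs (by simp)).isOpen_inter_preimage hs
      ContinuousLinearEquiv.isOpen
  refine ⟨(hgx.toOpenPartialHomeomorph g hd (by simp)).restrOpen s' hs', fun y => rfl,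
    ⟨hgx.mem_toOpenPartialHomeomorph_source hd (by simp), hx, L, hL⟩, fun y hy => hy.2.1, ?_⟩
  intro y hy
  set G := (hgx.toOpenPartialHomeomorph g hd (by simp)).restrOpen s' hs'
  have hy' : G.symm y ∈ s' := (G.map_target hy).2
  obtain ⟨L', hL'⟩ := hy'.2
  have c := hg.contDiffAt (hs.mem_nhds hy'.1)
  refine (G.contDiffAt_symm hy (f₀' := L') ?_ c).contDiffWithinAt
  rw [hL']
  exact (c.differentiableAt (by simp)).hasFDerivAt

namespace LocalSubmersion

variable {m l : ℝ} {O : TopologicalSpace.Opens (EuclideanSpace ℝ (Fin 3))}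
  {T : TopologicalSpace.Opens (EuclideanSpace ℝ (Fin 2))}
  {f : EuclideanSpace ℝ (Fin 3) → EuclideanSpace ℝ (Fin 2)}
  {H : EuclideanSpace ℝ (Fin 2) → Matrix (Fin 2) (Fin 2) ℝ}

/-- Near a point, the metric of the target is the pull-back of the Euclidean metric under a map to
the plane. -/
lemma exists_developing_map (h : LocalSubmersion m l O T f H)
    (hb : ∀ p ∈ O, bitension (bcvMetric m l) H f p = 0)
    (hz : ∀ p ∈ O, fderiv ℝ f p (EuclideanSpace.single 2 1) ≠ 0)
    (hT : ∀ p ∈ O, tension (bcvMetric m l) H f p ≠ 0) {p : EuclideanSpace ℝ (Fin 3)}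
    (hp : p ∈ O) :
    ∃ U : EuclideanSpace ℝ (Fin 3) → EuclideanSpace ℝ (Fin 2), ∃ s : Set _, IsOpen s ∧ p ∈ s ∧
      s ⊆ O ∧ ContDiffOn ℝ ∞ U s ∧ ∀ q ∈ s, ∀ v w, pairing H (f q) (fderiv ℝ f q v)
        (fderiv ℝ f q w) = ∑ k, fderiv ℝ U q v k * fderiv ℝ U q w k := by
  obtain ⟨θ, hθ, hH⟩ := h.exists_closed_forms hb hz hT
  obtain ⟨r, hr, hball⟩ := Metric.isOpen_iff.1 O.2 p hp
  choose U hU hU' using fun k => exists_primitive (hθ k) hball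
  have hsm : ContDiffOn ℝ ∞ (fun q => (WithLp.toLp 2 fun k => U k q : EuclideanSpace ℝ (Fin 2)))
      (Metric.ball p r) := contDiffOn_euclidean.2 hU
  refine ⟨_, Metric.ball p r, Metric.isOpen_ball, Metric.mem_ball_self hr, hball, hsm,
    fun q hq v w => ?_⟩
  have hcoord : ∀ v k, fderiv ℝ
      (fun q => (WithLp.toLp 2 fun k => U k q : EuclideanSpace ℝ (Fin 2))) q v k =
        ∑ i, eval ⟨q, hball hq⟩ (θ k i) * v i := by
    intro v k
    have hdq := ((hsm.contDiffAt (Metric.isOpen_ball.mem_nhds hq)).differentiableAt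
      (by simp)).hasFDerivAt
    obtain ⟨L, hL, hLv⟩ := hU' k ⟨q, hball hq⟩ hq
    have := ((EuclideanSpace.proj (𝕜 := ℝ) k).hasFDerivAt.comp q hdq).unique hL
    rw [← hLv, ← this]
    rfl
  rw [hH ⟨q, hball hq⟩]
  simp only [hcoord]

end LocalSubmersion

namespace LocalSubmersion

variable {m l : ℝ} {O : TopologicalSpace.Opens (EuclideanSpace ℝ (Fin 3))}
  {T : TopologicalSpace.Opens (EuclideanSpace ℝ (Fin 2))}
  {f : EuclideanSpace ℝ (Fin 3) → EuclideanSpace ℝ (Fin 2)}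
  {H : EuclideanSpace ℝ (Fin 2) → Matrix (Fin 2) (Fin 2) ℝ}

/-- A vector orthogonal to all vectors vanishes. -/
lemma _root_.BCV.eq_zero_of_pairing {y : EuclideanSpace ℝ (Fin 2)} (hdet : (H y).det ≠ 0)
    {v : EuclideanSpace ℝ (Fin 2)} (hv : ∀ w : EuclideanSpace ℝ (Fin 2), pairing H y v w = 0) :
    v = 0 := by
  have h0 : Matrix.vecMul v.ofLp (H y) = 0 := by
    ext β
    have := hv (EuclideanSpace.single β 1)
    simp only [pairing] at this
    simp only [Matrix.vecMul, dotProduct, Pi.zero_apply]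
    rw [← this]
    refine Finset.sum_congr rfl fun α _ => ?_
    rw [Finset.sum_eq_single β]
    · simp; ring
    · intro b _ hb
      simp [hb]
    · simp
  have := Matrix.eq_zero_of_vecMul_eq_zero hdet h0
  ext i
  exact congrFun this i

/-- Where the tension field of a biharmonic Riemannian submersion does not vanish, the target has
flat coordinates: if `S` is an affine section of the submersion `f` and `U` is the developing map,
then `U ∘ S ∘ (f ∘ S)⁻¹` is a local isometry to the plane. -/
lemma exists_flat_chart (h : LocalSubmersion m l O T f H)
    (hb : ∀ p ∈ O, bitension (bcvMetric m l) H f p = 0)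
    (hz : ∀ p ∈ O, fderiv ℝ f p (EuclideanSpace.single 2 1) ≠ 0)
    (hT : ∀ p ∈ O, tension (bcvMetric m l) H f p ≠ 0) {p : EuclideanSpace ℝ (Fin 3)}
    (hp : p ∈ O) :
    ∃ κ : OpenPartialHomeomorph (EuclideanSpace ℝ (Fin 2)) (EuclideanSpace ℝ (Fin 2)),
      f p ∈ κ.source ∧ κ.source ⊆ T ∧ ContDiffOn ℝ ∞ κ κ.source ∧
      ContDiffOn ℝ ∞ κ.symm κ.target ∧ ∀ y ∈ κ.target, ∀ v w : EuclideanSpace ℝ (Fin 2),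
        pairing H (κ.symm y) (fderiv ℝ κ.symm y v) (fderiv ℝ κ.symm y w) = ∑ k, v k * w k := by
  obtain ⟨U, s, hs, hps, hsO, hU, hUH⟩ := h.exists_developing_map hb hz hT hp
  obtain ⟨R, hR⟩ := (fderiv ℝ f p).exists_rightInverse_of_surjective
    (LinearMap.range_eq_top.2 (h.surjective p hp))
  have hR' : ∀ v, fderiv ℝ f p (R v) = v := fun v => congrArg (fun L => L v) hR
  obtain ⟨S, hSdef⟩ : ∃ S : EuclideanSpace ℝ (Fin 2) → EuclideanSpace ℝ (Fin 3),
      S = fun y => p + R y := ⟨_, rfl⟩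
  have hSsm : ContDiff ℝ ∞ S := by rw [hSdef]; exact contDiff_const.add R.contDiff
  have hSd : ∀ y, HasFDerivAt S R y := fun y => by
    rw [hSdef]; exact R.hasFDerivAt.const_add p
  have hS0 : S 0 = p := by rw [hSdef]; simp
  set s₂ := S ⁻¹' s
  have hs₂ : IsOpen s₂ := hs.preimage hSsm.continuous
  have h0 : (0 : EuclideanSpace ℝ (Fin 2)) ∈ s₂ := by
    change S 0 ∈ s
    rwa [hS0]
  have hg₁ : ContDiffOn ℝ ∞ (f ∘ S) s₂ :=
    h.smooth.comp hSsm.contDiffOn fun y hy => hsO hy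
  have hg₂ : ContDiffOn ℝ ∞ (U ∘ S) s₂ := hU.comp hSsm.contDiffOn fun y hy => hy
  have hd₁ : ∀ y ∈ s₂, HasFDerivAt (f ∘ S) ((fderiv ℝ f (S y)).comp R) y := fun y hy =>
    (h.differentiableAt ⟨S y, hsO hy⟩).hasFDerivAt.comp y (hSd y)
  have hd₂ : ∀ y ∈ s₂, HasFDerivAt (U ∘ S) ((fderiv ℝ U (S y)).comp R) y := fun y hy =>
    ((hU.contDiffAt (hs.mem_nhds hy)).differentiableAt (by simp)).hasFDerivAt.comp y (hSd y)
  have hi₁ : Function.Injective (fderiv ℝ (f ∘ S) 0) := by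
    rw [(hd₁ 0 h0).fderiv, hS0, hR]
    exact fun v w h => h
  have hi₂ : Function.Injective (fderiv ℝ (U ∘ S) 0) := by
    rw [(hd₂ 0 h0).fderiv, hS0]
    refine (injective_iff_map_eq_zero _).2 fun v hv => ?_
    refine eq_zero_of_pairing (H := H) (h.metric_det _ (h.mapsTo hp)) fun w => ?_
    have := hUH p hps (R v) (R w)
    rw [hR', hR'] at this
    rw [this]
    have hv' : fderiv ℝ U p (R v) = 0 := hv
    simp [hv']
  obtain ⟨G₁, hG₁, h0₁, hss₁, hsm₁⟩ := exists_local_diffeomorphism hs₂ hg₁ h0 hi₁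
  obtain ⟨G₂, hG₂, h0₂, hss₂, hsm₂⟩ := exists_local_diffeomorphism hs₂ hg₂ h0 hi₂
  have e₁ : (G₁ : _ → _) = f ∘ S := funext hG₁
  have e₂ : (G₂ : _ → _) = U ∘ S := funext hG₂
  have hp0 : f p = G₁ 0 := by rw [hG₁, Function.comp_apply, hS0]
  refine ⟨G₁.symm.trans G₂, ?_, ?_, ?_, ?_, ?_⟩
  · rw [hp0]
    refine ⟨G₁.map_source h0₁, ?_⟩
    change G₁.symm (G₁ 0) ∈ G₂.source
    rwa [G₁.left_inv h0₁]
  · intro y hy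
    have hy1 : y ∈ G₁.target := hy.1
    rw [← G₁.right_inv hy1, e₁]
    exact h.mapsTo (hsO (hss₁ (G₁.map_target hy1)))
  · rw [OpenPartialHomeomorph.coe_trans, e₂]
    refine hg₂.comp (hsm₁.mono fun y hy => hy.1) fun y hy => hss₂ hy.2
  · rw [OpenPartialHomeomorph.coe_trans_symm, OpenPartialHomeomorph.symm_symm, e₁]
    refine hg₁.comp (hsm₂.mono fun y hy => hy.1) fun y hy => hss₂ (G₂.map_target hy.1)
  · intro y hy v w
    have hy2 : y ∈ G₂.target := hy.1
    have hz2 : G₂.symm y ∈ s₂ := hss₂ (G₂.map_target hy2)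
    have hd : HasFDerivAt G₂.symm (fderiv ℝ G₂.symm y) y :=
      ((hsm₂.contDiffAt (G₂.open_target.mem_nhds hy2)).differentiableAt (by simp)).hasFDerivAt
    have k1 : fderiv ℝ (G₁.symm.trans G₂).symm y =
        ((fderiv ℝ f (S (G₂.symm y))).comp R).comp (fderiv ℝ G₂.symm y) := by
      rw [OpenPartialHomeomorph.coe_trans_symm, OpenPartialHomeomorph.symm_symm, e₁]
      exact ((hd₁ _ hz2).comp y hd).fderiv
    have k2 : ((fderiv ℝ U (S (G₂.symm y))).comp R).comp (fderiv ℝ G₂.symm y) =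
        ContinuousLinearMap.id ℝ _ := by
      refine ((hd₂ _ hz2).comp y hd).unique ((hasFDerivAt_id y).congr_of_eventuallyEq ?_)
      filter_upwards [G₂.open_target.mem_nhds hy2] with x hx
      rw [← e₂]
      exact G₂.right_inv hx
    have k3 : (G₁.symm.trans G₂).symm y = f (S (G₂.symm y)) := by
      rw [OpenPartialHomeomorph.coe_trans_symm, OpenPartialHomeomorph.symm_symm, e₁]
      rfl
    have k2' : ∀ v, fderiv ℝ U (S (G₂.symm y)) (R (fderiv ℝ G₂.symm y v)) = v := fun v =>
      congrArg (fun L => L v) k2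
    rw [k1, k3]
    have := hUH _ hz2 (R (fderiv ℝ G₂.symm y v)) (R (fderiv ℝ G₂.symm y w))
    rw [k2', k2'] at this
    exact this

end LocalSubmersion

/-! ### Riemannian submersions in charts -/

lemma mfderiv_chart_symm_comp {N : Type*} [TopologicalSpace N]
    [ChartedSpace (EuclideanSpace ℝ (Fin 2)) N]
    {φ : OpenPartialHomeomorph N (EuclideanSpace ℝ (Fin 2))}
    (hφ : φ ∈ IsManifold.maximalAtlas 𝓘(ℝ, EuclideanSpace ℝ (Fin 2)) ∞ N)
    {y : EuclideanSpace ℝ (Fin 2)} (hy : y ∈ φ.target) (v : EuclideanSpace ℝ (Fin 2)) :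
    mfderiv 𝓘(ℝ, EuclideanSpace ℝ (Fin 2)) 𝓘(ℝ, EuclideanSpace ℝ (Fin 2)) φ (φ.symm y)
      (mfderiv 𝓘(ℝ, EuclideanSpace ℝ (Fin 2)) 𝓘(ℝ, EuclideanSpace ℝ (Fin 2)) φ.symm y v) = v ∧
    mfderiv 𝓘(ℝ, EuclideanSpace ℝ (Fin 2)) 𝓘(ℝ, EuclideanSpace ℝ (Fin 2)) φ.symm y
      (mfderiv 𝓘(ℝ, EuclideanSpace ℝ (Fin 2)) 𝓘(ℝ, EuclideanSpace ℝ (Fin 2)) φ (φ.symm y) v) =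
      v := by
  have h1 : MDifferentiableAt 𝓘(ℝ, EuclideanSpace ℝ (Fin 2)) 𝓘(ℝ, EuclideanSpace ℝ (Fin 2))
      φ.symm y := (contMDiffAt_symm_of_mem_maximalAtlas hφ hy).mdifferentiableAt (by simp)
  have h2 : MDifferentiableAt 𝓘(ℝ, EuclideanSpace ℝ (Fin 2)) 𝓘(ℝ, EuclideanSpace ℝ (Fin 2))
      φ (φ.symm y) :=
    (contMDiffAt_of_mem_maximalAtlas hφ (φ.map_target hy)).mdifferentiableAt (by simp)
  have h1' : MDifferentiableAt 𝓘(ℝ, EuclideanSpace ℝ (Fin 2)) 𝓘(ℝ, EuclideanSpace ℝ (Fin 2))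
      φ.symm (φ (φ.symm y)) := by rwa [φ.right_inv hy]
  constructor
  · have e : (φ ∘ φ.symm) =ᶠ[nhds y] id := by
      filter_upwards [φ.open_target.mem_nhds hy] with z hz using φ.right_inv hz
    have k := mfderiv_comp y h2 h1
    rw [e.mfderiv_eq, mfderiv_id] at k
    exact (congrArg (fun L => L v) k).symm
  · have e : (φ.symm ∘ φ) =ᶠ[nhds (φ.symm y)] id := by
      filter_upwards [φ.open_source.mem_nhds (φ.map_target hy)] with z hz using φ.left_inv hz
    have k := mfderiv_comp (φ.symm y) h1' h2
    rw [e.mfderiv_eq, mfderiv_id] at k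
    rw [φ.right_inv hy] at k
    exact (congrArg (fun L => L v) k).symm

section Chart

variable {N : Type*} [TopologicalSpace N] [ChartedSpace (EuclideanSpace ℝ (Fin 2)) N]
  [IsManifold 𝓘(ℝ, EuclideanSpace ℝ (Fin 2)) ∞ N]
  {h : Bundle.ContMDiffRiemannianMetric 𝓘(ℝ, EuclideanSpace ℝ (Fin 2)) ∞
      (EuclideanSpace ℝ (Fin 2))
      (fun x : N => TangentSpace 𝓘(ℝ, EuclideanSpace ℝ (Fin 2)) x)}
  {φ : OpenPartialHomeomorph N (EuclideanSpace ℝ (Fin 2))}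

lemma contDiffOn_chartMetric
    (hφ : φ ∈ IsManifold.maximalAtlas 𝓘(ℝ, EuclideanSpace ℝ (Fin 2)) ∞ N) (i j : Fin 2) :
    ContDiffOn ℝ ∞ (fun y => chartMetric h φ y i j) φ.target := by
  have hs := contMDiffOn_symm_of_mem_maximalAtlas hφ
  have hU : UniqueMDiffOn 𝓘(ℝ, EuclideanSpace ℝ (Fin 2)) φ.target := φ.open_target.uniqueMDiffOn
  have ht := hs.contMDiffOn_tangentMapWithin (m := ∞) le_rfl hU
  have hc : ∀ i : Fin 2, ContMDiffOn 𝓘(ℝ, EuclideanSpace ℝ (Fin 2))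
      𝓘(ℝ, EuclideanSpace ℝ (Fin 2)).tangent ∞
      (fun y : EuclideanSpace ℝ (Fin 2) =>
        (⟨y, (EuclideanSpace.single i (1 : ℝ) : EuclideanSpace ℝ (Fin 2))⟩ :
          TangentBundle 𝓘(ℝ, EuclideanSpace ℝ (Fin 2)) (EuclideanSpace ℝ (Fin 2)))) φ.target :=
    fun i => contMDiffOn_vectorSpace_iff_contDiffOn.2 contDiffOn_const
  have hv : ∀ i : Fin 2, ContMDiffOn 𝓘(ℝ, EuclideanSpace ℝ (Fin 2))
      𝓘(ℝ, EuclideanSpace ℝ (Fin 2)).tangent ∞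
      (fun y : EuclideanSpace ℝ (Fin 2) => (⟨φ.symm y,
        mfderiv 𝓘(ℝ, EuclideanSpace ℝ (Fin 2)) 𝓘(ℝ, EuclideanSpace ℝ (Fin 2)) φ.symm y
        (EuclideanSpace.single i (1 : ℝ) : EuclideanSpace ℝ (Fin 2))⟩ :
          TangentBundle 𝓘(ℝ, EuclideanSpace ℝ (Fin 2)) N)) φ.target := fun i => by
    refine (ht.comp (hc i) fun y hy => hy).congr fun y hy => ?_
    simp only [Function.comp_apply, tangentMapWithin]
    rw [mfderivWithin_of_isOpen φ.open_target hy]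
  have key := ContMDiffOn.clm_bundle_apply₂ (E₃ := fun _ : N => ℝ)
    (h.contMDiff.comp_contMDiffOn hs) (hv i) (hv j)
  intro y hy
  have k := key y hy
  rw [Bundle.contMDiffWithinAt_totalSpace] at k
  exact k.2.contDiffWithinAt

lemma inner_eq_pairing (y v w : EuclideanSpace ℝ (Fin 2)) : h.inner (φ.symm y)
      (mfderiv 𝓘(ℝ, EuclideanSpace ℝ (Fin 2)) 𝓘(ℝ, EuclideanSpace ℝ (Fin 2)) φ.symm y v)
      (mfderiv 𝓘(ℝ, EuclideanSpace ℝ (Fin 2)) 𝓘(ℝ, EuclideanSpace ℝ (Fin 2)) φ.symm y w) =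
    pairing (chartMetric h φ) y v w := by
  obtain ⟨B, hB⟩ : ∃ B : EuclideanSpace ℝ (Fin 2) →L[ℝ] EuclideanSpace ℝ (Fin 2) →L[ℝ] ℝ,
      B = h.inner (φ.symm y) := ⟨_, rfl⟩
  obtain ⟨D, hD⟩ : ∃ D : EuclideanSpace ℝ (Fin 2) →L[ℝ] EuclideanSpace ℝ (Fin 2),
      D = mfderiv 𝓘(ℝ, EuclideanSpace ℝ (Fin 2)) 𝓘(ℝ, EuclideanSpace ℝ (Fin 2)) φ.symm y :=
    ⟨_, rfl⟩
  have hm : ∀ i j, chartMetric h φ y i j =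
      B (D (EuclideanSpace.single i 1)) (D (EuclideanSpace.single j 1)) := by
    intro i j; rw [hB, hD]; rfl
  suffices B (D v) (D w) = pairing (chartMetric h φ) y v w by
    rw [← this, hB, hD]; rfl
  have hv : ∀ v : EuclideanSpace ℝ (Fin 2), v = ∑ i, v i • EuclideanSpace.single i (1 : ℝ) := by
    intro v
    ext j
    fin_cases j <;> simp
  conv_lhs => rw [hv v, hv w]
  simp only [pairing, hm, map_sum, map_smul, sum_apply, smul_apply, smul_eq_mul]
  rw [Finset.sum_comm]
  simp only [Finset.mul_sum]
  refine Finset.sum_congr rfl fun i _ => Finset.sum_congr rfl fun j _ => ?_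
  ring

lemma chartMetric_symm (y : EuclideanSpace ℝ (Fin 2)) (i j : Fin 2) :
    chartMetric h φ y i j = chartMetric h φ y j i := h.symm _ _ _

lemma det_chartMetric_ne_zero
    (hφ : φ ∈ IsManifold.maximalAtlas 𝓘(ℝ, EuclideanSpace ℝ (Fin 2)) ∞ N)
    {y : EuclideanSpace ℝ (Fin 2)} (hy : y ∈ φ.target) : (chartMetric h φ y).det ≠ 0 := by
  intro h0
  obtain ⟨v, hv0, hv⟩ := Matrix.exists_mulVec_eq_zero_iff.2 h0
  have k := inner_eq_pairing (h := h) (φ := φ) y (WithLp.toLp 2 v) (WithLp.toLp 2 v)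
  have k0 : pairing (chartMetric h φ) y v v = 0 := by
    have := congrArg (fun w => v ⬝ᵥ w) hv
    simp only [Matrix.mulVec, dotProduct, Finset.mul_sum, Pi.zero_apply, mul_zero,
      Finset.sum_const_zero] at this
    rw [← this, pairing]
    refine Finset.sum_congr rfl fun i _ => Finset.sum_congr rfl fun j _ => ?_
    ring
  rw [k0] at k
  by_cases hd : mfderiv 𝓘(ℝ, EuclideanSpace ℝ (Fin 2)) 𝓘(ℝ, EuclideanSpace ℝ (Fin 2)) φ.symm y
      (WithLp.toLp 2 v : EuclideanSpace ℝ (Fin 2)) = 0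
  · have := (mfderiv_chart_symm_comp hφ hy (WithLp.toLp 2 v)).1
    rw [hd, map_zero] at this
    exact hv0 (congrArg (fun w : EuclideanSpace ℝ (Fin 2) => w.ofLp) this.symm)
  · exact (h.pos _ _ hd).ne' k

lemma inner_eq_pairing_chart
    (hφ : φ ∈ IsManifold.maximalAtlas 𝓘(ℝ, EuclideanSpace ℝ (Fin 2)) ∞ N)
    {q : N} (hq : q ∈ φ.source) (v w : EuclideanSpace ℝ (Fin 2))
    {v' w' : EuclideanSpace ℝ (Fin 2)}
    (hv : mfderiv 𝓘(ℝ, EuclideanSpace ℝ (Fin 2)) 𝓘(ℝ, EuclideanSpace ℝ (Fin 2)) φ q v = v')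
    (hw : mfderiv 𝓘(ℝ, EuclideanSpace ℝ (Fin 2)) 𝓘(ℝ, EuclideanSpace ℝ (Fin 2)) φ q w = w') :
    h.inner q v w = pairing (chartMetric h φ) (φ q) v' w' := by
  obtain ⟨y, hy, rfl⟩ : ∃ y ∈ φ.target, q = φ.symm y :=
    ⟨φ q, φ.map_source hq, (φ.left_inv hq).symm⟩
  rw [φ.right_inv hy, ← inner_eq_pairing, ← hv, ← hw]
  have kv := (mfderiv_chart_symm_comp hφ hy v).2
  have kw := (mfderiv_chart_symm_comp hφ hy w).2
  exact (congrArg₂ (fun a b => h.inner (φ.symm y) a b) kv kw).symm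

lemma isOpen_bcvDomain (m : ℝ) : IsOpen (bcvDomain m) := by
  have : Continuous (bcvF m) := by unfold bcvF; fun_prop
  exact isOpen_lt continuous_const this

variable {m l : ℝ} {π : EuclideanSpace ℝ (Fin 3) → N}

/-- The part of the BCV space over the domain of a chart. -/
def chartDomain (hπ : IsRiemannianSubmersion (bcvDomain m) (bcvMetric m l) h π)
    (φ : OpenPartialHomeomorph N (EuclideanSpace ℝ (Fin 2))) :
    TopologicalSpace.Opens (EuclideanSpace ℝ (Fin 3)) where
  carrier := bcvDomain m ∩ π ⁻¹' φ.source
  is_open' := hπ.smooth.continuousOn.isOpen_inter_preimage (isOpen_bcvDomain m) φ.open_source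

lemma mdifferentiableAt_of_mem
    (hπ : IsRiemannianSubmersion (bcvDomain m) (bcvMetric m l) h π)
    {p : EuclideanSpace ℝ (Fin 3)} (hp : p ∈ bcvDomain m) :
    MDifferentiableAt 𝓘(ℝ, EuclideanSpace ℝ (Fin 3)) 𝓘(ℝ, EuclideanSpace ℝ (Fin 2)) π p :=
  (hπ.smooth.contMDiffAt ((isOpen_bcvDomain m).mem_nhds hp)).mdifferentiableAt (by simp)

lemma fderiv_chart_comp
    (hπ : IsRiemannianSubmersion (bcvDomain m) (bcvMetric m l) h π)
    (hφ : φ ∈ IsManifold.maximalAtlas 𝓘(ℝ, EuclideanSpace ℝ (Fin 2)) ∞ N)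
    {p : EuclideanSpace ℝ (Fin 3)} (hp : p ∈ chartDomain hπ φ) (v : EuclideanSpace ℝ (Fin 3)) :
    fderiv ℝ (fun x => φ (π x)) p v =
      mfderiv 𝓘(ℝ, EuclideanSpace ℝ (Fin 2)) 𝓘(ℝ, EuclideanSpace ℝ (Fin 2)) φ (π p)
        (mfderiv 𝓘(ℝ, EuclideanSpace ℝ (Fin 3)) 𝓘(ℝ, EuclideanSpace ℝ (Fin 2)) π p v) := by
  have h2 : MDifferentiableAt 𝓘(ℝ, EuclideanSpace ℝ (Fin 2)) 𝓘(ℝ, EuclideanSpace ℝ (Fin 2))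
      φ (π p) := (contMDiffAt_of_mem_maximalAtlas hφ hp.2).mdifferentiableAt (by simp)
  have k := mfderiv_comp p h2 (mdifferentiableAt_of_mem hπ hp.1)
  rw [mfderiv_eq_fderiv] at k
  exact congrArg (fun L => L v) k

lemma fderiv_chart_eq_zero
    (hπ : IsRiemannianSubmersion (bcvDomain m) (bcvMetric m l) h π)
    (hφ : φ ∈ IsManifold.maximalAtlas 𝓘(ℝ, EuclideanSpace ℝ (Fin 2)) ∞ N)
    {p : EuclideanSpace ℝ (Fin 3)} (hp : p ∈ chartDomain hπ φ) (v : EuclideanSpace ℝ (Fin 3)) :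
    fderiv ℝ (fun x => φ (π x)) p v = 0 ↔
      mfderiv 𝓘(ℝ, EuclideanSpace ℝ (Fin 3)) 𝓘(ℝ, EuclideanSpace ℝ (Fin 2)) π p v = 0 := by
  rw [fderiv_chart_comp hπ hφ hp]
  constructor
  · intro h0
    have h1 : ∀ q ∈ φ.source, ∀ w : EuclideanSpace ℝ (Fin 2), mfderiv
        𝓘(ℝ, EuclideanSpace ℝ (Fin 2)) 𝓘(ℝ, EuclideanSpace ℝ (Fin 2)) φ q w = 0 → w = 0 := by
      intro q hq w hw
      obtain ⟨y, hy, rfl⟩ : ∃ y ∈ φ.target, q = φ.symm y :=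
        ⟨φ q, φ.map_source hq, (φ.left_inv hq).symm⟩
      rw [← (mfderiv_chart_symm_comp hφ hy w).2, hw]
      exact map_zero _
    exact h1 _ hp.2 _ h0
  · intro h0
    rw [h0]
    exact map_zero _

/-- A Riemannian submersion in a chart of the target. -/
lemma localSubmersion
    (hπ : IsRiemannianSubmersion (bcvDomain m) (bcvMetric m l) h π)
    (hφ : φ ∈ IsManifold.maximalAtlas 𝓘(ℝ, EuclideanSpace ℝ (Fin 2)) ∞ N) :
    LocalSubmersion m l (chartDomain hπ φ) ⟨φ.target, φ.open_target⟩ (fun x => φ (π x))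
      (chartMetric h φ) where
  smooth := by
    rw [← contMDiffOn_iff_contDiffOn]
    exact (contMDiffOn_of_mem_maximalAtlas hφ).comp (hπ.smooth.mono fun p hp => hp.1)
      fun p hp => hp.2
  mapsTo p hp := φ.map_source hp.2
  metric_smooth α β := contDiffOn_chartMetric hφ α β
  metric_symm y _ α β := chartMetric_symm y α β
  metric_det y hy := det_chartMetric_ne_zero hφ hy
  subset p hp := hp.1
  surjective p hp w := by
    obtain ⟨v, hv⟩ := hπ.submersion p hp.1
      (mfderiv 𝓘(ℝ, EuclideanSpace ℝ (Fin 2)) 𝓘(ℝ, EuclideanSpace ℝ (Fin 2)) φ.symm (φ (π p)) w)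
    refine ⟨v, (fderiv_chart_comp hπ hφ hp v).trans ?_⟩
    have h1 : ∀ q ∈ φ.source, mfderiv
        𝓘(ℝ, EuclideanSpace ℝ (Fin 2)) 𝓘(ℝ, EuclideanSpace ℝ (Fin 2)) φ q (mfderiv
        𝓘(ℝ, EuclideanSpace ℝ (Fin 2)) 𝓘(ℝ, EuclideanSpace ℝ (Fin 2)) φ.symm (φ q) w :
          EuclideanSpace ℝ (Fin 2)) = w := by
      intro q hq
      obtain ⟨y, hy, rfl⟩ : ∃ y ∈ φ.target, q = φ.symm y :=
        ⟨φ q, φ.map_source hq, (φ.left_inv hq).symm⟩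
      rw [φ.right_inv hy]
      exact (mfderiv_chart_symm_comp hφ hy w).1
    exact (congrArg _ hv).trans (h1 _ hp.2)
  isometry p hp v w hv hw := by
    have k := hπ.isometry p hp.1 v w
      (fun u hu => hv u ((fderiv_chart_eq_zero hπ hφ hp u).2 hu))
      (fun u hu => hw u ((fderiv_chart_eq_zero hπ hφ hp u).2 hu))
    exact (inner_eq_pairing_chart hφ hp.2 _ _ (fderiv_chart_comp hπ hφ hp v).symm
      (fderiv_chart_comp hπ hφ hp w).symm).symm.trans k

end Chart

/-! ### Proper biharmonic Riemannian submersions -/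

lemma isPreconnected_bcvDomain (m : ℝ) : IsPreconnected (bcvDomain m) := by
  have hs : StarConvex ℝ 0 (bcvDomain m) := by
    intro p hp a b ha hb hab
    have hp' : 0 < 1 + m * (p 0 ^ 2 + p 1 ^ 2) := hp
    change 0 < bcvF m _
    simp only [bcvF, smul_zero, zero_add, PiLp.smul_apply, smul_eq_mul]
    have hb1 : b ≤ 1 := by linarith
    have hb2 : b ^ 2 ≤ 1 := by nlinarith
    have e : 1 + m * ((b * p 0) ^ 2 + (b * p 1) ^ 2) =
        b ^ 2 * (1 + m * (p 0 ^ 2 + p 1 ^ 2)) + (1 - b ^ 2) := by ring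
    rw [e]
    rcases hb2.lt_or_eq with h | h
    · have := mul_nonneg (sq_nonneg b) hp'.le
      linarith
    · rw [h]; linarith
  have h0 : (0 : EuclideanSpace ℝ (Fin 3)) ∈ bcvDomain m := by simp [bcvDomain, bcvF]
  exact (StarConvex.isPathConnected hs h0).isConnected.isPreconnected

section Global

variable {N : Type*} [TopologicalSpace N] [ChartedSpace (EuclideanSpace ℝ (Fin 2)) N]
  [IsManifold 𝓘(ℝ, EuclideanSpace ℝ (Fin 2)) ∞ N]
  {h : Bundle.ContMDiffRiemannianMetric 𝓘(ℝ, EuclideanSpace ℝ (Fin 2)) ∞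
      (EuclideanSpace ℝ (Fin 2))
      (fun x : N => TangentSpace 𝓘(ℝ, EuclideanSpace ℝ (Fin 2)) x)}
  {m l : ℝ} {π : EuclideanSpace ℝ (Fin 3) → N}

lemma tension_chart_eq_zero
    (hπ : IsRiemannianSubmersion (bcvDomain m) (bcvMetric m l) h π)
    {φ ψ : OpenPartialHomeomorph N (EuclideanSpace ℝ (Fin 2))}
    (hφ : φ ∈ IsManifold.maximalAtlas 𝓘(ℝ, EuclideanSpace ℝ (Fin 2)) ∞ N)
    (hψ : ψ ∈ IsManifold.maximalAtlas 𝓘(ℝ, EuclideanSpace ℝ (Fin 2)) ∞ N)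
    {p : EuclideanSpace ℝ (Fin 3)} (hpφ : p ∈ chartDomain hπ φ) (hpψ : p ∈ chartDomain hπ ψ)
    (hz : mfderiv 𝓘(ℝ, EuclideanSpace ℝ (Fin 3)) 𝓘(ℝ, EuclideanSpace ℝ (Fin 2)) π p
      (EuclideanSpace.single 2 1 : EuclideanSpace ℝ (Fin 3)) ≠ 0)
    (hT : tension (bcvMetric m l) (chartMetric h φ) (fun x => φ (π x)) p = 0) :
    tension (bcvMetric m l) (chartMetric h ψ) (fun x => ψ (π x)) p = 0 := by
  have k1 := (localSubmersion hπ hφ).mono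
    (inf_le_left : chartDomain hπ φ ⊓ chartDomain hπ ψ ≤ chartDomain hπ φ)
  have k2 := (localSubmersion hπ hψ).mono
    (inf_le_right : chartDomain hπ φ ⊓ chartDomain hπ ψ ≤ chartDomain hπ ψ)
  refine k1.tension_eq_zero_of_ker_le k2 (fun q hq v hv => ?_) ⟨hpφ, hpψ⟩ (fun h0 => hz ?_) hT
  · exact (fderiv_chart_eq_zero hπ hψ hq.2 v).2 ((fderiv_chart_eq_zero hπ hφ hq.1 v).1 hv)
  · exact (fderiv_chart_eq_zero hπ hφ hpφ _).1 h0

/-- The set of points where the Killing field `∂_z` is not vertical and the tension field does not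
vanish. -/
def properSet (h : Bundle.ContMDiffRiemannianMetric 𝓘(ℝ, EuclideanSpace ℝ (Fin 2)) ∞
      (EuclideanSpace ℝ (Fin 2))
      (fun x : N => TangentSpace 𝓘(ℝ, EuclideanSpace ℝ (Fin 2)) x)) (m l : ℝ)
    (π : EuclideanSpace ℝ (Fin 3) → N) : Set (EuclideanSpace ℝ (Fin 3)) :=
  {p | p ∈ bcvDomain m ∧
    mfderiv 𝓘(ℝ, EuclideanSpace ℝ (Fin 3)) 𝓘(ℝ, EuclideanSpace ℝ (Fin 2)) π p
      (EuclideanSpace.single 2 1 : EuclideanSpace ℝ (Fin 3)) ≠ 0 ∧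
    ∀ φ ∈ atlas (EuclideanSpace ℝ (Fin 2)) N, π p ∈ φ.source →
      tension (bcvMetric m l) (chartMetric h φ) (fun x => φ (π x)) p ≠ 0}

lemma mem_properSet (hπ : IsRiemannianSubmersion (bcvDomain m) (bcvMetric m l) h π)
    {φ : OpenPartialHomeomorph N (EuclideanSpace ℝ (Fin 2))}
    (hφ : φ ∈ atlas (EuclideanSpace ℝ (Fin 2)) N) {p : EuclideanSpace ℝ (Fin 3)}
    (hp : p ∈ chartDomain hπ φ)
    (hz : fderiv ℝ (fun x => φ (π x)) p (EuclideanSpace.single 2 1) ≠ 0)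
    (hT : tension (bcvMetric m l) (chartMetric h φ) (fun x => φ (π x)) p ≠ 0) :
    p ∈ properSet h m l π := by
  have hφ' := IsManifold.subset_maximalAtlas (I := 𝓘(ℝ, EuclideanSpace ℝ (Fin 2))) (n := ∞) hφ
  have hz' := fun h0 => hz ((fderiv_chart_eq_zero hπ hφ' hp _).2 h0)
  exact ⟨hp.1, hz', fun ψ hψ hpψ h0 => hT (tension_chart_eq_zero hπ
    (IsManifold.subset_maximalAtlas hψ) hφ' ⟨hp.1, hpψ⟩ hp hz' h0)⟩

lemma isOpen_properSet (hπ : IsRiemannianSubmersion (bcvDomain m) (bcvMetric m l) h π) :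
    IsOpen (properSet h m l π) := by
  refine isOpen_iff_mem_nhds.2 fun p hp => ?_
  have hφ := chart_mem_atlas (EuclideanSpace ℝ (Fin 2)) (π p)
  have hφ' := IsManifold.subset_maximalAtlas (I := 𝓘(ℝ, EuclideanSpace ℝ (Fin 2))) (n := ∞) hφ
  have hpO : p ∈ chartDomain hπ (chartAt (EuclideanSpace ℝ (Fin 2)) (π p)) :=
    ⟨hp.1, mem_chart_source _ _⟩
  have k := localSubmersion hπ hφ'
  have hps : p ∈ k.slanted :=
    ⟨hpO, fun h0 => hp.2.1 ((fderiv_chart_eq_zero hπ hφ' hpO _).1 h0)⟩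
  have hc := k.continuousOn_tension.continuousAt (k.slanted_le.trans le_rfl |> fun _ =>
    (chartDomain hπ (chartAt (EuclideanSpace ℝ (Fin 2)) (π p))).2.mem_nhds hpO)
  filter_upwards [k.slanted.2.mem_nhds hps, hc.eventually_ne (hp.2.2 _ hφ (mem_chart_source _ _))]
    with q hq hT
  exact mem_properSet hπ hφ hq.1 hq.2 hT

lemma nonempty_properSet (hπ : IsRiemannianSubmersion (bcvDomain m) (bcvMetric m l) h π)
    (hh : ¬ IsHarmonic (bcvDomain m) (bcvMetric m l) h π) : (properSet h m l π).Nonempty := by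
  simp only [IsHarmonic, not_forall] at hh
  obtain ⟨φ, hφ, p, hp, hpφ, hT⟩ := hh
  have hφ' := IsManifold.subset_maximalAtlas (I := 𝓘(ℝ, EuclideanSpace ℝ (Fin 2))) (n := ∞) hφ
  have k := localSubmersion hπ hφ'
  set O' : TopologicalSpace.Opens (EuclideanSpace ℝ (Fin 3)) :=
    ⟨chartDomain hπ φ ∩ tension (bcvMetric m l) (chartMetric h φ) (fun x => φ (π x)) ⁻¹' {0}ᶜ,
      k.continuousOn_tension.isOpen_inter_preimage (chartDomain hπ φ).2 isOpen_ne⟩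
  by_contra hne
  rw [Set.not_nonempty_iff_eq_empty] at hne
  refine hT ((k.mono (O' := O') fun q hq => hq.1).tension_eq_zero_of_vertical (fun q hq => ?_)
    ⟨⟨hp, hpφ⟩, hT⟩)
  by_contra hz
  have : q ∈ properSet h m l π := mem_properSet hπ hφ hq.1 hz hq.2
  rw [hne] at this
  exact this

lemma closure_properSet (hπ : IsRiemannianSubmersion (bcvDomain m) (bcvMetric m l) h π)
    (hb : IsBiharmonic (bcvDomain m) (bcvMetric m l) h π) :
    closure (properSet h m l π) ∩ bcvDomain m ⊆ properSet h m l π := by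
  rintro p ⟨hpc, hp⟩
  have hφ := chart_mem_atlas (EuclideanSpace ℝ (Fin 2)) (π p)
  set φ := chartAt (EuclideanSpace ℝ (Fin 2)) (π p)
  have hφ' := IsManifold.subset_maximalAtlas (I := 𝓘(ℝ, EuclideanSpace ℝ (Fin 2))) (n := ∞) hφ
  have hpO : p ∈ chartDomain hπ φ := ⟨hp, mem_chart_source _ _⟩
  have hO := (chartDomain hπ φ).2.mem_nhds hpO
  have k := localSubmersion hπ hφ'
  have hev : ∃ᶠ q in nhds p, m < 0 ∧ pairing (chartMetric h φ) (φ (π q))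
        (tension (bcvMetric m l) (chartMetric h φ) (fun x => φ (π x)) q)
        (tension (bcvMetric m l) (chartMetric h φ) (fun x => φ (π x)) q) = -4 * m ∧
      (4 * m - l ^ 2) * pairing (chartMetric h φ) (φ (π q))
        (fderiv ℝ (fun x => φ (π x)) q (EuclideanSpace.single 2 1))
        (fderiv ℝ (fun x => φ (π x)) q (EuclideanSpace.single 2 1)) = 4 * m := by
    refine ((mem_closure_iff_frequently.1 hpc).and_eventually hO).mono fun q hq => ?_
    obtain ⟨hq, hqO⟩ := hq
    exact k.norms_of_ne_zero (fun r hr => hb φ hφ r hr.1 hr.2) hqO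
      (fun h0 => hq.2.1 ((fderiv_chart_eq_zero hπ hφ' hqO _).1 h0)) (hq.2.2 φ hφ hqO.2)
  obtain ⟨-, hm, -, -⟩ := hev.exists
  have c1 := isClosed_singleton.mem_of_frequently_of_tendsto (hev.mono fun q hq => hq.2.1)
    (k.continuousOn_norm_tension.continuousAt hO)
  have c2 := isClosed_singleton.mem_of_frequently_of_tendsto (hev.mono fun q hq => hq.2.2)
    ((k.continuousOn_norm_vertical.continuousAt hO).const_mul (4 * m - l ^ 2))
  refine mem_properSet hπ hφ hpO (fun h0 => ?_) (fun h0 => ?_)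
  · have : (4 * m - l ^ 2) * pairing (chartMetric h φ) (φ (π p))
        (fderiv ℝ (fun x => φ (π x)) p (EuclideanSpace.single 2 1))
        (fderiv ℝ (fun x => φ (π x)) p (EuclideanSpace.single 2 1)) = 4 * m := c2
    rw [h0] at this
    simp [pairing] at this
    linarith
  · have : pairing (chartMetric h φ) (φ (π p))
        (tension (bcvMetric m l) (chartMetric h φ) (fun x => φ (π x)) p)
        (tension (bcvMetric m l) (chartMetric h φ) (fun x => φ (π x)) p) = -4 * m := c1
    rw [h0] at this
    simp [pairing] at this
    linarith

/-- For a proper biharmonic Riemannian submersion, the tension field vanishes nowhere and `∂_z` is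
nowhere vertical. -/
lemma bcvDomain_subset_properSet
    (hπ : IsRiemannianSubmersion (bcvDomain m) (bcvMetric m l) h π)
    (hb : IsProperBiharmonic (bcvDomain m) (bcvMetric m l) h π) :
    bcvDomain m ⊆ properSet h m l π := by
  obtain ⟨p, hp⟩ := nonempty_properSet hπ hb.2
  exact (isPreconnected_bcvDomain m).subset_of_closure_inter_subset (isOpen_properSet hπ)
    ⟨p, hp.1, hp⟩ (closure_properSet hπ hb.1)

lemma neg_of_isProperBiharmonic
    (hπ : IsRiemannianSubmersion (bcvDomain m) (bcvMetric m l) h π)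
    (hb : IsProperBiharmonic (bcvDomain m) (bcvMetric m l) h π) : m < 0 := by
  obtain ⟨p, hp⟩ := nonempty_properSet hπ hb.2
  have hφ := chart_mem_atlas (EuclideanSpace ℝ (Fin 2)) (π p)
  have hφ' := IsManifold.subset_maximalAtlas (I := 𝓘(ℝ, EuclideanSpace ℝ (Fin 2))) (n := ∞) hφ
  have hpO : p ∈ chartDomain hπ (chartAt (EuclideanSpace ℝ (Fin 2)) (π p)) :=
    ⟨hp.1, mem_chart_source _ _⟩
  exact ((localSubmersion hπ hφ').norms_of_ne_zero (fun r hr => hb.1 _ hφ r hr.1 hr.2) hpO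
    (fun h0 => hp.2.1 ((fderiv_chart_eq_zero hπ hφ' hpO _).1 h0))
    (hp.2.2 _ hφ (mem_chart_source _ _))).1

lemma isLocallyFlat_of_isProperBiharmonic
    (hπ : IsRiemannianSubmersion (bcvDomain m) (bcvMetric m l) h π)
    (hb : IsProperBiharmonic (bcvDomain m) (bcvMetric m l) h π) : IsLocallyFlat h := by
  intro q
  obtain ⟨p, hp, rfl⟩ := hπ.surjOn (Set.mem_univ q)
  have hφ := chart_mem_atlas (EuclideanSpace ℝ (Fin 2)) (π p)
  set φ := chartAt (EuclideanSpace ℝ (Fin 2)) (π p)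
  have hφ' := IsManifold.subset_maximalAtlas (I := 𝓘(ℝ, EuclideanSpace ℝ (Fin 2))) (n := ∞) hφ
  have hpO : p ∈ chartDomain hπ φ := ⟨hp, mem_chart_source _ _⟩
  have hsub := bcvDomain_subset_properSet hπ hb
  obtain ⟨κ, hpκ, hκT, hκ, hκs, hκm⟩ := (localSubmersion hπ hφ').exists_flat_chart
    (fun r hr => hb.1 φ hφ r hr.1 hr.2)
    (fun r hr h0 => (hsub hr.1).2.1 ((fderiv_chart_eq_zero hπ hφ' hr _).1 h0))
    (fun r hr => (hsub hr.1).2.2 φ hφ hr.2) hpO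
  refine ⟨φ.trans κ, ?_, ⟨mem_chart_source _ _, hpκ⟩, fun y hy => ?_⟩
  · refine OpenPartialHomeomorph.mem_maximalAtlas_of_contMDiffOn _ ?_ ?_
    · exact (contMDiffOn_iff_contDiffOn.2 hκ).comp ((contMDiffOn_of_mem_maximalAtlas hφ').mono
        fun x hx => hx.1) fun x hx => hx.2
    · exact (contMDiffOn_symm_of_mem_maximalAtlas hφ').comp
        ((contMDiffOn_iff_contDiffOn.2 hκs).mono fun x hx => hx.1) fun x hx => hx.2
  · have hyκ : y ∈ κ.target := hy.1
    have hyφ : κ.symm y ∈ φ.target := hy.2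
    have h1 : MDifferentiableAt 𝓘(ℝ, EuclideanSpace ℝ (Fin 2)) 𝓘(ℝ, EuclideanSpace ℝ (Fin 2))
      φ.symm (κ.symm y) :=
      (contMDiffAt_symm_of_mem_maximalAtlas hφ' hyφ).mdifferentiableAt (by simp)
    have h2 : MDifferentiableAt 𝓘(ℝ, EuclideanSpace ℝ (Fin 2)) 𝓘(ℝ, EuclideanSpace ℝ (Fin 2))
      κ.symm y := ((hκs.contDiffAt (κ.open_target.mem_nhds hyκ)).differentiableAt
        (by simp)).mdifferentiableAt
    have hd := mfderiv_comp y h1 h2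
    rw [mfderiv_eq_fderiv] at hd
    have hd' : ∀ i : Fin 2, mfderiv 𝓘(ℝ, EuclideanSpace ℝ (Fin 2))
        𝓘(ℝ, EuclideanSpace ℝ (Fin 2)) (φ.trans κ).symm y
        (EuclideanSpace.single i (1 : ℝ) : EuclideanSpace ℝ (Fin 2)) =
        mfderiv 𝓘(ℝ, EuclideanSpace ℝ (Fin 2)) 𝓘(ℝ, EuclideanSpace ℝ (Fin 2)) φ.symm (κ.symm y)
          (fderiv ℝ κ.symm y (EuclideanSpace.single i 1)) := fun i =>
      congrArg (fun L => L (EuclideanSpace.single i (1 : ℝ) : EuclideanSpace ℝ (Fin 2))) hd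
    ext i j
    have key := (inner_eq_pairing (h := h) (φ := φ) (κ.symm y)
      (fderiv ℝ κ.symm y (EuclideanSpace.single i 1))
      (fderiv ℝ κ.symm y (EuclideanSpace.single j 1))).trans (hκm y hyκ _ _)
    have e : chartMetric h (φ.trans κ) y i j = ∑ k, (EuclideanSpace.single i (1 : ℝ) :
        EuclideanSpace ℝ (Fin 2)) k * (EuclideanSpace.single j (1 : ℝ) :
        EuclideanSpace ℝ (Fin 2)) k := by
      rw [← key]
      exact congrArg₂ (fun a b => h.inner (φ.symm (κ.symm y)) a b) (hd' i) (hd' j)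
    rw [e]
    fin_cases i <;> fin_cases j <;> simp

end Global

/-! ### Examples over the hyperbolic plane -/

/-- The composition of a smooth function with a smooth function of one variable. -/
lemma smoothAlgebra.exists_comp {n : ℕ} {O : TopologicalSpace.Opens (EuclideanSpace ℝ (Fin n))}
    {g : smoothAlgebra O} {ψ : ℝ → ℝ} (hψ : ∀ x, ContDiffAt ℝ ∞ ψ (eval x g)) :
    ∃ L : smoothAlgebra O, (∀ x, eval x L = ψ (eval x g)) ∧ ∀ D ∈ vectorFields O, ∀ x,
      eval x (D L) = deriv ψ (eval x g) * eval x (D g) := by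
  refine ⟨mk (fun p => ψ (rep g p)) fun p hp => ?_, fun x => ?_, fun D hD x => ?_⟩
  · have := hψ ⟨p, hp⟩
    rw [← rep_apply] at this
    exact this.comp_contDiffWithinAt p (contDiffOn_rep g p hp)
  · exact congrArg ψ (rep_apply g x)
  · obtain ⟨v, rfl⟩ := exists_eq_field hD
    have h1 : DifferentiableAt ℝ ψ (rep g x) := by
      rw [rep_apply]; exact (hψ x).differentiableAt (by simp)
    rw [eval_field_of_eval (F := fun p => ψ (rep g p)) v (fun x => rfl),
      eval_field_of_eval (F := rep g) v (fun x => (rep_apply g x).symm), ← rep_apply]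
    have := (h1.hasDerivAt.comp_hasFDerivAt (x : EuclideanSpace ℝ (Fin n))
      (differentiableAt_rep g x).hasFDerivAt).fderiv
    exact congrArg (fun L : EuclideanSpace ℝ (Fin n) →L[ℝ] ℝ => L _) this

lemma smoothAlgebra.exists_log {n : ℕ} {O : TopologicalSpace.Opens (EuclideanSpace ℝ (Fin n))}
    {g : smoothAlgebra O} (hg : ∀ x, 0 < eval x g) :
    ∃ L : smoothAlgebra O, (∀ x, eval x L = Real.log (eval x g)) ∧ ∀ D ∈ vectorFields O,
      g * D L = D g := by
  obtain ⟨L, hL, hD⟩ := exists_comp (g := g) (ψ := Real.log)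
    fun x => Real.contDiffAt_log.2 (hg x).ne'
  refine ⟨L, hL, fun D hDm => ?_⟩
  ext x
  rw [map_mul, hD D hDm, Real.deriv_log, mul_inv_cancel_left₀ (hg x).ne']

lemma smoothAlgebra.exists_arctan {n : ℕ}
    {O : TopologicalSpace.Opens (EuclideanSpace ℝ (Fin n))} (g : smoothAlgebra O) :
    ∃ L : smoothAlgebra O, (∀ x, eval x L = Real.arctan (eval x g)) ∧ ∀ D ∈ vectorFields O,
      (1 + g ^ 2) * D L = D g := by
  obtain ⟨L, hL, hD⟩ := exists_comp (g := g) (ψ := Real.arctan)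
    fun x => Real.contDiff_arctan.contDiffAt
  refine ⟨L, hL, fun D hDm => ?_⟩
  ext x
  have : (1 : ℝ) + eval x g ^ 2 ≠ 0 := by positivity
  rw [map_mul, hD D hDm, Real.deriv_arctan, map_add, map_pow, map_one]
  field_simp

/-- The gradients of the Busemann function `(log F - log Q) / (2 μ)` of the hyperbolic plane and of
the angle `φ = arctan (w₂ / w₁)`, where `w₁ = 1 - μ x`, `w₂ = μ y` and `Q = w₁² + w₂²`. -/
lemma BCVFrame.horospherical_gradients {A : Type*} [CommRing A] [Algebra ℝ A]
    {μ L X Y q W u LF LQ g φ : A} {E₁ E₂ E₃ : Derivation ℝ A A}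
    (h : BCVFrame (-μ ^ 2) L X Y E₁ E₂ E₃) (hμ : ∀ D : Derivation ℝ A A, D μ = 0)
    (hq : ((1 - μ * X) ^ 2 + (μ * Y) ^ 2) * q = 1)
    (hW : (1 + -μ ^ 2 * (X ^ 2 + Y ^ 2)) * W = 1) (hu : (1 - μ * X) * u = 1)
    (hg : g = μ * Y * u)
    {𝒱 : Submodule A (Derivation ℝ A A)} (m₁ : E₁ ∈ 𝒱) (m₂ : E₂ ∈ 𝒱) (m₃ : E₃ ∈ 𝒱)
    (hLF : ∀ D ∈ 𝒱, (1 + -μ ^ 2 * (X ^ 2 + Y ^ 2)) * D LF = D (1 + -μ ^ 2 * (X ^ 2 + Y ^ 2)))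
    (hLQ : ∀ D ∈ 𝒱, ((1 - μ * X) ^ 2 + (μ * Y) ^ 2) * D LQ = D ((1 - μ * X) ^ 2 + (μ * Y) ^ 2))
    (hφ : ∀ D ∈ 𝒱, (1 + g ^ 2) * D φ = D g) :
    (E₁ (LF - LQ) = 2 * μ * (((1 - μ * X) ^ 2 - (μ * Y) ^ 2) * q) ∧
      E₂ (LF - LQ) = 2 * μ * (-2 * (1 - μ * X) * (μ * Y) * q) ∧ E₃ (LF - LQ) = 0) ∧
    (μ ^ 2 * Y + E₁ φ = μ * (2 * (1 - μ * X) * (μ * Y) * q) ∧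
      μ ^ 2 * X - E₂ φ = -(μ * (((1 - μ * X) ^ 2 - (μ * Y) ^ 2) * q)) ∧ E₃ φ = 0) := by
  -- derivatives of the functions involved along a field with given `D X`, `D Y`
  have key : ∀ D ∈ 𝒱, D (LF - LQ) = -2 * μ ^ 2 * (X * D X + Y * D Y) * W -
      2 * μ * (-(1 - μ * X) * D X + (μ * Y) * D Y) * q ∧
      D φ = μ * ((1 - μ * X) * D Y + (μ * Y) * D X) * q := by
    intro D hD
    have k1 := hLF D hD
    have k2 := hLQ D hD
    have k3 := hφ D hD
    have k4 := congrArg D hu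
    rw [hg] at k3
    simp only [map_sub, map_add, Derivation.leibniz, Derivation.leibniz_pow, map_neg, hμ,
      Derivation.map_one_eq_zero, smul_eq_mul, nsmul_eq_mul] at k1 k2 k3 k4
    push_cast at k1 k2 k3 k4
    norm_num at k1 k2 k3 k4
    refine ⟨?_, ?_⟩
    · rw [map_sub]
      linear_combination W * k1 - q * k2 - D LF * hW + D LQ * hq
    · have k5 : D u = u ^ 2 * (μ * D X) := by
        linear_combination u * k4 - D u * hu
      rw [k5] at k3
      have k6 : (1 + (μ * Y * u) ^ 2) * (1 - μ * X) ^ 2 = (1 - μ * X) ^ 2 + (μ * Y) ^ 2 := by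
        linear_combination (μ * Y) ^ 2 * ((1 - μ * X) * u + 1) * hu
      linear_combination q * (1 - μ * X) ^ 2 * k3 - D φ * hq - q * D φ * k6 +
        (q * μ * D Y * (1 - μ * X) + q * μ * Y * μ * D X * ((1 - μ * X) * u + 1)) * hu
  obtain ⟨a1, b1⟩ := key E₁ m₁
  obtain ⟨a2, b2⟩ := key E₂ m₂
  obtain ⟨a3, b3⟩ := key E₃ m₃
  rw [h.E₁_X, h.E₁_Y] at a1 b1
  rw [h.E₂_X, h.E₂_Y] at a2 b2
  rw [h.E₃_X, h.E₃_Y] at a3 b3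
  refine ⟨⟨?_, ?_, ?_⟩, ?_, ?_, ?_⟩
  · rw [a1]; linear_combination -2 * μ ^ 2 * X * hW + 2 * μ * (1 - (1 - μ * X)) * hq
  · rw [a2]; linear_combination -2 * μ ^ 2 * Y * hW + 2 * μ * (μ * Y) * hq
  · rw [a3]; ring
  · rw [b1]; linear_combination -μ * (μ * Y) * hq
  · rw [b2]; linear_combination (-μ + μ * (1 - μ * X)) * hq
  · rw [b3]; ring

/-- The Laplacian of the Busemann function is constant, and that of the angle vanishes. -/
lemma BCVFrame.horospherical_laplacians {A : Type*} [CommRing A] [Algebra ℝ A]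
    {μ L X Y q c d : A} {E₁ E₂ E₃ : Derivation ℝ A A}
    (h : BCVFrame (-μ ^ 2) L X Y E₁ E₂ E₃) (hμ : ∀ D : Derivation ℝ A A, D μ = 0)
    (hq : ((1 - μ * X) ^ 2 + (μ * Y) ^ 2) * q = 1)
    (hc : c = ((1 - μ * X) ^ 2 - (μ * Y) ^ 2) * q) (hd : d = -2 * (1 - μ * X) * (μ * Y) * q) :
    c ^ 2 + d ^ 2 = 1 ∧ E₁ c + E₂ d + 2 * μ ^ 2 * (X * c + Y * d) = -2 * μ ∧
      E₁ d - E₂ c + 2 * μ ^ 2 * (X * d - Y * c) = 0 ∧ E₃ c = 0 ∧ E₃ d = 0 := by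
  have key : ∀ D : Derivation ℝ A A,
      D q = -2 * μ * (-(1 - μ * X) * D X + (μ * Y) * D Y) * q ^ 2 := by
    intro D
    have k := congrArg D hq
    simp only [map_sub, map_add, Derivation.leibniz, Derivation.leibniz_pow, hμ,
      Derivation.map_one_eq_zero, smul_eq_mul, nsmul_eq_mul] at k
    push_cast at k
    norm_num at k
    linear_combination q * k - D q * hq
  have dc : ∀ D : Derivation ℝ A A, D c = (-2 * μ * (1 - μ * X) * D X - 2 * μ * (μ * Y) * D Y) * q +
      ((1 - μ * X) ^ 2 - (μ * Y) ^ 2) * D q := by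
    intro D
    rw [hc]
    simp only [map_sub, Derivation.leibniz, Derivation.leibniz_pow, hμ,
      Derivation.map_one_eq_zero, smul_eq_mul, nsmul_eq_mul]
    push_cast
    norm_num
    ring
  have dd : ∀ D : Derivation ℝ A A, D d = 2 * μ * (D X * (μ * Y) - (1 - μ * X) * D Y) * q -
      2 * (1 - μ * X) * (μ * Y) * D q := by
    intro D
    rw [hd]
    simp only [map_sub, map_neg, Derivation.leibniz, hμ, deriv_ofNat,
      Derivation.map_one_eq_zero, smul_eq_mul]
    ring
  refine ⟨?_, ?_, ?_, ?_, ?_⟩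
  · rw [hc, hd]
    linear_combination (((1 - μ * X) ^ 2 + (μ * Y) ^ 2) * q + 1) * hq
  · rw [dc, dd, key, key, h.E₁_X, h.E₁_Y, h.E₂_X, h.E₂_Y, hc, hd]
    clear hc hd dc dd key
    grind
  · rw [dc, dd, key, key, h.E₁_X, h.E₁_Y, h.E₂_X, h.E₂_Y, hc, hd]
    clear hc hd dc dd key
    grind
  · rw [dc, key, h.E₃_X, h.E₃_Y]; ring
  · rw [dd, key, h.E₃_X, h.E₃_Y]; ring

/-- The domain of a BCV space as an open set. -/
def bcvOpens (m : ℝ) : TopologicalSpace.Opens (EuclideanSpace ℝ (Fin 3)) :=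
  ⟨bcvDomain m, isOpen_bcvDomain m⟩

/-- The coordinates `f 0`, `f 1` of a Riemannian submersion to the plane with non-vanishing constant
tension field: the gradient of `f 0` is the horizontal unit field `c E₁ + d E₂`, and the gradient of
`f 1` is `ν (k d E₁ - k c E₂ + E₃)`. -/
structure ExampleData (m l : ℝ) (f : Fin 2 → smoothAlgebra (bcvOpens m))
    (c d : smoothAlgebra (bcvOpens m)) (k ν μ : ℝ) : Prop where
  unit : c ^ 2 + d ^ 2 = 1
  unit' : ν ^ 2 * (1 + k ^ 2) = 1
  μ_ne_zero : μ ≠ 0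
  grad₁ : frame₁ m l _ (f 0) = c ∧ frame₂ m l _ (f 0) = d ∧ frame₃ _ (f 0) = 0
  grad₂ : frame₁ m l _ (f 1) = algebraMap ℝ _ (ν * k) * d ∧
    frame₂ m l _ (f 1) = -(algebraMap ℝ _ (ν * k) * c) ∧ frame₃ _ (f 1) = algebraMap ℝ _ ν
  laplacian₁ : frame₁ m l _ c + frame₂ m l _ d -
    2 * algebraMap ℝ _ m * (coordinate _ 0 * c + coordinate _ 1 * d) = algebraMap ℝ _ (-2 * μ)
  laplacian₂ : frame₁ m l _ d - frame₂ m l _ c -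
    2 * algebraMap ℝ _ m * (coordinate _ 0 * d - coordinate _ 1 * c) = 0
  surj : ∀ s r : ℝ, ∃ p : bcvOpens m, eval p (f 0) = s ∧ eval p (f 1) = r

/-- The gradients and the Laplacians of `f₀ = (log F - log Q) / (2 μ)` and of
`f₁ = ν (z - (k / μ) φ)`. -/
lemma BCVFrame.example_equations {A : Type*} [CommRing A] [Algebra ℝ A] {m l k ν μ : ℝ}
    (hμ0 : μ ≠ 0) (hμm : μ ^ 2 = -m) (hk : k = l / (2 * μ)) {M X Y Z q W u LF LQ φ g f₀ f₁ c d : A}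
    {E₁ E₂ E₃ : Derivation ℝ A A} (hM : M = algebraMap ℝ A μ)
    (h : BCVFrame (algebraMap ℝ A m) (2 * algebraMap ℝ A (l / 2)) X Y E₁ E₂ E₃)
    (hZ : E₁ Z = -(algebraMap ℝ A (l / 2) * Y) ∧ E₂ Z = algebraMap ℝ A (l / 2) * X ∧ E₃ Z = 1)
    (hq : ((1 - M * X) ^ 2 + (M * Y) ^ 2) * q = 1)
    (hW : (1 + -M ^ 2 * (X ^ 2 + Y ^ 2)) * W = 1) (hu : (1 - M * X) * u = 1)
    (hg : g = M * Y * u)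
    {𝒱 : Submodule A (Derivation ℝ A A)} (m₁ : E₁ ∈ 𝒱) (m₂ : E₂ ∈ 𝒱) (m₃ : E₃ ∈ 𝒱)
    (hLF : ∀ D ∈ 𝒱, (1 + -M ^ 2 * (X ^ 2 + Y ^ 2)) * D LF = D (1 + -M ^ 2 * (X ^ 2 + Y ^ 2)))
    (hLQ : ∀ D ∈ 𝒱, ((1 - M * X) ^ 2 + (M * Y) ^ 2) * D LQ = D ((1 - M * X) ^ 2 + (M * Y) ^ 2))
    (hφ : ∀ D ∈ 𝒱, (1 + g ^ 2) * D φ = D g)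
    (hf₀ : f₀ = algebraMap ℝ A (1 / (2 * μ)) * (LF - LQ))
    (hf₁ : f₁ = algebraMap ℝ A ν * (Z - algebraMap ℝ A (k / μ) * φ))
    (hc : c = ((1 - M * X) ^ 2 - (M * Y) ^ 2) * q) (hd : d = -2 * (1 - M * X) * (M * Y) * q) :
    c ^ 2 + d ^ 2 = 1 ∧ (E₁ f₀ = c ∧ E₂ f₀ = d ∧ E₃ f₀ = 0) ∧
      (E₁ f₁ = algebraMap ℝ A (ν * k) * d ∧ E₂ f₁ = -(algebraMap ℝ A (ν * k) * c) ∧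
        E₃ f₁ = algebraMap ℝ A ν) ∧
      E₁ c + E₂ d - 2 * algebraMap ℝ A m * (X * c + Y * d) = algebraMap ℝ A (-2 * μ) ∧
      E₁ d - E₂ c - 2 * algebraMap ℝ A m * (X * d - Y * c) = 0 := by
  have hconst : ∀ D : Derivation ℝ A A, D M = 0 := fun D => by rw [hM, D.map_algebraMap]
  have hMM : algebraMap ℝ A m = -M ^ 2 := by
    rw [hM, ← map_pow, ← map_neg, hμm, neg_neg]
  rw [hMM] at h ⊢
  obtain ⟨⟨g1, g2, g3⟩, g4, g5, g6⟩ := h.horospherical_gradients hconst hq hW hu hg m₁ m₂ m₃ hLF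
    hLQ hφ
  obtain ⟨c1, c2, c3, -, -⟩ := h.horospherical_laplacians hconst hq hc hd
  rw [← hc] at g1 g5
  rw [← hd] at g2
  have g4' : M ^ 2 * Y + E₁ φ = -(M * d) := by rw [g4, hd]; ring
  have hκ : algebraMap ℝ A (k / μ) * M = algebraMap ℝ A k := by
    rw [hM, ← map_mul, div_mul_cancel₀ _ hμ0]
  have hτ : algebraMap ℝ A (l / 2) = algebraMap ℝ A (k / μ) * M ^ 2 := by
    rw [hM, ← map_pow, ← map_mul]
    congr 1
    rw [hk]; field_simp
  have h2 : (2 : A) = algebraMap ℝ A 2 := (map_ofNat _ 2).symm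
  have h2μ : algebraMap ℝ A (1 / (2 * μ)) * (2 * M) = 1 := by
    rw [hM, h2, ← map_mul, ← map_mul, one_div_mul_cancel (by positivity), map_one]
  have h2μ' : algebraMap ℝ A (-2 * μ) = -2 * M := by
    rw [hM, map_mul, map_neg, h2]
  have hsmul : ∀ (D : Derivation ℝ A A) (r : ℝ) (a : A),
      D (algebraMap ℝ A r * a) = algebraMap ℝ A r * D a := fun D r a => by
    rw [Derivation.leibniz, D.map_algebraMap, smul_zero, add_zero, smul_eq_mul]
  obtain ⟨z1, z2, z3⟩ := hZ
  refine ⟨c1, ⟨?_, ?_, ?_⟩, ⟨?_, ?_, ?_⟩, ?_, ?_⟩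
  · rw [hf₀, hsmul, g1]; linear_combination c * h2μ
  · rw [hf₀, hsmul, g2]; linear_combination d * h2μ
  · rw [hf₀, hsmul, g3, mul_zero]
  · rw [hf₁, hsmul, map_sub, hsmul, z1, hτ, map_mul]
    linear_combination -algebraMap ℝ A ν * algebraMap ℝ A (k / μ) * g4' +
      algebraMap ℝ A ν * d * hκ
  · rw [hf₁, hsmul, map_sub, hsmul, z2, hτ, map_mul]
    linear_combination algebraMap ℝ A ν * algebraMap ℝ A (k / μ) * g5 -
      algebraMap ℝ A ν * c * hκ
  · rw [hf₁, hsmul, map_sub, hsmul, z3, g6]; ring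
  · rw [h2μ']; linear_combination c2
  · linear_combination c3

/-- The point with `y = 0` and `μ x = tanh (μ s)` lies in the domain, and the Busemann function
takes the value `s` there. -/
lemma exists_busemann_eq {μ : ℝ} (hμ : 0 < μ) (s : ℝ) : ∃ t : ℝ, 0 < 1 - μ ^ 2 * t ^ 2 ∧
    1 / (2 * μ) * (Real.log (1 - μ ^ 2 * t ^ 2) - Real.log ((1 - μ * t) ^ 2)) = s := by
  obtain ⟨e, he⟩ : ∃ e, e = Real.exp (2 * μ * s) := ⟨_, rfl⟩
  have he0 : 0 < e := he ▸ Real.exp_pos _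
  obtain ⟨T, hT⟩ : ∃ T, T = (e - 1) / (e + 1) := ⟨_, rfl⟩
  have hT1 : 1 + T = 2 * e / (e + 1) := by rw [hT]; field_simp; ring
  have hT2 : 1 - T = 2 / (e + 1) := by rw [hT]; field_simp; ring
  have hT1' : 0 < 1 + T := by rw [hT1]; positivity
  have hT2' : 0 < 1 - T := by rw [hT2]; positivity
  have hTμ : μ * (T / μ) = T := mul_div_cancel₀ _ hμ.ne'
  have e1 : (1 : ℝ) - μ ^ 2 * (T / μ) ^ 2 = (1 - T) * (1 + T) := by
    linear_combination -(μ * (T / μ) + T) * hTμ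
  refine ⟨T / μ, ?_, ?_⟩
  · rw [e1]; positivity
  · rw [e1, hTμ, sq, Real.log_mul hT2'.ne' hT1'.ne', Real.log_mul hT2'.ne' hT2'.ne']
    have e3 : Real.log (1 + T) - Real.log (1 - T) = 2 * μ * s := by
      rw [← Real.log_div hT1'.ne' hT2'.ne', hT1, hT2]
      have : 2 * e / (e + 1) / (2 / (e + 1)) = e := by field_simp
      rw [this, he, Real.log_exp]
    have e4 : 1 / (2 * μ) * (2 * μ) = 1 := one_div_mul_cancel (by positivity)
    linear_combination 1 / (2 * μ) * e3 + s * e4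

lemma frame_coordinate_two (m l : ℝ) (O : TopologicalSpace.Opens (EuclideanSpace ℝ (Fin 3))) :
    frame₁ m l O (coordinate O 2) = -(algebraMap ℝ _ (l / 2) * coordinate O 1) ∧
      frame₂ m l O (coordinate O 2) = algebraMap ℝ _ (l / 2) * coordinate O 0 ∧
      frame₃ O (coordinate O 2) = 1 := by
  refine ⟨?_, ?_, ?_⟩
  · rw [frame₁_apply]; simp [partialDeriv_coordinate]
  · rw [frame₂_apply]; simp [partialDeriv_coordinate]
  · rw [frame₃_apply]; simp [partialDeriv_coordinate]

/-- The coordinates of the example: with `μ = √(-m)`, the Busemann function of the hyperbolic plane,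
and a multiple of `z - (l / (2 μ²)) φ` with the angle `φ` at the point at infinity. -/
lemma exists_exampleData (l : ℝ) {m : ℝ} (hm : m < 0) :
    ∃ f c d, ∃ k ν μ : ℝ, ExampleData m l f c d k ν μ := by
  obtain ⟨μ, hμ, hμm⟩ : ∃ μ : ℝ, 0 < μ ∧ μ ^ 2 = -m :=
    ⟨Real.sqrt (-m), Real.sqrt_pos.2 (by linarith), Real.sq_sqrt (by linarith)⟩
  obtain ⟨k, hk⟩ : ∃ k, k = l / (2 * μ) := ⟨_, rfl⟩
  obtain ⟨ν, hν0, hν⟩ : ∃ ν : ℝ, 0 < ν ∧ ν ^ 2 * (1 + k ^ 2) = 1 := by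
    have h1 : 0 < 1 + k ^ 2 := by positivity
    refine ⟨(Real.sqrt (1 + k ^ 2))⁻¹, inv_pos.2 (Real.sqrt_pos.2 h1), ?_⟩
    rw [inv_pow, Real.sq_sqrt h1.le, inv_mul_cancel₀ h1.ne']
  obtain ⟨X, hX⟩ : ∃ X, X = coordinate (bcvOpens m) 0 := ⟨_, rfl⟩
  obtain ⟨Y, hY⟩ : ∃ Y, Y = coordinate (bcvOpens m) 1 := ⟨_, rfl⟩
  obtain ⟨M, hM⟩ : ∃ M, M = algebraMap ℝ (smoothAlgebra (bcvOpens m)) μ := ⟨_, rfl⟩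
  -- on the domain, `|μ x| < 1`
  have hFpos : ∀ p : bcvOpens m, 0 < 1 - μ ^ 2 * ((p : EuclideanSpace ℝ (Fin 3)) 0 ^ 2 +
      (p : EuclideanSpace ℝ (Fin 3)) 1 ^ 2) := by
    intro p
    have : 0 < bcvF m p := p.2
    rw [hμm]
    unfold bcvF at this
    linarith
  have hw₁ : ∀ p : bcvOpens m, 0 < 1 - μ * (p : EuclideanSpace ℝ (Fin 3)) 0 := by
    intro p
    have h1 := hFpos p
    by_contra! h2
    nlinarith [sq_nonneg (μ * (p : EuclideanSpace ℝ (Fin 3)) 1)]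
  have eM : ∀ p, eval p M = μ := fun p => by rw [hM]; exact eval_algebraMap μ p
  have eX : ∀ p : bcvOpens m, eval p X = (p : EuclideanSpace ℝ (Fin 3)) 0 := fun p => by
    rw [hX]; rfl
  have eY : ∀ p : bcvOpens m, eval p Y = (p : EuclideanSpace ℝ (Fin 3)) 1 := fun p => by
    rw [hY]; rfl
  have eF : ∀ p : bcvOpens m, eval p (1 + -M ^ 2 * (X ^ 2 + Y ^ 2)) =
      1 - μ ^ 2 * ((p : EuclideanSpace ℝ (Fin 3)) 0 ^ 2 +
        (p : EuclideanSpace ℝ (Fin 3)) 1 ^ 2) := fun p => by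
    simp only [map_add, map_mul, map_neg, map_pow, map_one, eM, eX, eY]; ring
  have eQ : ∀ p : bcvOpens m, eval p ((1 - M * X) ^ 2 + (M * Y) ^ 2) =
      (1 - μ * (p : EuclideanSpace ℝ (Fin 3)) 0) ^ 2 +
        (μ * (p : EuclideanSpace ℝ (Fin 3)) 1) ^ 2 := fun p => by
    simp only [map_add, map_sub, map_mul, map_pow, map_one, eM, eX, eY]
  have hF0 : ∀ p, 0 < eval p (1 + -M ^ 2 * (X ^ 2 + Y ^ 2)) := fun p => by
    rw [eF]; exact hFpos p
  have hQ0 : ∀ p, 0 < eval p ((1 - M * X) ^ 2 + (M * Y) ^ 2) := fun p => by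
    rw [eQ]; have := hw₁ p; positivity
  have hw0 : ∀ p, eval p (1 - M * X) ≠ 0 := fun p => by
    simp only [map_sub, map_mul, map_one, eM, eX]; exact (hw₁ p).ne'
  obtain ⟨W, hW⟩ := exists_inv fun p => (hF0 p).ne'
  obtain ⟨q, hq⟩ := exists_inv fun p => (hQ0 p).ne'
  obtain ⟨u, hu⟩ := exists_inv hw0
  obtain ⟨LF, eLF, hLF⟩ := exists_log hF0
  obtain ⟨LQ, eLQ, hLQ⟩ := exists_log hQ0
  obtain ⟨φ, eφ, hφ⟩ := exists_arctan (M * Y * u)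
  obtain ⟨f₀, hf₀⟩ : ∃ f₀, f₀ = algebraMap ℝ (smoothAlgebra (bcvOpens m)) (1 / (2 * μ)) *
    (LF - LQ) := ⟨_, rfl⟩
  obtain ⟨f₁, hf₁⟩ : ∃ f₁, f₁ = algebraMap ℝ (smoothAlgebra (bcvOpens m)) ν *
    (coordinate _ 2 - algebraMap ℝ _ (k / μ) * φ) := ⟨_, rfl⟩
  obtain ⟨c, hc⟩ : ∃ c, c = ((1 - M * X) ^ 2 - (M * Y) ^ 2) * q := ⟨_, rfl⟩
  obtain ⟨d, hd⟩ : ∃ d, d = -2 * (1 - M * X) * (M * Y) * q := ⟨_, rfl⟩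
  have hFr := bcvFrame m l (bcvOpens m)
  have hZ := frame_coordinate_two m l (bcvOpens m)
  rw [← hX, ← hY] at hFr hZ
  obtain ⟨h1, h2, h3, h4, h5⟩ := hFr.example_equations hμ.ne' hμm hk hM hZ hq hW hu rfl frame₁_mem
    frame₂_mem frame₃_mem hLF hLQ hφ hf₀ hf₁ hc hd
  rw [hX, hY] at h4 h5
  refine ⟨![f₀, f₁], c, d, k, ν, μ, h1, hν, hμ.ne', h2, h3, h4, h5, fun s r => ?_⟩
  obtain ⟨t, ht, hts⟩ := exists_busemann_eq hμ s
  have hp : (WithLp.toLp 2 ![t, 0, r / ν] : EuclideanSpace ℝ (Fin 3)) ∈ bcvOpens m := by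
    change 0 < 1 + m * (t ^ 2 + 0 ^ 2)
    rw [hμm] at ht
    linarith
  refine ⟨⟨_, hp⟩, ?_, ?_⟩
  · change eval _ f₀ = s
    rw [hf₀, map_mul, map_sub, eLF, eLQ, eF, eQ, eval_algebraMap, ← hts]
    simp
  · change eval _ f₁ = r
    rw [hf₁, map_mul, map_sub, map_mul, eφ, eval_algebraMap, map_mul, map_mul, eY, eval_coordinate]
    simp
    field_simp

/-! ### Maps to the Euclidean plane -/

lemma chartMetric_euclideanPlane :
    chartMetric euclideanPlane (OpenPartialHomeomorph.refl (EuclideanSpace ℝ (Fin 2))) =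
      fun _ => 1 := by
  funext y
  ext i j
  have h1 : (mfderiv 𝓘(ℝ, EuclideanSpace ℝ (Fin 2)) 𝓘(ℝ, EuclideanSpace ℝ (Fin 2))
      (OpenPartialHomeomorph.refl (EuclideanSpace ℝ (Fin 2))).symm y) =
      ContinuousLinearMap.id ℝ (EuclideanSpace ℝ (Fin 2)) := by
    exact mfderiv_id
  unfold chartMetric
  rw [h1]
  change inner ℝ (EuclideanSpace.single i (1 : ℝ)) (EuclideanSpace.single j (1 : ℝ)) = _
  rw [EuclideanSpace.inner_single_left, Matrix.one_apply]
  simp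

lemma christoffel_one (k i j : Fin 2) :
    christoffel (fun _ => (1 : Matrix (Fin 2) (Fin 2) ℝ)) k i j = fun _ => 0 := by
  funext x
  simp [christoffel, pd]

/-- The map to the plane with the given coordinates. -/
def planeMap {O : TopologicalSpace.Opens (EuclideanSpace ℝ (Fin 3))} (f : Fin 2 → smoothAlgebra O)
    (p : EuclideanSpace ℝ (Fin 3)) : EuclideanSpace ℝ (Fin 2) :=
  WithLp.toLp 2 fun α => rep (f α) p

section PlaneMap

variable {O : TopologicalSpace.Opens (EuclideanSpace ℝ (Fin 3))}

lemma contDiffOn_planeMap (f : Fin 2 → smoothAlgebra O) : ContDiffOn ℝ ∞ (planeMap f) O :=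
  contDiffOn_euclidean.2 fun α => contDiffOn_rep (f α)

lemma planeMap_apply (f : Fin 2 → smoothAlgebra O) (p : O) (α : Fin 2) :
    planeMap f p α = eval p (f α) := rep_apply (f α) p

lemma coordinateMap_planeMap (f : Fin 2 → smoothAlgebra O) :
    CoordinateMap O ⊤ (planeMap f) fun _ => 1 where
  smooth := contDiffOn_planeMap f
  mapsTo := fun _ _ => trivial
  metric_smooth := fun _ _ => contDiffOn_const
  metric_symm := fun _ _ α β => by rw [Matrix.one_apply, Matrix.one_apply]; simp [eq_comm]
  metric_det := fun _ _ => by simp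

lemma coordinateMap_planeMap_cov (f : Fin 2 → smoothAlgebra O)
    (D : Derivation ℝ (smoothAlgebra O) (smoothAlgebra O)) (W : Fin 2 → smoothAlgebra O)
    (α : Fin 2) : (coordinateMap_planeMap f).geometry.cov D W α = D (W α) := by
  have h : ∀ β γ, (coordinateMap_planeMap f).geometry.Γ α β γ = 0 := fun β γ => by
    ext p
    exact congrFun (christoffel_one α β γ) _
  simp [PullbackGeometry.cov, h]

lemma coordinateMap_planeMap_push (f : Fin 2 → smoothAlgebra O)
    (D : Derivation ℝ (smoothAlgebra O) (smoothAlgebra O)) (α : Fin 2) :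
    (coordinateMap_planeMap f).geometry.push D α = D (f α) := by
  change D ((coordinateMap_planeMap f).coord α) = _
  congr 1
  ext p
  exact planeMap_apply f p α

lemma coordinateMap_planeMap_curvOp (f : Fin 2 → smoothAlgebra O)
    (U V W : Fin 2 → smoothAlgebra O) :
    (coordinateMap_planeMap f).geometry.curvOp U V W = 0 := by
  have h : ∀ α β γ, (coordinateMap_planeMap f).geometry.Γ α β γ = 0 := fun α β γ => by
    ext p
    exact congrFun (christoffel_one α β γ) _
  have h' : ∀ δ α β γ, (coordinateMap_planeMap f).geometry.dΓ δ α β γ = 0 := fun δ α β γ => by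
    ext p
    change pd δ (christoffel (fun _ => 1) α β γ) _ = 0
    rw [christoffel_one]
    simp [pd]
  funext α
  simp [PullbackGeometry.curvOp, PullbackGeometry.curv, h, h']

lemma fderiv_planeMap (f : Fin 2 → smoothAlgebra O) {m l : ℝ} {p : O}
    (hp : (p : EuclideanSpace ℝ (Fin 3)) ∈ bcvDomain m) (v : EuclideanSpace ℝ (Fin 3))
    (α : Fin 2) :
    fderiv ℝ (planeMap f) p v α = frameCoeff m l p v 0 * eval p (frame₁ m l O (f α)) +
      frameCoeff m l p v 1 * eval p (frame₂ m l O (f α)) +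
      frameCoeff m l p v 2 * eval p (frame₃ O (f α)) := by
  rw [← fderiv_eq_frameCoeff (R := fun q => planeMap f q α)
    (fun q => (planeMap_apply f q α).symm) hp]
  have hd : DifferentiableAt ℝ (planeMap f) p :=
    ((contDiffOn_planeMap f).contDiffAt (O.2.mem_nhds p.2)).differentiableAt (by simp)
  have := ((EuclideanSpace.proj (𝕜 := ℝ) α).hasFDerivAt.comp (p : EuclideanSpace ℝ (Fin 3))
    hd.hasFDerivAt).fderiv
  exact (congrArg (fun L => L v) this).symm

end PlaneMap

namespace ExampleData

variable {m l : ℝ} {f : Fin 2 → smoothAlgebra (bcvOpens m)} {c d : smoothAlgebra (bcvOpens m)}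
  {k ν μ : ℝ}

lemma fderiv_zero (h : ExampleData m l f c d k ν μ) (p : bcvOpens m)
    (v : EuclideanSpace ℝ (Fin 3)) :
    fderiv ℝ (planeMap f) p v 0 =
      frameCoeff m l p v 0 * eval p c + frameCoeff m l p v 1 * eval p d := by
  rw [fderiv_planeMap (l := l) f p.2, h.grad₁.1, h.grad₁.2.1, h.grad₁.2.2, map_zero, mul_zero,
    add_zero]

lemma fderiv_one (h : ExampleData m l f c d k ν μ) (p : bcvOpens m)
    (v : EuclideanSpace ℝ (Fin 3)) :
    fderiv ℝ (planeMap f) p v 1 =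
      ν * (k * (frameCoeff m l p v 0 * eval p d - frameCoeff m l p v 1 * eval p c) +
        frameCoeff m l p v 2) := by
  rw [fderiv_planeMap (l := l) f p.2, h.grad₂.1, h.grad₂.2.1, h.grad₂.2.2]
  simp only [map_mul, map_neg, eval_algebraMap]
  ring

lemma eval_unit (h : ExampleData m l f c d k ν μ) (p : bcvOpens m) :
    eval p c ^ 2 + eval p d ^ 2 = 1 := by
  rw [← map_pow, ← map_pow, ← map_add, h.unit, map_one]

lemma isRiemannianSubmersion (h : ExampleData m l f c d k ν μ) :
    IsRiemannianSubmersion (bcvDomain m) (bcvMetric m l) euclideanPlane (planeMap f) where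
  smooth := (contDiffOn_planeMap f).contMDiffOn
  surjOn := by
    intro y _
    obtain ⟨p, h0, h1⟩ := h.surj (y 0) (y 1)
    refine ⟨p, p.2, ?_⟩
    ext α
    rw [planeMap_apply]
    fin_cases α
    · exact h0
    · exact h1
  submersion := by
    intro p hp
    rw [mfderiv_eq_fderiv]
    intro y
    have h1 := h.eval_unit ⟨p, hp⟩
    have h2 := h.unit'
    have e0 := fun v => h.fderiv_zero ⟨p, hp⟩ v
    have e1 := fun v => h.fderiv_one ⟨p, hp⟩ v
    generalize eval (⟨p, hp⟩ : bcvOpens m) c = c' at h1 e0 e1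
    generalize eval (⟨p, hp⟩ : bcvOpens m) d = d' at h1 e0 e1
    obtain ⟨a, ha⟩ : ∃ a : ℝ, a = (show EuclideanSpace ℝ (Fin 2) from y) 0 := ⟨_, rfl⟩
    obtain ⟨b, hb⟩ : ∃ b : ℝ, b = (show EuclideanSpace ℝ (Fin 2) from y) 1 := ⟨_, rfl⟩
    refine ⟨frameVec m l p ![a * c' + b * (ν * k * d'), a * d' - b * (ν * k * c'), b * ν], ?_⟩
    have e0' := e0 (frameVec m l p ![a * c' + b * (ν * k * d'), a * d' - b * (ν * k * c'), b * ν])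
    have e1' := e1 (frameVec m l p ![a * c' + b * (ν * k * d'), a * d' - b * (ν * k * c'), b * ν])
    rw [frameCoeff_frameVec hp] at e0' e1'
    simp only [Matrix.cons_val_zero, Matrix.cons_val_one, Matrix.cons_val] at e0' e1'
    refine PiLp.ext fun α => ?_
    fin_cases α
    · refine e0'.trans (Eq.trans ?_ ha)
      linear_combination a * h1
    · refine e1'.trans (Eq.trans ?_ hb)
      linear_combination b * h2 + b * ν ^ 2 * k ^ 2 * h1
  isometry := by
    intro p hp v w hv hw
    unfold IsHorizontal at hv hw
    rw [mfderiv_eq_fderiv] at hv hw ⊢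
    have h1 := h.eval_unit ⟨p, hp⟩
    have h2 := h.unit'
    have e0 := fun v => h.fderiv_zero ⟨p, hp⟩ v
    have e1 := fun v => h.fderiv_one ⟨p, hp⟩ v
    generalize eval (⟨p, hp⟩ : bcvOpens m) c = c' at h1 e0 e1
    generalize eval (⟨p, hp⟩ : bcvOpens m) d = d' at h1 e0 e1
    -- the kernel of the differential is spanned by `d E₁ - c E₂ - k E₃`
    have hker : fderiv ℝ (planeMap f) p (frameVec m l p ![d', -c', -k]) = 0 := by
      have e0' := e0 (frameVec m l p ![d', -c', -k])
      have e1' := e1 (frameVec m l p ![d', -c', -k])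
      rw [frameCoeff_frameVec hp] at e0' e1'
      simp only [Matrix.cons_val_zero, Matrix.cons_val_one, Matrix.cons_val] at e0' e1'
      ext α
      fin_cases α
      · refine e0'.trans ?_
        change _ = (0 : ℝ)
        ring
      · refine e1'.trans ?_
        change _ = (0 : ℝ)
        linear_combination ν * k * h1
    have hv' := hv _ hker
    have hw' := hw _ hker
    rw [bcvMetric_eq_frameCoeff hp, frameCoeff_frameVec hp] at hv' hw'
    rw [bcvMetric_eq_frameCoeff hp]
    simp only [Fin.sum_univ_three, Matrix.cons_val_zero, Matrix.cons_val_one, Matrix.cons_val]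
      at hv' hw' ⊢
    have key : ∀ v w : EuclideanSpace ℝ (Fin 2),
        euclideanPlane.inner (planeMap f p) v w = v 0 * w 0 + v 1 * w 1 := by
      intro v w
      change inner ℝ v w = _
      simp [PiLp.inner_apply, Fin.sum_univ_two, mul_comm]
    refine (key _ _).trans ?_
    refine (congrArg₂ (· + ·) (congrArg₂ (· * ·) (e0 v) (e0 w))
      (congrArg₂ (· * ·) (e1 v) (e1 w))).trans ?_
    dsimp only
    generalize frameCoeff m l p v 0 = v0 at hv' ⊢
    generalize frameCoeff m l p v 1 = v1 at hv' ⊢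
    generalize frameCoeff m l p v 2 = v2 at hv' ⊢
    generalize frameCoeff m l p w 0 = w0 at hw' ⊢
    generalize frameCoeff m l p w 1 = w1 at hw' ⊢
    generalize frameCoeff m l p w 2 = w2 at hw' ⊢
    have hv2 : v0 * d' - v1 * c' = v2 * k := by linear_combination hv'
    have hw2 : w0 * d' - w1 * c' = w2 * k := by linear_combination hw'
    rw [hv2, hw2]
    linear_combination (v0 * w0 + v1 * w1) * h1 - (w0 * d' - w1 * c') * hv2 - v2 * k * hw2 +
      v2 * w2 * (1 + k ^ 2) * h2

lemma frameTension_eq (h : ExampleData m l f c d k ν μ) :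
    (coordinateMap_planeMap f).geometry.frameTension (frame₁ m l _) (frame₂ m l _) (frame₃ _)
      (frameZ m l _) = ![algebraMap ℝ _ (-2 * μ), 0] := by
  have e : ∀ α, (coordinateMap_planeMap f).geometry.frameTension (frame₁ m l _) (frame₂ m l _)
      (frame₃ _) (frameZ m l _) α = frame₁ m l _ (frame₁ m l _ (f α)) +
        frame₂ m l _ (frame₂ m l _ (f α)) + frame₃ _ (frame₃ _ (f α)) -
        (2 * algebraMap ℝ _ m * coordinate _ 0 * frame₁ m l _ (f α) +
          2 * algebraMap ℝ _ m * coordinate _ 1 * frame₂ m l _ (f α)) := by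
    intro α
    simp only [PullbackGeometry.frameTension, Pi.sub_apply, Pi.add_apply,
      coordinateMap_planeMap_cov, coordinateMap_planeMap_push]
    rfl
  funext α
  fin_cases α
  · refine (e 0).trans ?_
    obtain ⟨a1, a2, a3⟩ := h.grad₁
    rw [a1, a2, a3, map_zero]
    refine Eq.trans ?_ h.laplacian₁
    ring
  · refine (e 1).trans ?_
    obtain ⟨a1, a2, a3⟩ := h.grad₂
    rw [a1, a2, a3, map_neg, Derivation.map_algebraMap, Derivation.leibniz, Derivation.leibniz,
      Derivation.map_algebraMap, Derivation.map_algebraMap]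
    simp only [smul_eq_mul, mul_zero, add_zero]
    change _ = (0 : smoothAlgebra (bcvOpens m))
    linear_combination algebraMap ℝ _ (ν * k) * h.laplacian₂

lemma frameBitension_eq_zero (h : ExampleData m l f c d k ν μ) :
    (coordinateMap_planeMap f).geometry.frameBitension (frame₁ m l _) (frame₂ m l _) (frame₃ _)
      (frameZ m l _) = 0 := by
  have e : ∀ D : Derivation ℝ (smoothAlgebra (bcvOpens m)) (smoothAlgebra (bcvOpens m)),
      (coordinateMap_planeMap f).geometry.cov D ![algebraMap ℝ _ (-2 * μ), 0] = 0 := by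
    intro D
    funext α
    rw [coordinateMap_planeMap_cov]
    fin_cases α
    · exact D.map_algebraMap _
    · exact D.map_zero
  have e' : ∀ D : Derivation ℝ (smoothAlgebra (bcvOpens m)) (smoothAlgebra (bcvOpens m)),
      (coordinateMap_planeMap f).geometry.cov D 0 = 0 := by
    intro D
    funext α
    rw [coordinateMap_planeMap_cov]
    exact D.map_zero
  rw [PullbackGeometry.frameBitension, h.frameTension_eq, PullbackGeometry.frameLaplacian]
  simp only [e, e', coordinateMap_planeMap_curvOp, add_zero, sub_zero]

lemma isProperBiharmonic (h : ExampleData m l f c d k ν μ) :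
    IsProperBiharmonic (bcvDomain m) (bcvMetric m l) euclideanPlane (planeMap f) := by
  refine ⟨fun φ hφ p hp _ => ?_, fun hh => ?_⟩
  · rw [chartedSpaceSelf_atlas] at hφ
    subst hφ
    rw [chartMetric_euclideanPlane]
    funext α
    refine ((coordinateMap_planeMap f).eval_frameBitension (m := m) (l := l) subset_rfl ⟨p, hp⟩
      α).symm.trans ?_
    rw [h.frameBitension_eq_zero]
    exact map_zero _
  · have hp : (0 : EuclideanSpace ℝ (Fin 3)) ∈ bcvDomain m := by simp [bcvDomain, bcvF]
    have h0 := hh (OpenPartialHomeomorph.refl _) (by rw [chartedSpaceSelf_atlas]) 0 hp trivial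
    rw [chartMetric_euclideanPlane] at h0
    have h1 := (coordinateMap_planeMap f).eval_frameTension (m := m) (l := l) subset_rfl ⟨0, hp⟩ 0
    rw [h.frameTension_eq] at h1
    have h2 := h1.trans (congrFun h0 0)
    have h3 : eval (⟨0, hp⟩ : bcvOpens m) (algebraMap ℝ _ (-2 * μ)) = 0 := h2
    rw [eval_algebraMap] at h3
    exact h.μ_ne_zero (by linarith [show -2 * μ = 0 from h3])

end ExampleData

/-- For `m < 0` there is a proper biharmonic Riemannian submersion to the Euclidean plane. -/
theorem exists_isProperBiharmonic (l : ℝ) {m : ℝ} (hm : m < 0) :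
    ∃ π : EuclideanSpace ℝ (Fin 3) → EuclideanSpace ℝ (Fin 2),
      IsRiemannianSubmersion (bcvDomain m) (bcvMetric m l) euclideanPlane π ∧
      IsProperBiharmonic (bcvDomain m) (bcvMetric m l) euclideanPlane π := by
  obtain ⟨f, c, d, k, ν, μ, h⟩ := exists_exampleData l hm
  exact ⟨planeMap f, h.isRiemannianSubmersion, h.isProperBiharmonic⟩

end BCV

end

theorem theorem3p2 :
    (∀ (m l : ℝ) (N : Type*) [TopologicalSpace N] [ChartedSpace (EuclideanSpace ℝ (Fin 2)) N]
      [IsManifold 𝓘(ℝ, EuclideanSpace ℝ (Fin 2)) ∞ N]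
      (h : Bundle.ContMDiffRiemannianMetric 𝓘(ℝ, EuclideanSpace ℝ (Fin 2)) ∞
        (EuclideanSpace ℝ (Fin 2))
        (fun x : N => TangentSpace 𝓘(ℝ, EuclideanSpace ℝ (Fin 2)) x))
      (π : EuclideanSpace ℝ (Fin 3) → N),
      BCV.IsRiemannianSubmersion (BCV.bcvDomain m) (BCV.bcvMetric m l) h π →
      BCV.IsProperBiharmonic (BCV.bcvDomain m) (BCV.bcvMetric m l) h π →
        ((m < 0 ∧ l = 0) ∨ (m < 0 ∧ l ≠ 0)) ∧ BCV.IsLocallyFlat h) ∧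
    (∀ m l : ℝ, ((m < 0 ∧ l = 0) ∨ (m < 0 ∧ l ≠ 0)) →
      ∃ π : EuclideanSpace ℝ (Fin 3) → EuclideanSpace ℝ (Fin 2),
        BCV.IsRiemannianSubmersion (BCV.bcvDomain m) (BCV.bcvMetric m l) BCV.euclideanPlane π ∧
        BCV.IsProperBiharmonic (BCV.bcvDomain m) (BCV.bcvMetric m l) BCV.euclideanPlane π) := by
  constructor
  · intro m l N _ _ _ h π hπ hb
    have hm := BCV.neg_of_isProperBiharmonic hπ hb
    refine ⟨?_, BCV.isLocallyFlat_of_isProperBiharmonic hπ hb⟩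
    by_cases hl : l = 0
    · exact Or.inl ⟨hm, hl⟩
    · exact Or.inr ⟨hm, hl⟩
  · intro m l hml
    have hm : m < 0 := hml.elim And.left And.left
    exact BCV.exists_isProperBiharmonic l hm
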